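/- **Theorem 2.5 (FSP–LSE equivalence).** Let $n\in\{2,3\}$, $k>0$, and let $f\in L^2(\mathbb{R}^n)$ and $\mathfrak m\in L^\infty(\mathbb{R}^n)$ be complex-valued with compact (essential) support. Let $$\Phi(x,y)=\tfrac{\mathrm i}{4}H^{(1)}_0(k|x-y|)\ (n=2),\qquad \Phi(x,y)=\frac{\mathrm e^{\mathrm ik|x-y|}}{4\pi|x-y|}\ (n=3),$$ where $H^{(1)}_0$ is the Hankel function of the first kind of order $0$, and for $\psi\in L^2(\mathbb{R}^n)$ with compact support let $\mathcal V\psi(x)=\int_{\mathbb{R}^n}\Phi(x,y)\psi(y)\,dy$. For $s\ge 0$, $H^s_{\rm loc}(\mathbb{R}^n)$ denotes the set of distributions $u$ such that $\chi u\in H^s(\mathbb{R}^n)$ for every $\chi\in C^\infty_{\rm comp}(\mathbb{R}^n)$. We say that $u^{\rm s}\in H^1_{\rm loc}(\mathbb{R}^n)$ solves the full-space problem (FSP) if $$\Delta u^{\rm s}+k^2(1+\mathfrak m)u^{\rm s}=-f\quad\text{in }\mathbb{R}^n$$ in the sense of distributions, and $u^{\rm s}$ satisfies the Sommerfeld radiation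 condition $$\frac{\partial u^{\rm s}}{\partial r}(x)-\mathrm iku^{\rm s}(x)=o\bigl(r^{-(n-1)/2}\bigr)\quad\text{uniformly as } r=|x|\to\infty,$$ where the radial derivative is the classical one, of a representative of $u^{\rm s}$ that is differentiable outside some ball. (i) If $u^{\rm s}\in H^1_{\rm loc}(\mathbb{R}^n)$ solves the FSP, then $u^{\rm s}\in H^2_{\rm loc}(\mathbb{R}^n)\cap C^0(\mathbb{R}^n)$ and $u^{\rm s}$ satisfies the Lippmann–Schwinger equation (LSE) $$u^{\rm s}=\mathcal Vf+k^2\mathcal V(\mathfrak m u^{\rm s}),$$ i.e., for the continuous representative of $u^{\rm s}$, $$u^{\rm s}(x)=\int_{\mathbb{R}^n}\bigl(f(y)+k^2\mathfrak m(y)u^{\rm s}(y)\bigr)\Phi(x,y)\,dy\quad\text{for every }x\in\mathbb{R}^n,$$ with absolutely convergent integral. (ii) Conversely, if $u^{\rm s}\in L^2_{\rm loc}(\mathbb{R}^n)$ satisfies the LSE (almost everywhere), then $u^{\rm s}\in H^2_{\rm loc}(\mathbb{R}^n)\cap C^0(\mathbb{R}^n)$ and $u^{\rm s}$ solves the FSP.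 -/

import Mathlib

open MeasureTheory Filter Topology Asymptotics
open scoped ContDiff Laplacian SchwartzMap ENNReal

noncomputable section

namespace Helmholtz

/-- Euclidean space `ℝⁿ`. -/
abbrev E (n : ℕ) := EuclideanSpace ℝ (Fin n)

/-! Elements of `L²_loc`, `H^s_loc`, ... are represented by functions `u : ℝⁿ → ℂ`. Every notion
below is invariant under changing its function arguments on a Lebesgue null set. -/

/-- Test functions: elements of `C^∞_comp(ℝⁿ)`, complex valued. -/
def IsTestFunction {n : ℕ} (φ : E n → ℂ) : Prop :=
  ContDiff ℝ ∞ φ ∧ HasCompactSupport φ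

/-- The essential support of `g` is compact: `g` vanishes a.e. outside some compact set. -/
def HasCompactEssSupport {n : ℕ} (g : E n → ℂ) : Prop :=
  ∃ K : Set (E n), IsCompact K ∧ ∀ᵐ x : E n, x ∉ K → g x = 0

/-- `g ∈ L^p_comp(ℝⁿ)`. -/
def MemLpComp {n : ℕ} (p : ℝ≥0∞) (g : E n → ℂ) : Prop :=
  MemLp g p volume ∧ HasCompactEssSupport g

/-- `u ∈ L²_loc(ℝⁿ)`. -/
def MemL2Loc {n : ℕ} (u : E n → ℂ) : Prop :=
  ∀ K : Set (E n), IsCompact K → MemLp u 2 (volume.restrict K)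

/-- `u ∈ H^s_loc(ℝⁿ)`, for `s ≥ 0`: for every `χ ∈ C^∞_comp(ℝⁿ)` the product `χ u` lies in the
Bessel potential space `H^s(ℝⁿ)`. (For `s ≥ 0` such a `χ u` is in particular an `L²` function.) -/
def MemHLoc {n : ℕ} (s : ℝ) (u : E n → ℂ) : Prop :=
  ∀ χ : E n → ℂ, IsTestFunction χ →
    ∃ h : MemLp (fun x => χ x * u x) 2 (volume : Measure (E n)),
      TemperedDistribution.MemSobolev s 2
        (Lp.toTemperedDistribution (h.toLp (fun x => χ x * u x)))

/-- `u ∈ C⁰(ℝⁿ)` as an equivalence class: `u` has a continuous representative. -/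
def MemC0 {n : ℕ} (u : E n → ℂ) : Prop :=
  ∃ v : E n → ℂ, Continuous v ∧ v =ᵐ[volume] u

/-- `Δu + k²(1+m)u = -f` in `ℝⁿ`, in the sense of distributions. -/
def SolvesHelmholtz {n : ℕ} (k : ℝ) (m f u : E n → ℂ) : Prop :=
  ∀ φ : E n → ℂ, IsTestFunction φ →
    ∫ x, (u x * (Δ φ) x + (k : ℂ) ^ 2 * (1 + m x) * u x * φ x) = -∫ x, f x * φ x

/-- The Sommerfeld radiation condition `∂u/∂r - i k u = o(r^{-(n-1)/2})`, uniformly as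
`r = |x| → ∞`, the radial derivative being the classical one of a representative of `u` that is
differentiable outside some ball. -/
def SommerfeldRadiation {n : ℕ} (k : ℝ) (u : E n → ℂ) : Prop :=
  ∃ v : E n → ℂ, v =ᵐ[volume] u ∧
    (∀ᶠ x in Bornology.cobounded (E n), DifferentiableAt ℝ v x) ∧
    (fun x => fderiv ℝ v x (‖x‖⁻¹ • x) - Complex.I * k * v x)
      =o[Bornology.cobounded (E n)] fun x => ‖x‖ ^ (-(((n : ℝ) - 1) / 2))

/-- `u` is an `H¹_loc` solution of the full-space problem. -/
structure IsFSPSolution {n : ℕ} (k : ℝ) (m f u : E n → ℂ) : Prop where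
  memHLoc : MemHLoc 1 u
  helmholtz : SolvesHelmholtz k m f u
  radiation : SommerfeldRadiation k u

/-- The Bessel function `J₀` of a real argument. -/
def besselJ0 (x : ℝ) : ℝ :=
  ∑' j : ℕ, (-1) ^ j / (j.factorial : ℝ) ^ 2 * (x / 2) ^ (2 * j)

/-- The Bessel function of the second kind `Y₀`, for `x > 0`:
`Y₀(x) = (2/π)(log(x/2) + γ)J₀(x) - (2/π)∑_{j≥1} (-1)^j (1 + 1/2 + ⋯ + 1/j)/(j!)² (x/2)^{2j}`. -/
def besselY0 (x : ℝ) : ℝ :=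
  2 / Real.pi * (Real.log (x / 2) + Real.eulerMascheroniConstant) * besselJ0 x
    - 2 / Real.pi *
      ∑' j : ℕ, (-1) ^ j * (harmonic j : ℝ) / (j.factorial : ℝ) ^ 2 * (x / 2) ^ (2 * j)

/-- The Hankel function `H₀⁽¹⁾ = J₀ + i Y₀`, for `x > 0`. -/
def hankel0 (x : ℝ) : ℂ := (besselJ0 x : ℂ) + Complex.I * (besselY0 x : ℂ)

/-- The outgoing fundamental solution of the Helmholtz equation in `ℝⁿ`, for `n = 2` and `n = 3`
(it is used for no other `n`; the value at `x = y` is irrelevant). -/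
def Phi {n : ℕ} (k : ℝ) (x y : E n) : ℂ :=
  if n = 2 then Complex.I / 4 * hankel0 (k * ‖x - y‖)
  else Complex.exp (Complex.I * (k * ‖x - y‖ : ℝ)) / (4 * Real.pi * ‖x - y‖ : ℝ)

/-- The acoustic Newtonian potential `Vψ(x) = ∫ Φ(x,y) ψ(y) dy`. -/
def newton {n : ℕ} (k : ℝ) (ψ : E n → ℂ) (x : E n) : ℂ := ∫ y, Phi k x y * ψ y

/-- The Lippmann–Schwinger equation `u = Vf + k² V(m u)`, as an equality in `L²_loc`. -/
def SolvesLSE {n : ℕ} (k : ℝ) (m f u : E n → ℂ) : Prop :=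
  u =ᵐ[volume] fun x => newton k f x + (k : ℂ) ^ 2 * newton k (fun y => m y * u y) x

end Helmholtz

end

/-!
The theorem holds because `Φ` is the outgoing fundamental solution of the Helmholtz equation, and
because an entire solution of the homogeneous equation that radiates outwards is zero. Everything
that is needed about `Φ` is collected in `OutgoingKernel`: `Φ(x, y) = h(|x - y|)`, where `h` solves
the radial Helmholtz equation, is `O(r^{-(n-1)/2})`, satisfies the radiation condition with a power
of `r` to spare, and has flux `-1` through small spheres. The equivalence is proved for any such
kernel and any `n ≥ 2` (`OutgoingKernel.fsp_lse_equivalence`).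

From LSE to FSP. A solution of the LSE is a volume potential `u = Vψ` with `ψ = f + k²mu ∈ L²_comp`.
Replacing `|z|` by `√(|z|² + ε²)` gives smooth kernels which solve the Helmholtz equation up to an
approximate identity, so that `h(|z|)` is a fundamental solution and `Δu + k²u = -ψ`
(`integral_mul_helmholtz`, `integral_potential_mul_helmholtz`); they also approximate the kernel in
`L²_loc`, so that `u` is continuous (`continuous_potential`). The radiation condition passes from
the kernel to `u` (`radiation_potential`). As `u` and `Δu` are in `L²_loc`, elliptic regularity puts
`u` in `H²_loc` (`memHLoc_two`): the Bessel potential of order two is `1 - Δ/(4π²)`, and cutting off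
costs one derivative only.

From FSP to LSE. The difference `s = u - V(f + k²mu)` is a distributional solution of the
homogeneous equation. Bootstrapping elliptic regularity puts it in every `H^s_loc`, hence it is smooth
(`exists_contDiff_of_helmholtz`), and it radiates, as both terms do. That it vanishes
(`eq_zero_of_radiating`) is proved without spherical harmonics. Multiplying the equation by
`x · ∇s + (n-1)/2 s` and integrating against the weight `(R² - |x|²)₊²` gives a Rellich-Pohozaev
identity, which implies that the energy `P(R)` with this weight, divided by `(R + c)^5`, is
nondecreasing. As the energy flux of `s` through spheres vanishes, the same identity bounds `P(R)`
by an integral of `|∂s/∂r - iks|²`, which by the radiation condition is `o(R^4)`, with a factor `R + c`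
in front. So `P(R)/(R + c)^5` tends to zero, and `P = 0`.

In three dimensions the kernel is elementary. In two dimensions the Hankel function is given by its
power series, which says nothing about its behaviour at infinity. It is identified with a multiple
of the Laplace integral `e^{ix} ∫₀^∞ e^{-xs} (s² - 2is)^{-1/2} ds`, from which decay and radiation
are immediate (`hankel0_eq`). Both functions solve Bessel's equation; their logarithmic
singularities at `0` agree including the constant term, where Euler's constant enters through
`∫₀^∞ e^{-t} log t dt = -γ` (`tendsto_hmom_zero_add_log`); and a solution of Bessel's equation
without singularity that vanishes at `0` is zero, as `|D|² + |D'|²` is nonincreasing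
(`eq_zero_of_bessel`).
-/

noncomputable section

namespace Helmholtz

/-! ### Calculus: partial derivatives, the Laplacian, Green's identity -/

/-- The partial derivative in the `i`-th coordinate direction. -/
def pderiv {n : ℕ} (i : Fin n) (a : E n → ℂ) : E n → ℂ :=
  fun x => fderiv ℝ a x (EuclideanSpace.single i 1)

lemma contDiff_pderiv {n : ℕ} {a : E n → ℂ} {p q : WithTop ℕ∞} (ha : ContDiff ℝ q a)
    (h : p + 1 ≤ q) (i : Fin n) : ContDiff ℝ p (pderiv i a) :=
  (ha.fderiv_right h).clm_apply contDiff_const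

lemma hasCompactSupport_pderiv {n : ℕ} {a : E n → ℂ} (ha : HasCompactSupport a) (i : Fin n) :
    HasCompactSupport (pderiv i a) := ha.fderiv_apply ℝ _

lemma laplacian_eq_sum_pderiv {n : ℕ} {a : E n → ℂ} {x : E n} (ha : ContDiffAt ℝ 2 a x) :
    (Δ a) x = ∑ i, pderiv i (pderiv i a) x := by
  rw [InnerProductSpace.laplacian_eq_iteratedFDeriv_orthonormalBasis a
    (EuclideanSpace.basisFun (Fin n) ℝ)]
  refine Finset.sum_congr rfl fun i _ => ?_
  have h1 : DifferentiableAt ℝ (fderiv ℝ a) x :=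
    (ha.fderiv_right (m := 1) (by norm_num)).differentiableAt (by norm_num)
  have h2 : HasFDerivAt (pderiv i a)
      ((fderiv ℝ (fderiv ℝ a) x).flip (EuclideanSpace.single i 1)) x := by
    refine (h1.hasFDerivAt.clm_apply
      (hasFDerivAt_const (𝕜 := ℝ) (EuclideanSpace.single i (1 : ℝ)) x)).congr_fderiv ?_
    ext v; simp
  rw [iteratedFDeriv_two_apply]
  simp only [pderiv] at h2 ⊢
  rw [h2.fderiv]
  simp

lemma continuous_laplacian {n : ℕ} {a : E n → ℂ} (ha : ContDiff ℝ 2 a) : Continuous (Δ a) := by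
  have : Δ a = fun x => ∑ i, pderiv i (pderiv i a) x :=
    funext fun x => laplacian_eq_sum_pderiv ha.contDiffAt
  rw [this]
  refine continuous_finsetSum _ fun i _ => ?_
  exact (contDiff_pderiv (p := 0) (contDiff_pderiv (p := 1) ha (by norm_num) i)
    (by norm_num) i).continuous

lemma contDiff_laplacian {n : ℕ} {a : E n → ℂ} (ha : ContDiff ℝ ∞ a) : ContDiff ℝ ∞ (Δ a) := by
  have : Δ a = fun x => ∑ i, pderiv i (pderiv i a) x :=
    funext fun x => laplacian_eq_sum_pderiv
      (ha.of_le (by exact WithTop.coe_le_coe.2 le_top)).contDiffAt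
  rw [this]
  exact ContDiff.sum fun i _ =>
    contDiff_pderiv (q := ∞) (contDiff_pderiv (p := ∞) ha (by simp) i) (by simp) i

lemma hasCompactSupport_laplacian {n : ℕ} {a : E n → ℂ} (ha : HasCompactSupport a) :
    HasCompactSupport (Δ a) := by
  refine ha.mono' (fun x hx => ?_)
  by_contra hxs
  apply hx
  have h0 : a =ᶠ[𝓝 x] fun _ => 0 := notMem_tsupport_iff_eventuallyEq.1 hxs
  have := (InnerProductSpace.laplacian_congr_nhds h0).eq_of_nhds
  rw [this]
  exact congrFun (InnerProductSpace.laplacian_const (c := (0 : ℂ))) x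

lemma IsTestFunction.pderiv {n : ℕ} {φ : E n → ℂ} (h : IsTestFunction φ) (i : Fin n) :
    IsTestFunction (pderiv i φ) :=
  ⟨contDiff_pderiv h.1 (by simp) i, hasCompactSupport_pderiv h.2 i⟩

lemma IsTestFunction.laplacian {n : ℕ} {φ : E n → ℂ} (h : IsTestFunction φ) :
    IsTestFunction (Δ φ) :=
  ⟨contDiff_laplacian h.1, hasCompactSupport_laplacian h.2⟩

lemma IsTestFunction.contDiff_two {n : ℕ} {φ : E n → ℂ} (h : IsTestFunction φ) :
    ContDiff ℝ 2 φ := h.1.of_le (by exact WithTop.coe_le_coe.2 le_top)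

lemma pderiv_mul {n : ℕ} {a b : E n → ℂ} {x : E n} (ha : DifferentiableAt ℝ a x)
    (hb : DifferentiableAt ℝ b x) (i : Fin n) :
    pderiv i (fun y => a y * b y) x = a x * pderiv i b x + b x * pderiv i a x := by
  simp only [pderiv]
  rw [fderiv_fun_mul ha hb]; simp

lemma laplacian_mul {n : ℕ} {a b : E n → ℂ} (ha : ContDiff ℝ 2 a) (hb : ContDiff ℝ 2 b)
    (x : E n) :
    (Δ fun y => a y * b y) x
      = a x * (Δ b) x + 2 * ∑ i, pderiv i a x * pderiv i b x + b x * (Δ a) x := by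
  rw [laplacian_eq_sum_pderiv (ha.mul hb).contDiffAt, laplacian_eq_sum_pderiv ha.contDiffAt,
    laplacian_eq_sum_pderiv hb.contDiffAt, Finset.mul_sum, Finset.mul_sum, Finset.mul_sum,
    ← Finset.sum_add_distrib, ← Finset.sum_add_distrib]
  refine Finset.sum_congr rfl fun i _ => ?_
  have da := ha.differentiable (by norm_num)
  have db := hb.differentiable (by norm_num)
  have h1 : pderiv i (fun y => a y * b y)
      = fun y => a y * pderiv i b y + b y * pderiv i a y := by
    ext y; exact pderiv_mul (da y) (db y) i
  have da' := (contDiff_pderiv (p := 1) ha (by norm_num) i).differentiable (by norm_num)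
  have db' := (contDiff_pderiv (p := 1) hb (by norm_num) i).differentiable (by norm_num)
  have h2 : pderiv i (fun y => a y * pderiv i b y + b y * pderiv i a y) x
      = pderiv i (fun y => a y * pderiv i b y) x + pderiv i (fun y => b y * pderiv i a y) x := by
    change fderiv ℝ _ x _ = fderiv ℝ _ x _ + fderiv ℝ _ x _
    rw [fderiv_fun_add (f := fun y => a y * pderiv i b y) (g := fun y => b y * pderiv i a y)
      ((da x).mul (db' x)) ((db x).mul (da' x))]
    rfl
  rw [h1, h2, pderiv_mul (da x) (db' x), pderiv_mul (db x) (da' x)]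
  ring

lemma integral_mul_pderiv {n : ℕ} {a b : E n → ℂ} (ha : ContDiff ℝ 1 a) (hb : ContDiff ℝ 1 b)
    (hc : HasCompactSupport b) (i : Fin n) :
    ∫ x, a x * pderiv i b x = -∫ x, pderiv i a x * b x := by
  have ca := (contDiff_pderiv (p := 0) ha (by norm_num) i).continuous
  have cb := (contDiff_pderiv (p := 0) hb (by norm_num) i).continuous
  refine integral_mul_fderiv_eq_neg_fderiv_mul_of_integrable ?_ ?_ ?_ ?_ ?_
  · exact (ca.mul hb.continuous).integrable_of_hasCompactSupport hc.mul_left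
  · exact (ha.continuous.mul cb).integrable_of_hasCompactSupport
      (hasCompactSupport_pderiv hc i).mul_left
  · exact (ha.continuous.mul hb.continuous).integrable_of_hasCompactSupport hc.mul_left
  · exact fun x _ => ha.differentiable (by norm_num) x
  · exact fun x _ => hb.differentiable (by norm_num) x

/-- Green's second identity without boundary terms. -/
lemma integral_mul_laplacian_comm {n : ℕ} {a b : E n → ℂ} (ha : ContDiff ℝ 2 a)
    (hb : ContDiff ℝ 2 b) (hc : HasCompactSupport b) :
    ∫ x, a x * (Δ b) x = ∫ x, (Δ a) x * b x := by
  have ha1 := ha.of_le (m := 1) (by norm_num)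
  have hb1 := hb.of_le (m := 1) (by norm_num)
  have pa := fun i => contDiff_pderiv (p := 1) ha (by norm_num) i
  have pb := fun i => contDiff_pderiv (p := 1) hb (by norm_num) i
  simp only [laplacian_eq_sum_pderiv ha.contDiffAt, laplacian_eq_sum_pderiv hb.contDiffAt,
    Finset.mul_sum, Finset.sum_mul]
  rw [integral_finsetSum, integral_finsetSum]
  · refine Finset.sum_congr rfl fun i _ => ?_
    rw [integral_mul_pderiv ha1 (pb i) (hasCompactSupport_pderiv hc i),
      integral_mul_pderiv (pa i) hb1 hc, neg_neg]
  · exact fun i _ => ((contDiff_pderiv (p := 0) (pa i) (by norm_num) i).continuous.mul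
      hb.continuous).integrable_of_hasCompactSupport hc.mul_left
  · exact fun i _ => (ha.continuous.mul (contDiff_pderiv (p := 0) (pb i) (by norm_num)
      i).continuous).integrable_of_hasCompactSupport
        (hasCompactSupport_pderiv (hasCompactSupport_pderiv hc i) i).mul_left

/-! ### Radial functions -/

lemma hasFDerivAt_radial {n : ℕ} {g : ℝ → ℂ} {g' : ℂ} {c : ℝ} {x : E n}
    (hg : HasDerivAt g g' (‖x‖ ^ 2 + c)) :
    HasFDerivAt (fun y : E n => g (‖y‖ ^ 2 + c))
      (ContinuousLinearMap.smulRight (2 • innerSL ℝ x) g') x := by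
  have h1 : HasFDerivAt (fun y : E n => ‖y‖ ^ 2 + c) (2 • innerSL ℝ x) x := by
    have := (hasStrictFDerivAt_norm_sq x).hasFDerivAt.add_const c
    simpa using this
  refine (hg.hasFDerivAt.comp x h1).congr_fderiv ?_
  ext v
  simp [mul_assoc]

lemma pderiv_radial {n : ℕ} {g : ℝ → ℂ} {g' : ℂ} {c : ℝ} {x : E n}
    (hg : HasDerivAt g g' (‖x‖ ^ 2 + c)) (i : Fin n) :
    pderiv i (fun y : E n => g (‖y‖ ^ 2 + c)) x = 2 * x i * g' := by
  rw [pderiv, (hasFDerivAt_radial hg).fderiv]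
  simp [mul_assoc, EuclideanSpace.inner_single_right]

/-- The Laplacian of `g(|x|² + c)`. -/
lemma laplacian_radial {n : ℕ} {g g₁ g₂ : ℝ → ℂ} {c : ℝ}
    (hg : ∀ x : E n, HasDerivAt g (g₁ (‖x‖ ^ 2 + c)) (‖x‖ ^ 2 + c))
    (hg₁ : ∀ x : E n, HasDerivAt g₁ (g₂ (‖x‖ ^ 2 + c)) (‖x‖ ^ 2 + c))
    (hC : ContDiff ℝ 2 fun y : E n => g (‖y‖ ^ 2 + c)) (x : E n) :
    (Δ fun y : E n => g (‖y‖ ^ 2 + c)) x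
      = 4 * ‖x‖ ^ 2 * g₂ (‖x‖ ^ 2 + c) + 2 * n * g₁ (‖x‖ ^ 2 + c) := by
  rw [laplacian_eq_sum_pderiv hC.contDiffAt]
  have key : ∀ i, pderiv i (pderiv i fun y : E n => g (‖y‖ ^ 2 + c)) x
      = 4 * ((x i : ℂ)) ^ 2 * g₂ (‖x‖ ^ 2 + c) + 2 * g₁ (‖x‖ ^ 2 + c) := by
    intro i
    have h1 : (pderiv i fun y : E n => g (‖y‖ ^ 2 + c))
        = fun y : E n => (2 * (y i : ℂ)) * g₁ (‖y‖ ^ 2 + c) := by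
      ext y; exact pderiv_radial (hg y) i
    have h2 : HasFDerivAt (fun y : E n => (2 * (y i : ℂ)))
        ((2 : ℂ) • (Complex.ofRealCLM.comp (EuclideanSpace.proj i : E n →L[ℝ] ℝ))) x := by
      exact ((Complex.ofRealCLM.comp (EuclideanSpace.proj i : E n →L[ℝ] ℝ)).hasFDerivAt).const_mul 2
    rw [h1, pderiv_mul h2.differentiableAt (hasFDerivAt_radial (hg₁ x)).differentiableAt,
      pderiv_radial (hg₁ x)]
    rw [pderiv, h2.fderiv]
    simp
    ring
  rw [Finset.sum_congr rfl fun i _ => key i, Finset.sum_add_distrib, Finset.sum_const,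
    ← Finset.sum_mul, ← Finset.mul_sum]
  have : ((‖x‖ : ℂ)) ^ 2 = ∑ i, ((x i : ℂ)) ^ 2 := by
    have := EuclideanSpace.real_norm_sq_eq x
    exact_mod_cast this
  rw [this]; simp; ring

/-! ### Outgoing radial kernels and the fundamental solution -/

/-- The radial profile `h` (with derivative `h₁`) of an outgoing fundamental solution of the
Helmholtz equation in `ℝⁿ`: it solves `h'' + ((n-1)/r) h' + k² h = 0`, obeys decay and radiation
bounds (valid also as `r → 0`), and its flux through small spheres tends to `-1`; the normalization
uses that the unit sphere has area `n * vol(B₁)`. -/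
structure OutgoingKernel (n : ℕ) (k : ℝ) (h h₁ : ℝ → ℂ) : Prop where
  hasDerivAt : ∀ r, 0 < r → HasDerivAt h (h₁ r) r
  hasDerivAt₁ : ∀ r : ℝ, 0 < r → HasDerivAt h₁ (-(((n : ℂ) - 1) / r) * h₁ r - (k : ℂ) ^ 2 * h r) r
  bound : ∃ C, ∀ r : ℝ, 0 < r → ‖h r‖ ≤ C * r ^ (-(((n : ℝ) - 1) / 2))
  radiation : ∃ C, ∀ r : ℝ, 0 < r →
    ‖h₁ r - Complex.I * k * h r‖ ≤ C * r ^ (-(((n : ℝ) + 1) / 2))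
  flux_bound : ∃ C, ∀ r : ℝ, 0 < r → ‖(r : ℂ) ^ (n - 1) * h₁ r‖ ≤ C * (1 + r) ^ n
  flux : Tendsto (fun r : ℝ => (n : ℂ) * ((r : ℂ) ^ (n - 1) * h₁ r)) (𝓝[>] 0)
    (𝓝 (-((volume.real (Metric.ball (0 : E n) 1) : ℝ) : ℂ)⁻¹))

lemma hasDerivAt_bubble_primitive {n : ℕ} (hn : 0 < n) (r : ℝ) :
    HasDerivAt (fun r : ℝ => r ^ n / √(r ^ 2 + 1) ^ n / n)
      (r ^ (n - 1) * (√(r ^ 2 + 1) ^ (n + 2))⁻¹) r := by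
  obtain ⟨m, rfl⟩ : ∃ m, n = m + 1 := ⟨n - 1, by omega⟩
  have hw : 0 < √(r ^ 2 + 1) := Real.sqrt_pos.2 (by positivity)
  have hsq : √(r ^ 2 + 1) ^ 2 = r ^ 2 + 1 := Real.sq_sqrt (by positivity)
  have h1 : HasDerivAt (fun r : ℝ => √(r ^ 2 + 1)) (r / √(r ^ 2 + 1)) r := by
    have : HasDerivAt (fun r : ℝ => r ^ 2 + 1) (2 * r) r := by
      simpa using (hasDerivAt_pow 2 r).add_const 1
    convert! this.sqrt (by positivity) using 1
    field_simp
  have h2 := (((hasDerivAt_pow (m + 1) r).div (h1.pow (m + 1)) (pow_ne_zero _ hw.ne')).div_const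
    ((m + 1 : ℕ) : ℝ))
  convert! h2 using 1
  simp only [Nat.add_sub_cancel, Pi.pow_apply]
  set w := √(r ^ 2 + 1)
  have hm : ((m + 1 : ℕ) : ℝ) ≠ 0 := by positivity
  field_simp
  linear_combination (-(r ^ m * w ^ (2 * m + 3))) * hsq

lemma tendsto_bubble_primitive (n : ℕ) :
    Tendsto (fun r : ℝ => r ^ n / √(r ^ 2 + 1) ^ n / n) atTop (𝓝 (1 / n)) := by
  have h : Tendsto (fun r : ℝ => √(1 / (1 + (r⁻¹) ^ 2)) ^ n / n) atTop
      (𝓝 (√(1 / (1 + 0 ^ 2)) ^ n / n)) := by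
    have hc : ContinuousAt (fun t : ℝ => √(1 / (1 + t ^ 2)) ^ n / n) 0 := by
      refine ContinuousAt.div_const (ContinuousAt.pow (ContinuousAt.sqrt ?_) _) _
      exact ContinuousAt.div continuousAt_const (by fun_prop) (by norm_num)
    exact hc.tendsto.comp tendsto_inv_atTop_zero
  simp only [ne_eq, OfNat.ofNat_ne_zero, not_false_eq_true, zero_pow, add_zero, div_one,
    Real.sqrt_one, one_pow] at h
  refine h.congr' ?_
  filter_upwards [eventually_gt_atTop 0] with r hr
  rw [← div_pow]
  congr 2
  rw [show (1 : ℝ) / (1 + r⁻¹ ^ 2) = r ^ 2 / (r ^ 2 + 1) by field_simp,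
    Real.sqrt_div (by positivity), Real.sqrt_sq hr.le]

lemma integrable_bubble {n : ℕ} (hn : 0 < n) :
    Integrable fun y : E n => (√(‖y‖ ^ 2 + 1) ^ (n + 2))⁻¹ := by
  have : Nonempty (Fin n) := ⟨⟨0, hn⟩⟩
  rw [integrable_fun_norm_addHaar (volume : Measure (E n))
    (f := fun r : ℝ => (√(r ^ 2 + 1) ^ (n + 2))⁻¹)]
  rw [finrank_euclideanSpace_fin]
  exact integrableOn_Ioi_deriv_of_nonneg' (l := 1 / n) (fun r _ => hasDerivAt_bubble_primitive hn r)
    (fun r hr => by have : (0 : ℝ) < r := hr; positivity) (tendsto_bubble_primitive n)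

/-- The mass of `(|y|² + 1)^{-(n+2)/2}`, the profile of the approximate identity that arises in the
regularization of outgoing kernels. -/
lemma integral_bubble {n : ℕ} (hn : 0 < n) :
    ∫ y : E n, (√(‖y‖ ^ 2 + 1) ^ (n + 2))⁻¹ = volume.real (Metric.ball (0 : E n) 1) := by
  have : Nonempty (Fin n) := ⟨⟨0, hn⟩⟩
  rw [integral_fun_norm_addHaar (volume : Measure (E n))
    (fun r : ℝ => (√(r ^ 2 + 1) ^ (n + 2))⁻¹)]
  rw [finrank_euclideanSpace_fin]
  simp only [smul_eq_mul]
  rw [integral_Ioi_of_hasDerivAt_of_nonneg' (l := 1 / n)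
    (fun r _ => hasDerivAt_bubble_primitive hn r)
    (fun r hr => by have : (0 : ℝ) < r := hr; positivity) (tendsto_bubble_primitive n)]
  have : (n : ℝ) ≠ 0 := by positivity
  simp [hn.ne']
  field_simp

lemma sq_add_sq_pos {n : ℕ} {ε : ℝ} (hε : 0 < ε) (x : E n) : 0 < ‖x‖ ^ 2 + ε ^ 2 := by positivity

namespace OutgoingKernel

variable {n : ℕ} {k : ℝ} {h h₁ : ℝ → ℂ}

lemma contDiffAt_sqrt (H : OutgoingKernel n k h h₁) {s : ℝ} (hs : 0 < s) :
    ContDiffAt ℝ 2 (fun t => h √t) s := by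
  have hcd : ContDiffOn ℝ 2 h (Set.Ioi 0) := by
    have c0 : ContDiffOn ℝ 1 h₁ (Set.Ioi 0) := by
      rw [show (1 : WithTop ℕ∞) = 0 + 1 by norm_num,
        contDiffOn_succ_iff_deriv_of_isOpen isOpen_Ioi]
      refine ⟨fun r hr => (H.hasDerivAt₁ r hr).differentiableAt.differentiableWithinAt, by simp, ?_⟩
      refine ContDiffOn.congr (f := fun r : ℝ => -(((n : ℂ) - 1) / r) * h₁ r - (k : ℂ) ^ 2 * h r)
        ?_ (fun r hr => (H.hasDerivAt₁ r hr).deriv)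
      rw [contDiffOn_zero]
      intro r hr
      have h1 := (H.hasDerivAt₁ r hr).continuousAt
      have h2 := (H.hasDerivAt r hr).continuousAt
      have h3 : ((r : ℝ) : ℂ) ≠ 0 := by exact_mod_cast (ne_of_gt hr)
      refine ContinuousAt.continuousWithinAt ?_
      refine ContinuousAt.sub (ContinuousAt.mul (ContinuousAt.neg
        (ContinuousAt.div continuousAt_const (by fun_prop) h3)) h1) (continuousAt_const.mul h2)
    rw [show (2 : WithTop ℕ∞) = 1 + 1 by norm_num, contDiffOn_succ_iff_deriv_of_isOpen isOpen_Ioi]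
    exact ⟨fun r hr => (H.hasDerivAt r hr).differentiableAt.differentiableWithinAt, by simp,
      c0.congr fun r hr => (H.hasDerivAt r hr).deriv⟩
  have h1 : ContDiffAt ℝ 2 h √s := hcd.contDiffAt (Ioi_mem_nhds (Real.sqrt_pos.2 hs))
  exact h1.comp s (Real.contDiffAt_sqrt hs.ne')

lemma hasDerivAt_sqrt (H : OutgoingKernel n k h h₁) {s : ℝ} (hs : 0 < s) :
    HasDerivAt (fun t => h √t) (h₁ √s / (2 * √s : ℝ)) s := by
  have h2 := Real.hasDerivAt_sqrt hs.ne'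
  have h1 := (H.hasDerivAt _ (Real.sqrt_pos.2 hs)).scomp s h2
  convert! h1 using 1
  rw [Complex.real_smul]; push_cast; ring

lemma hasDerivAt_sqrt₁ (H : OutgoingKernel n k h h₁) {s : ℝ} (hs : 0 < s) :
    HasDerivAt (fun t => h₁ √t / (2 * √t : ℝ))
      (-(n * h₁ √s / (4 * √s ^ 3 : ℝ) + k ^ 2 * h √s / (4 * √s ^ 2 : ℝ))) s := by
  have hp := Real.sqrt_pos.2 hs
  have h2 := Real.hasDerivAt_sqrt hs.ne'
  have h1 := (H.hasDerivAt₁ _ hp).scomp s h2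
  have h3 := (h2.const_mul 2).ofReal_comp
  have hne : ((√s : ℝ) : ℂ) ≠ 0 := by exact_mod_cast hp.ne'
  have h4 := h1.fun_div h3 (by push_cast; exact mul_ne_zero two_ne_zero hne)
  convert! h4 using 1
  simp only [Complex.real_smul, Function.comp]
  push_cast
  field_simp
  ring

/-- The regularized kernel `h(√(|z|² + ε²))` solves the Helmholtz equation up to an approximate
identity at scale `ε`. -/
lemma laplacian_regularized (H : OutgoingKernel n k h h₁) {ε : ℝ} (hε : 0 < ε) (x : E n) :
    (Δ fun y : E n => h √(‖y‖ ^ 2 + ε ^ 2)) x + k ^ 2 * h √(‖x‖ ^ 2 + ε ^ 2)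
      = ε ^ 2 * (n * h₁ √(‖x‖ ^ 2 + ε ^ 2) / (√(‖x‖ ^ 2 + ε ^ 2) ^ 3 : ℝ)
        + k ^ 2 * h √(‖x‖ ^ 2 + ε ^ 2) / (√(‖x‖ ^ 2 + ε ^ 2) ^ 2 : ℝ)) := by
  have hlap := laplacian_radial (n := n) (c := ε ^ 2) (g := fun t => h √t)
    (g₁ := fun s => h₁ √s / (2 * √s : ℝ))
    (g₂ := fun s => -(n * h₁ √s / (4 * √s ^ 3 : ℝ) + k ^ 2 * h √s / (4 * √s ^ 2 : ℝ)))
    (fun x => H.hasDerivAt_sqrt (sq_add_sq_pos hε x))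
    (fun x => H.hasDerivAt_sqrt₁ (sq_add_sq_pos hε x)) ?_ x
  · rw [hlap]
    have hs := sq_add_sq_pos hε x
    have hp := Real.sqrt_pos.2 hs
    have hsq : ((√(‖x‖ ^ 2 + ε ^ 2) : ℝ) : ℂ) ^ 2 = ‖x‖ ^ 2 + ε ^ 2 := by
      exact_mod_cast Real.sq_sqrt hs.le
    set ρ := √(‖x‖ ^ 2 + ε ^ 2)
    have hne : (ρ : ℂ) ≠ 0 := by exact_mod_cast hp.ne'
    have hx : (‖x‖ : ℂ) ^ 2 = ρ ^ 2 - ε ^ 2 := by rw [hsq]; ring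
    rw [hx]
    push_cast
    field_simp
    ring
  · rw [contDiff_iff_contDiffAt]
    intro y
    exact ContDiffAt.comp (g := fun t => h √t) y (H.contDiffAt_sqrt (sq_add_sq_pos hε y))
      ((contDiff_norm_sq ℝ).add contDiff_const).contDiffAt

lemma contDiff_regularized (H : OutgoingKernel n k h h₁) {ε : ℝ} (hε : 0 < ε) :
    ContDiff ℝ 2 fun y : E n => h √(‖y‖ ^ 2 + ε ^ 2) := by
  rw [contDiff_iff_contDiffAt]
  intro y
  exact ContDiffAt.comp (g := fun t => h √t) y (H.contDiffAt_sqrt (sq_add_sq_pos hε y))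
    ((contDiff_norm_sq ℝ).add contDiff_const).contDiffAt

lemma exists_bound (H : OutgoingKernel n k h h₁) :
    ∃ C, 0 ≤ C ∧ ∀ r : ℝ, 0 < r → ‖h r‖ ≤ C * r ^ (-(((n : ℝ) - 1) / 2)) := by
  obtain ⟨C, hC⟩ := H.bound
  refine ⟨C, ?_, hC⟩
  have := (norm_nonneg _).trans (hC 1 one_pos)
  simpa using this

lemma continuousOn (H : OutgoingKernel n k h h₁) : ContinuousOn h (Set.Ioi 0) :=
  fun r hr => (H.hasDerivAt r hr).continuousAt.continuousWithinAt

lemma aestronglyMeasurable (H : OutgoingKernel n k h h₁) (hn : 2 ≤ n) :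
    AEStronglyMeasurable (fun z : E n => h ‖z‖) := by
  have : Nonempty (Fin n) := ⟨⟨0, by omega⟩⟩
  have h1 : ContinuousOn (fun z : E n => h ‖z‖) {0}ᶜ :=
    H.continuousOn.comp continuous_norm.continuousOn fun z hz => by simpa using hz
  have h2 := h1.aestronglyMeasurable (μ := volume) (MeasurableSet.singleton _).compl
  rwa [restrict_compl_singleton] at h2

lemma norm_regularized_le (_ : OutgoingKernel n k h h₁) (hn : 2 ≤ n) {C : ℝ} (hC0 : 0 ≤ C)
    (hC : ∀ r : ℝ, 0 < r → ‖h r‖ ≤ C * r ^ (-(((n : ℝ) - 1) / 2))) {ε : ℝ} (hε : 0 < ε) {z : E n}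
    (hz : z ≠ 0) : ‖h √(‖z‖ ^ 2 + ε ^ 2)‖ ≤ C * ‖z‖ ^ (-(((n : ℝ) - 1) / 2)) := by
  refine (hC _ (Real.sqrt_pos.2 (sq_add_sq_pos hε z))).trans ?_
  refine mul_le_mul_of_nonneg_left ?_ hC0
  have hn' : (2 : ℝ) ≤ n := by exact_mod_cast hn
  refine Real.rpow_le_rpow_of_nonpos (norm_pos_iff.2 hz) ?_ (by linarith)
  exact Real.le_sqrt_of_sq_le (by nlinarith)

lemma tendsto_regularized (H : OutgoingKernel n k h h₁) {z : E n} (hz : z ≠ 0) :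
    Tendsto (fun ε : ℝ => h √(‖z‖ ^ 2 + ε ^ 2)) (𝓝[>] 0) (𝓝 (h ‖z‖)) := by
  have h1 := (H.hasDerivAt _ (norm_pos_iff.2 hz)).continuousAt
  have h2 : Tendsto (fun ε : ℝ => √(‖z‖ ^ 2 + ε ^ 2)) (𝓝 0) (𝓝 ‖z‖) := by
    have : Continuous fun ε : ℝ => √(‖z‖ ^ 2 + ε ^ 2) := by fun_prop
    simpa using this.tendsto 0
  exact (h1.tendsto.comp h2).mono_left nhdsWithin_le_nhds

/-- `h(|z|)` is a fundamental solution of the Helmholtz equation. -/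
theorem integral_mul_helmholtz (H : OutgoingKernel n k h h₁) (hn : 2 ≤ n) {φ : E n → ℂ}
    (hφ : ContDiff ℝ 2 φ) (hc : HasCompactSupport φ) :
    ∫ z, h ‖z‖ * ((Δ φ) z + k ^ 2 * φ z) = -φ 0 := by
  have : Nonempty (Fin n) := ⟨⟨0, by omega⟩⟩
  have hn0 : 0 < n := by omega
  obtain ⟨C, hC0, hC⟩ := H.exists_bound
  have hn' : (2 : ℝ) ≤ n := by exact_mod_cast hn
  set ψ : E n → ℂ := fun z => (Δ φ) z + k ^ 2 * φ z with hψ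
  have hψc : Continuous ψ := (continuous_laplacian hφ).add (continuous_const.mul hφ.continuous)
  have hψs : HasCompactSupport ψ := (hasCompactSupport_laplacian hc).add hc.mul_left
  have hz0 : ∀ᵐ z : E n, z ≠ 0 := by simp [ae_iff]
  -- the regularized integrals converge to the left-hand side
  have lim1 : Tendsto (fun ε : ℝ => ∫ z : E n, h √(‖z‖ ^ 2 + ε ^ 2) * ψ z) (𝓝[>] 0)
      (𝓝 (∫ z, h ‖z‖ * ψ z)) := by
    refine tendsto_integral_filter_of_dominated_convergence
      (fun z : E n => C * ‖z‖ ^ (-(((n : ℝ) - 1) / 2)) * ‖ψ z‖) ?_ ?_ ?_ ?_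
    · filter_upwards [self_mem_nhdsWithin] with ε hε
      exact ((H.contDiff_regularized hε).continuous.mul hψc).aestronglyMeasurable
    · filter_upwards [self_mem_nhdsWithin] with ε hε
      filter_upwards [hz0] with z hz
      rw [norm_mul]
      exact mul_le_mul_of_nonneg_right (H.norm_regularized_le hn hC0 hC hε hz) (norm_nonneg _)
    · have hm : Measurable fun z : E n => C * ‖z‖ ^ (-(((n : ℝ) - 1) / 2)) := by fun_prop
      have hl : LocallyIntegrable fun z : E n => C * ‖z‖ ^ (-(((n : ℝ) - 1) / 2)) := by
        refine locallyIntegrable_of_norm_le_rpow (C := C) (α := ((n : ℝ) - 1) / 2) ?_ ?_ ?_ ?_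
        · rw [finrank_euclideanSpace_fin]; omega
        · simp; linarith
        · refine Eventually.of_forall fun z => ?_
          rw [Real.norm_of_nonneg (by positivity)]
        · exact hm.aestronglyMeasurable
      have := hl.integrable_smul_left_of_hasCompactSupport hψc.norm hψs.norm
      simpa [mul_comm] using this
    · filter_upwards [hz0] with z hz
      exact (H.tendsto_regularized hz).mul_const _
  -- moving the derivatives to the kernel and substituting `z = ε y` turns them into integrals
  -- against an approximate identity, up to the factor `Q`, which tends to a constant at `0`
  set Q : ℝ → ℂ := fun ρ => n * ((ρ : ℂ) ^ (n - 1) * h₁ ρ) + k ^ 2 * ((ρ : ℂ) ^ n * h ρ) with hQ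
  have eq2 : ∀ ε : ℝ, 0 < ε → ∫ z : E n, h √(‖z‖ ^ 2 + ε ^ 2) * ψ z
      = ∫ y : E n, Q (ε * √(‖y‖ ^ 2 + 1)) * (√(‖y‖ ^ 2 + 1) ^ (n + 2))⁻¹ * φ (ε • y) := by
    intro ε hε
    have e1 : ∫ z : E n, h √(‖z‖ ^ 2 + ε ^ 2) * ψ z
        = ∫ z : E n, ((Δ fun y : E n => h √(‖y‖ ^ 2 + ε ^ 2)) z
          + k ^ 2 * h √(‖z‖ ^ 2 + ε ^ 2)) * φ z := by
      have hr := H.contDiff_regularized (n := n) hε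
      have g := integral_mul_laplacian_comm hr hφ hc
      simp only [hψ, mul_add, add_mul]
      rw [integral_add, integral_add, g]
      · congr 1
        refine integral_congr_ae (Eventually.of_forall fun z => ?_)
        simp only; ring
      · exact ((continuous_laplacian hr).mul hφ.continuous).integrable_of_hasCompactSupport
          hc.mul_left
      · exact ((continuous_const.mul hr.continuous).mul
          hφ.continuous).integrable_of_hasCompactSupport hc.mul_left
      · exact (hr.continuous.mul (continuous_laplacian hφ)).integrable_of_hasCompactSupport
          (hasCompactSupport_laplacian hc).mul_left
      · exact (hr.continuous.mul (continuous_const.mul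
          hφ.continuous)).integrable_of_hasCompactSupport hc.mul_left.mul_left
    rw [e1]
    have e2 := Measure.integral_comp_smul (volume : Measure (E n)) (fun z : E n =>
      ((Δ fun y : E n => h √(‖y‖ ^ 2 + ε ^ 2)) z + k ^ 2 * h √(‖z‖ ^ 2 + ε ^ 2)) * φ z) ε
    rw [finrank_euclideanSpace_fin, abs_of_pos (by positivity)] at e2
    have e3 : ∀ I : ℂ, I = ε ^ n * ((ε ^ n)⁻¹ • I : ℂ) := by
      intro I
      have : (ε : ℂ) ≠ 0 := by exact_mod_cast hε.ne'
      rw [← Complex.ofReal_pow, ← Complex.real_smul, smul_smul,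
        mul_inv_cancel₀ (by positivity), one_smul]
    rw [e3 (∫ z : E n, _), ← e2, ← integral_const_mul]
    refine integral_congr_ae (Eventually.of_forall fun y => ?_)
    simp only
    rw [H.laplacian_regularized hε]
    have hw : 0 < √(‖y‖ ^ 2 + 1) := Real.sqrt_pos.2 (by positivity)
    have hρ : √(‖ε • y‖ ^ 2 + ε ^ 2) = ε * √(‖y‖ ^ 2 + 1) := by
      rw [norm_smul, Real.norm_of_nonneg hε.le,
        show (ε * ‖y‖) ^ 2 + ε ^ 2 = ε ^ 2 * (‖y‖ ^ 2 + 1) by ring,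
        Real.sqrt_mul (by positivity), Real.sqrt_sq hε.le]
    rw [hρ]
    simp only [hQ]
    set w := √(‖y‖ ^ 2 + 1)
    obtain ⟨m, rfl⟩ : ∃ m, n = m + 1 := ⟨n - 1, by omega⟩
    have hε' : (ε : ℂ) ≠ 0 := by exact_mod_cast hε.ne'
    have hw' : (w : ℂ) ≠ 0 := by exact_mod_cast hw.ne'
    simp only [Nat.add_sub_cancel]
    push_cast
    field_simp
    ring
  have hfl : Tendsto Q (𝓝[>] 0) (𝓝 (-((volume.real (Metric.ball (0 : E n) 1) : ℝ) : ℂ)⁻¹)) := by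
    have hz : Tendsto (fun ρ : ℝ => (k : ℂ) ^ 2 * ((ρ : ℂ) ^ n * h ρ)) (𝓝[>] 0)
        (𝓝 ((k : ℂ) ^ 2 * 0)) := by
      refine Tendsto.const_mul _ ?_
      refine squeeze_zero_norm' (a := fun ρ : ℝ => C * ρ ^ (((n : ℝ) + 1) / 2)) ?_ ?_
      · filter_upwards [self_mem_nhdsWithin] with ρ hρ
        have hρ : 0 < ρ := hρ
        rw [norm_mul, norm_pow, Complex.norm_real, Real.norm_of_nonneg hρ.le]
        refine (mul_le_mul_of_nonneg_left (hC ρ hρ) (by positivity)).trans_eq ?_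
        rw [mul_left_comm, ← Real.rpow_natCast, ← Real.rpow_add hρ]
        congr 2; ring
      · have : Tendsto (fun ρ : ℝ => C * ρ ^ (((n : ℝ) + 1) / 2)) (𝓝 0)
            (𝓝 (C * 0 ^ (((n : ℝ) + 1) / 2))) :=
          ((Real.continuous_rpow_const (by positivity)).tendsto 0).const_mul C
        rw [Real.zero_rpow (by positivity), mul_zero] at this
        exact this.mono_left nhdsWithin_le_nhds
    simpa using H.flux.add hz
  obtain ⟨C₁, hC₁⟩ := H.flux_bound
  have hC₁0 : 0 ≤ C₁ := by
    have := (norm_nonneg _).trans (hC₁ 1 one_pos)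
    exact nonneg_of_mul_nonneg_left this (by positivity)
  obtain ⟨M, hM0, hM⟩ := hc.isCompact.isBounded.exists_pos_norm_le
  obtain ⟨Cφ, hCφ⟩ := hφ.continuous.bounded_above_of_compact_support hc
  set B : ℝ := n * (C₁ * (1 + √(M ^ 2 + 1)) ^ n) + k ^ 2 * (C * √(M ^ 2 + 1) ^ (((n : ℝ) + 1) / 2))
  have hQb : ∀ ρ, 0 < ρ → ρ ≤ √(M ^ 2 + 1) → ‖Q ρ‖ ≤ B := by
    intro ρ hρ hρM
    refine (norm_add_le _ _).trans (add_le_add ?_ ?_)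
    · rw [norm_mul, Complex.norm_natCast]
      refine mul_le_mul_of_nonneg_left ((hC₁ ρ hρ).trans ?_) (by positivity)
      gcongr
    · rw [norm_mul, norm_pow, Complex.norm_real, Real.norm_eq_abs, sq_abs]
      refine mul_le_mul_of_nonneg_left ?_ (by positivity)
      rw [norm_mul, norm_pow, Complex.norm_real, Real.norm_of_nonneg hρ.le]
      refine (mul_le_mul_of_nonneg_left (hC ρ hρ) (by positivity)).trans ?_
      rw [mul_left_comm, ← Real.rpow_natCast, ← Real.rpow_add hρ]
      refine mul_le_mul_of_nonneg_left ?_ hC0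
      rw [show (n : ℝ) + -(((n : ℝ) - 1) / 2) = ((n : ℝ) + 1) / 2 by ring]
      exact Real.rpow_le_rpow hρ.le hρM (by positivity)
  have lim2 : Tendsto (fun ε : ℝ => ∫ y : E n,
      Q (ε * √(‖y‖ ^ 2 + 1)) * (√(‖y‖ ^ 2 + 1) ^ (n + 2))⁻¹ * φ (ε • y)) (𝓝[>] 0)
      (𝓝 (∫ y : E n, -((volume.real (Metric.ball (0 : E n) 1) : ℝ) : ℂ)⁻¹ *
        (√(‖y‖ ^ 2 + 1) ^ (n + 2))⁻¹ * φ 0)) := by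
    refine tendsto_integral_filter_of_dominated_convergence
      (fun y : E n => (B * Cφ) * (√(‖y‖ ^ 2 + 1) ^ (n + 2))⁻¹) ?_ ?_ ?_ ?_
    · filter_upwards [self_mem_nhdsWithin] with ε hε
      have hε : 0 < ε := hε
      have hQc : ContinuousOn Q (Set.Ioi 0) := by
        intro r hr
        have h1 := (H.hasDerivAt₁ r hr).continuousAt
        have h2 := (H.hasDerivAt r hr).continuousAt
        refine ContinuousAt.continuousWithinAt ?_
        simp only [hQ]
        fun_prop
      have c1 : Continuous fun y : E n => Q (ε * √(‖y‖ ^ 2 + 1)) := by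
        refine hQc.comp_continuous (by fun_prop) fun y => ?_
        exact mul_pos hε (Real.sqrt_pos.2 (by positivity))
      have c2 : Continuous fun y : E n => (((√(‖y‖ ^ 2 + 1) ^ (n + 2))⁻¹ : ℝ) : ℂ) := by
        refine Complex.continuous_ofReal.comp (Continuous.inv₀ (by fun_prop) fun y => ?_)
        have : 0 < √(‖y‖ ^ 2 + 1) := Real.sqrt_pos.2 (by positivity)
        exact pow_ne_zero _ this.ne'
      exact ((c1.mul c2).mul (hφ.continuous.comp (continuous_const_smul ε))).aestronglyMeasurable
    · have : Set.Ioc (0 : ℝ) 1 ∈ 𝓝[>] (0 : ℝ) := Ioc_mem_nhdsGT one_pos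
      filter_upwards [this] with ε hε
      refine Eventually.of_forall fun y => ?_
      have hw : 0 < √(‖y‖ ^ 2 + 1) := Real.sqrt_pos.2 (by positivity)
      by_cases hy : ε • y ∈ tsupport φ
      · have h1 := hM _ hy
        have hρ : ε * √(‖y‖ ^ 2 + 1) ≤ √(M ^ 2 + 1) := by
          have : ε * √(‖y‖ ^ 2 + 1) = √(‖ε • y‖ ^ 2 + ε ^ 2) := by
            rw [norm_smul, Real.norm_of_nonneg hε.1.le,
              show (ε * ‖y‖) ^ 2 + ε ^ 2 = ε ^ 2 * (‖y‖ ^ 2 + 1) by ring,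
              Real.sqrt_mul (by positivity), Real.sqrt_sq hε.1.le]
          rw [this]
          refine Real.sqrt_le_sqrt (add_le_add (by gcongr) ?_)
          nlinarith [hε.1, hε.2]
        have h2 := hQb _ (mul_pos hε.1 hw) hρ
        rw [norm_mul, norm_mul, Complex.norm_real, Real.norm_of_nonneg (by positivity)]
        have h3 := mul_le_mul h2 (hCφ (ε • y)) (norm_nonneg _) ((norm_nonneg _).trans h2)
        calc _ = ‖Q (ε * √(‖y‖ ^ 2 + 1))‖ * ‖φ (ε • y)‖ * (√(‖y‖ ^ 2 + 1) ^ (n + 2))⁻¹ := by ring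
          _ ≤ _ := mul_le_mul_of_nonneg_right h3 (by positivity)
      · rw [image_eq_zero_of_notMem_tsupport hy]
        have hB : 0 ≤ B := by
          have hp : 0 < √(M ^ 2 + 1) := Real.sqrt_pos.2 (by positivity)
          exact (norm_nonneg _).trans (hQb _ hp le_rfl)
        have hCφ0 : 0 ≤ Cφ := (norm_nonneg _).trans (hCφ 0)
        simp only [mul_zero, norm_zero]
        positivity
    · exact (integrable_bubble hn0).const_mul _
    · refine Eventually.of_forall fun y => ?_
      have hw : 0 < √(‖y‖ ^ 2 + 1) := Real.sqrt_pos.2 (by positivity)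
      refine Tendsto.mul (Tendsto.mul_const _ ?_) ?_
      · refine hfl.comp ?_
        refine tendsto_nhdsWithin_iff.2 ⟨?_, ?_⟩
        · have : Tendsto (fun ε : ℝ => ε * √(‖y‖ ^ 2 + 1)) (𝓝 0) (𝓝 (0 * √(‖y‖ ^ 2 + 1))) :=
            (continuous_id.mul continuous_const).tendsto 0
          rw [zero_mul] at this
          exact this.mono_left nhdsWithin_le_nhds
        · filter_upwards [self_mem_nhdsWithin] with ε hε
          exact mul_pos hε hw
      · have : Tendsto (fun ε : ℝ => φ (ε • y)) (𝓝 0) (𝓝 (φ ((0 : ℝ) • y))) := by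
          have c : Continuous fun ε : ℝ => φ (ε • y) :=
            hφ.continuous.comp (continuous_id.smul continuous_const)
          exact c.tendsto 0
        rw [zero_smul] at this
        exact this.mono_left nhdsWithin_le_nhds
  have e4 : ∫ y : E n, -((volume.real (Metric.ball (0 : E n) 1) : ℝ) : ℂ)⁻¹ *
        (√(‖y‖ ^ 2 + 1) ^ (n + 2))⁻¹ * φ 0 = -φ 0 := by
    rw [integral_mul_const, integral_const_mul]
    have h1 : ∫ y : E n, (((√(‖y‖ ^ 2 + 1) ^ (n + 2))⁻¹ : ℝ) : ℂ)
        = ((volume.real (Metric.ball (0 : E n) 1) : ℝ) : ℂ) := by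
      rw [← integral_bubble hn0, ← integral_complex_ofReal]
    rw [h1]
    have h2 : ((volume.real (Metric.ball (0 : E n) 1) : ℝ) : ℂ) ≠ 0 := by
      have : 0 < volume.real (Metric.ball (0 : E n) 1) :=
        ENNReal.toReal_pos (Metric.measure_ball_pos _ _ one_pos).ne' measure_ball_lt_top.ne
      exact_mod_cast this.ne'
    field_simp
  rw [e4] at lim2
  refine tendsto_nhds_unique lim1 (lim2.congr' ?_)
  filter_upwards [self_mem_nhdsWithin] with ε hε
  exact (eq2 ε hε).symm

end OutgoingKernel

/-! ### The volume potential of a compactly supported density -/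

lemma MemLpComp.exists_radius {n : ℕ} {p : ℝ≥0∞} {ψ : E n → ℂ} (hψ : MemLpComp p ψ) :
    ∃ R, 0 < R ∧ ∀ᵐ y : E n, ψ y = 0 ∨ ‖y‖ < R := by
  obtain ⟨K, hK, hKψ⟩ := hψ.2
  obtain ⟨R, hR, hKR⟩ := hK.isBounded.exists_pos_norm_lt
  refine ⟨R, hR, hKψ.mono fun y hy => ?_⟩
  by_cases h : y ∈ K
  · exact Or.inr (hKR y h)
  · exact Or.inl (hy h)

lemma MemLpComp.integrable {n : ℕ} {ψ : E n → ℂ} (hψ : MemLpComp 2 ψ) : Integrable ψ := by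
  obtain ⟨R, hR, hψR⟩ := hψ.exists_radius
  have h1 : IntegrableOn ψ (Metric.ball 0 R) := by
    have : IsFiniteMeasure (volume.restrict (Metric.ball (0 : E n) R)) :=
      ⟨by simpa using measure_ball_lt_top⟩
    exact (hψ.1.restrict _).integrable (by norm_num)
  have h2 : (Metric.ball (0 : E n) R).indicator ψ =ᵐ[volume] ψ := by
    filter_upwards [hψR] with y hy
    rcases hy with hy | hy
    · by_cases h : y ∈ Metric.ball (0 : E n) R <;> simp [h, hy]
    · rw [Set.indicator_of_mem]; simpa using hy
  exact ((integrable_indicator_iff measurableSet_ball).2 h1).congr h2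

/-- The volume potential with radial kernel `h`. -/
def potential {n : ℕ} (h : ℝ → ℂ) (ψ : E n → ℂ) (x : E n) : ℂ := ∫ y, h ‖x - y‖ * ψ y

lemma laplacian_comp_add_right {n : ℕ} {φ : E n → ℂ} (hφ : ContDiff ℝ 2 φ) (y z : E n) :
    (Δ fun x => φ (x + y)) z = (Δ φ) (z + y) := by
  have hφ' : ContDiff ℝ 2 fun x => φ (x + y) := hφ.comp (contDiff_id.add contDiff_const)
  rw [laplacian_eq_sum_pderiv hφ'.contDiffAt, laplacian_eq_sum_pderiv hφ.contDiffAt]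
  have key : ∀ (a : E n → ℂ) (i : Fin n), pderiv i (fun x => a (x + y))
      = fun x => pderiv i a (x + y) := by
    intro a i; ext x
    simp only [pderiv, fderiv_comp_add_right]
  simp only [key]

namespace OutgoingKernel

variable {n : ℕ} {k : ℝ} {h h₁ : ℝ → ℂ} {ψ : E n → ℂ}

/-- The kernel cut off to a ball. -/
def trunc (n : ℕ) (h : ℝ → ℂ) (R : ℝ) : E n → ℂ :=
  (Metric.ball (0 : E n) R).indicator fun z => h ‖z‖

lemma integrableOn_rpow_norm (hn : 2 ≤ n) (C R : ℝ) :
    IntegrableOn (fun z : E n => C * ‖z‖ ^ (-((n : ℝ) - 1))) (Metric.ball 0 R) := by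
  refine integrableOn_ball_of_norm_le_rpow (C := |C|) (α := (n : ℝ) - 1) ?_ ?_ ?_ ?_
  · rw [finrank_euclideanSpace_fin]; omega
  · simp
  · refine Eventually.of_forall fun z => ?_
    rw [norm_mul, Real.norm_eq_abs, Real.norm_of_nonneg (by positivity)]
  · have : Measurable fun z : E n => C * ‖z‖ ^ (-((n : ℝ) - 1)) := by fun_prop
    exact this.aestronglyMeasurable

lemma aestronglyMeasurable_trunc (H : OutgoingKernel n k h h₁) (hn : 2 ≤ n) (R : ℝ) :
    AEStronglyMeasurable (trunc n h R) :=
  (H.aestronglyMeasurable hn).indicator measurableSet_ball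

lemma rpow_half_sq {r a : ℝ} (hr : 0 < r) : (r ^ (-(a / 2))) ^ 2 = r ^ (-a) := by
  rw [← Real.rpow_natCast, ← Real.rpow_mul hr.le]
  congr 1; push_cast; ring

lemma memLp_trunc (H : OutgoingKernel n k h h₁) (hn : 2 ≤ n) (R : ℝ) :
    MemLp (trunc n h R) 2 := by
  have : Nonempty (Fin n) := ⟨⟨0, by omega⟩⟩
  rw [memLp_two_iff_integrable_sq_norm (H.aestronglyMeasurable_trunc hn R)]
  obtain ⟨C, hC0, hC⟩ := H.exists_bound
  have h1 := (integrable_indicator_iff measurableSet_ball).2 (integrableOn_rpow_norm hn (C ^ 2) R)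
  refine h1.mono' ((H.aestronglyMeasurable_trunc hn R).norm.pow 2) ?_
  have hz0 : ∀ᵐ z : E n, z ≠ 0 := by simp [ae_iff]
  filter_upwards [hz0] with z hz
  by_cases hzR : z ∈ Metric.ball (0 : E n) R
  · rw [trunc, Set.indicator_of_mem hzR, Set.indicator_of_mem hzR,
      Real.norm_of_nonneg (by positivity),
      ← rpow_half_sq (norm_pos_iff.2 hz), ← mul_pow]
    gcongr
    exact hC _ (norm_pos_iff.2 hz)
  · simp [trunc, hzR]

lemma integrable_trunc (H : OutgoingKernel n k h h₁) (hn : 2 ≤ n) (R : ℝ) :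
    Integrable (trunc n h R) := by
  refine MemLpComp.integrable ⟨H.memLp_trunc hn R, Metric.closedBall 0 R,
    isCompact_closedBall _ _, Eventually.of_forall fun x hx => ?_⟩
  rw [trunc, Set.indicator_of_notMem]
  exact fun h => hx (Metric.ball_subset_closedBall h)

lemma potential_integrand_eq_trunc {R R' : ℝ} (hψR : ∀ᵐ y : E n, ψ y = 0 ∨ ‖y‖ < R) {x : E n}
    (hx : ‖x‖ + R ≤ R') :
    (fun y => h ‖x - y‖ * ψ y) =ᵐ[volume] fun y => trunc n h R' (x - y) * ψ y := by
  filter_upwards [hψR] with y hy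
  rcases hy with hy | hy
  · simp [hy]
  · rw [trunc, Set.indicator_of_mem]
    rw [mem_ball_zero_iff]
    exact (norm_sub_le _ _).trans_lt (by linarith)

lemma integrable_potential_integrand (H : OutgoingKernel n k h h₁) (hn : 2 ≤ n)
    (hψ : MemLpComp 2 ψ) (x : E n) : Integrable fun y => h ‖x - y‖ * ψ y := by
  obtain ⟨R, hR, hψR⟩ := hψ.exists_radius
  refine Integrable.congr ?_ (potential_integrand_eq_trunc hψR (le_refl (‖x‖ + R))).symm
  have h1 : MemLp (fun y => trunc n h (‖x‖ + R) (x - y)) 2 :=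
    (H.memLp_trunc hn _).comp_measurePreserving (Measure.measurePreserving_sub_left volume x)
  exact h1.integrable_mul hψ.1

lemma continuous_regularized (H : OutgoingKernel n k h h₁) {ε : ℝ} (hε : 0 < ε) :
    Continuous fun z : E n => h √(‖z‖ ^ 2 + ε ^ 2) := (H.contDiff_regularized hε).continuous

/-- The regularized kernels converge in `L²_loc`. This uses `|z|^{-(n-1)} ∈ L¹_loc`. -/
lemma tendsto_integral_sq_regularized_sub (H : OutgoingKernel n k h h₁) (hn : 2 ≤ n) (R : ℝ) :
    Tendsto (fun ε : ℝ => ∫ z in Metric.ball (0 : E n) R, ‖h √(‖z‖ ^ 2 + ε ^ 2) - h ‖z‖‖ ^ 2)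
      (𝓝[>] 0) (𝓝 0) := by
  have : Nonempty (Fin n) := ⟨⟨0, by omega⟩⟩
  obtain ⟨C, hC0, hC⟩ := H.exists_bound
  have hz0 : ∀ᵐ z : E n ∂(volume.restrict (Metric.ball 0 R)), z ≠ 0 :=
    ae_restrict_of_ae (by simp [ae_iff])
  have := tendsto_integral_filter_of_dominated_convergence
    (μ := volume.restrict (Metric.ball (0 : E n) R)) (l := 𝓝[>] (0 : ℝ))
    (F := fun ε z => ‖h √(‖z‖ ^ 2 + ε ^ 2) - h ‖z‖‖ ^ 2) (f := fun _ => (0 : ℝ))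
    (fun z : E n => (2 * C) ^ 2 * ‖z‖ ^ (-((n : ℝ) - 1))) ?_ ?_ ?_ ?_
  · simpa using this
  · filter_upwards [self_mem_nhdsWithin] with ε hε
    exact (((H.continuous_regularized hε).aestronglyMeasurable.sub
      (H.aestronglyMeasurable hn)).norm.pow 2).restrict
  · filter_upwards [self_mem_nhdsWithin] with ε hε
    filter_upwards [hz0] with z hz
    rw [Real.norm_of_nonneg (by positivity), ← rpow_half_sq (norm_pos_iff.2 hz), ← mul_pow]
    gcongr
    refine (norm_sub_le _ _).trans ?_
    have h1 := H.norm_regularized_le hn hC0 hC hε hz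
    have h2 := hC _ (norm_pos_iff.2 hz)
    linarith
  · exact integrableOn_rpow_norm hn _ _
  · filter_upwards [hz0] with z hz
    have h1 := ((H.tendsto_regularized hz).sub_const (h ‖z‖)).norm.pow 2
    simpa using h1

/-- Volume potentials of compactly supported `L²` densities are continuous: locally uniformly they
are limits of the potentials with regularized kernels. -/
theorem continuous_potential (H : OutgoingKernel n k h h₁) (hn : 2 ≤ n) (hψ : MemLpComp 2 ψ) :
    Continuous (potential h ψ) := by
  obtain ⟨R, hR, hψR⟩ := hψ.exists_radius
  have hψ1 := hψ.integrable
  set N : ℝ := ∫ y, ‖ψ y‖ ^ 2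
  have hN : Integrable fun y => ‖ψ y‖ ^ 2 :=
    (memLp_two_iff_integrable_sq_norm hψ.1.1).1 hψ.1
  have hN0 : 0 ≤ N := integral_nonneg fun _ => by positivity
  refine continuous_of_locally_uniform_approx_of_continuousAt fun x u hu => ?_
  obtain ⟨δ, hδ, hδu⟩ := Metric.mem_uniformity_dist.1 hu
  -- the parameter of the weighted Cauchy-Schwarz inequality
  set t : ℝ := δ / (N + 1)
  have ht : 0 < t := by positivity
  set R' : ℝ := ‖x‖ + 1 + R
  have hlim := H.tendsto_integral_sq_regularized_sub hn R'
  have hev := hlim.eventually (gt_mem_nhds (show 0 < δ * t by positivity))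
  obtain ⟨ε, hε, hεt⟩ := (hev.and self_mem_nhdsWithin).exists
  have hεt : 0 < ε := hεt
  refine ⟨Metric.ball x 1, Metric.ball_mem_nhds x one_pos,
    fun x' => ∫ y, h √(‖x' - y‖ ^ 2 + ε ^ 2) * ψ y, ?_, fun x' hx' => hδu ?_⟩
  · -- continuity of the regularized potential
    have hcont := H.continuous_regularized (n := n) hεt
    obtain ⟨B, hB⟩ := (isCompact_closedBall (0 : E n) R').exists_bound_of_continuousOn
      hcont.continuousOn
    refine continuousAt_of_dominated (bound := fun y => B * ‖ψ y‖) ?_ ?_ ?_ ?_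
    · exact Eventually.of_forall fun x' => ((hcont.comp
        (continuous_const.sub continuous_id)).aestronglyMeasurable).mul hψ.1.1
    · filter_upwards [Metric.ball_mem_nhds x one_pos] with x' hx'
      filter_upwards [hψR] with y hy
      rcases hy with hy | hy
      · simp [hy]
      · rw [norm_mul]
        refine mul_le_mul_of_nonneg_right (hB _ ?_) (norm_nonneg _)
        rw [mem_closedBall_zero_iff]
        have h1 : ‖x'‖ ≤ ‖x‖ + 1 := by
          have := norm_le_norm_add_norm_sub' x' x
          rw [Metric.mem_ball, dist_eq_norm] at hx'
          linarith
        exact (norm_sub_le _ _).trans (by linarith)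
    · exact hψ1.norm.const_mul B
    · exact Eventually.of_forall fun y => ((hcont.comp
        (continuous_id.sub continuous_const)).continuousAt).mul continuousAt_const
  · -- uniform closeness to the potential on the unit ball around `x`
    have hx1 : ‖x'‖ + R ≤ R' := by
      have := norm_le_norm_add_norm_sub' x' x
      rw [Metric.mem_ball, dist_eq_norm] at hx'
      simp only [R']; linarith
    set d : E n → ℝ := (Metric.ball (0 : E n) R').indicator
      fun z => ‖h √(‖z‖ ^ 2 + ε ^ 2) - h ‖z‖‖ ^ 2 with hd
    have hdint : Integrable d := by
      rw [hd, integrable_indicator_iff measurableSet_ball]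
      have m1 : MemLp (fun z : E n => h √(‖z‖ ^ 2 + ε ^ 2)) 2
          (volume.restrict (Metric.ball 0 R')) := by
        have hcont := H.continuous_regularized (n := n) hεt
        obtain ⟨B, hB⟩ := (isCompact_closedBall (0 : E n) R').exists_bound_of_continuousOn
          hcont.continuousOn
        have : IsFiniteMeasure (volume.restrict (Metric.ball (0 : E n) R')) :=
          ⟨by simpa using measure_ball_lt_top⟩
        refine MemLp.of_bound hcont.aestronglyMeasurable B ?_
        exact ae_restrict_of_forall_mem measurableSet_ball fun z hz =>
          hB z (Metric.ball_subset_closedBall hz)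
      have m2 : MemLp (fun z : E n => h ‖z‖) 2 (volume.restrict (Metric.ball 0 R')) :=
        (memLp_indicator_iff_restrict measurableSet_ball).1 (H.memLp_trunc hn R')
      exact (memLp_two_iff_integrable_sq_norm (m1.sub m2).1).1 (m1.sub m2)
    have hdx : Integrable fun y => d (x' - y) := hdint.comp_sub_left x'
    have hdI : ∫ y, d (x' - y) = ∫ z in Metric.ball (0 : E n) R',
        ‖h √(‖z‖ ^ 2 + ε ^ 2) - h ‖z‖‖ ^ 2 := by
      rw [integral_sub_left_eq_self d volume x', hd, integral_indicator measurableSet_ball]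
    have hI1 := H.integrable_potential_integrand hn hψ x'
    have hI2 : Integrable fun y => h √(‖x' - y‖ ^ 2 + ε ^ 2) * ψ y := by
      have hcont := H.continuous_regularized (n := n) hεt
      obtain ⟨B, hB⟩ := (isCompact_closedBall (0 : E n) R').exists_bound_of_continuousOn
        hcont.continuousOn
      refine (hψ1.norm.const_mul B).mono' (((hcont.comp
        (continuous_const.sub continuous_id)).aestronglyMeasurable).mul hψ.1.1) ?_
      filter_upwards [hψR] with y hy
      rcases hy with hy | hy
      · simp [hy]
      · rw [norm_mul]
        refine mul_le_mul_of_nonneg_right (hB _ ?_) (norm_nonneg _)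
        rw [mem_closedBall_zero_iff]
        exact (norm_sub_le _ _).trans (by linarith)
    have hbound : ∀ᵐ y, ‖h ‖x' - y‖ * ψ y - h √(‖x' - y‖ ^ 2 + ε ^ 2) * ψ y‖
        ≤ (1 / (2 * t)) * d (x' - y) + t / 2 * ‖ψ y‖ ^ 2 := by
      filter_upwards [hψR] with y hy
      rcases hy with hy | hy
      · simp only [hy, mul_zero, sub_zero, norm_zero]
        have : 0 ≤ d (x' - y) := Set.indicator_nonneg (fun _ _ => by positivity) _
        positivity
      · rw [hd, Set.indicator_of_mem]
        · rw [← sub_mul, norm_mul, norm_sub_rev]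
          set a := ‖h √(‖x' - y‖ ^ 2 + ε ^ 2) - h ‖x' - y‖‖
          have : (1 / (2 * t)) * a ^ 2 + t / 2 * ‖ψ y‖ ^ 2 - a * ‖ψ y‖
              = (1 / (2 * t)) * (a - t * ‖ψ y‖) ^ 2 := by field_simp; ring
          have : 0 ≤ (1 / (2 * t)) * (a - t * ‖ψ y‖) ^ 2 := by positivity
          linarith
        · rw [mem_ball_zero_iff]
          exact (norm_sub_le _ _).trans_lt (by linarith)
    rw [potential, dist_eq_norm, ← integral_sub hI1 hI2]
    refine (norm_integral_le_integral_norm _).trans_lt ?_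
    refine (integral_mono_ae (hI1.sub hI2).norm
      ((hdx.const_mul _).add (hN.const_mul _)) hbound).trans_lt ?_
    rw [integral_add' (hdx.const_mul _) (hN.const_mul _), integral_const_mul, integral_const_mul,
      hdI]
    have h1 : 1 / (2 * t) * ∫ z in Metric.ball (0 : E n) R',
        ‖h √(‖z‖ ^ 2 + ε ^ 2) - h ‖z‖‖ ^ 2 < 1 / (2 * t) * (δ * t) :=
      mul_lt_mul_of_pos_left hε (by positivity)
    have h2 : 1 / (2 * t) * (δ * t) = δ / 2 := by field_simp
    have h3 : t / 2 * N ≤ δ / 2 := by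
      have : t * N ≤ δ := by
        have : t * N = δ * (N / (N + 1)) := by simp only [t]; ring
        rw [this]
        have : N / (N + 1) ≤ 1 := (div_le_one (by positivity)).2 (by linarith)
        nlinarith
      linarith
    change _ + t / 2 * N < δ
    linarith

/-- The potential `u = Vψ` satisfies `Δu + k²u = -ψ` in the sense of distributions. -/
theorem integral_potential_mul_helmholtz (H : OutgoingKernel n k h h₁) (hn : 2 ≤ n)
    (hψ : MemLpComp 2 ψ) {φ : E n → ℂ} (hφ : IsTestFunction φ) :
    ∫ x, potential h ψ x * ((Δ φ) x + k ^ 2 * φ x) = -∫ y, ψ y * φ y := by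
  obtain ⟨R, hR, hψR⟩ := hψ.exists_radius
  set θ : E n → ℂ := fun x => (Δ φ) x + k ^ 2 * φ x with hθ
  have hθc : Continuous θ :=
    (continuous_laplacian hφ.contDiff_two).add (continuous_const.mul hφ.1.continuous)
  have hθs : HasCompactSupport θ := (hasCompactSupport_laplacian hφ.2).add hφ.2.mul_left
  obtain ⟨M, hM0, hM⟩ := hθs.isCompact.isBounded.exists_pos_norm_le
  obtain ⟨B, hB⟩ := hθc.bounded_above_of_compact_support hθs
  set T := trunc n h (M + R)
  have hprod : Integrable (fun p : E n × E n => (T (p.1 - p.2) * ψ p.2) * θ p.1)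
      (volume.prod volume) := by
    have h1 := (hψ.integrable.convolution_integrand (ContinuousLinearMap.mul ℝ ℂ)
      (H.integrable_trunc hn (M + R)))
    have h2 := h1.mul_bdd (c := B) (g := fun p : E n × E n => θ p.1)
      (hθc.comp continuous_fst).aestronglyMeasurable (Eventually.of_forall fun p => hB _)
    refine h2.congr (Eventually.of_forall fun p => ?_)
    simp only [ContinuousLinearMap.mul_apply', T]
    ring
  have e1 : ∫ x, potential h ψ x * θ x = ∫ x, ∫ y, (T (x - y) * ψ y) * θ x := by
    refine integral_congr_ae (Eventually.of_forall fun x => ?_)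
    simp only
    rw [integral_mul_const]
    by_cases hx : x ∈ tsupport θ
    · rw [potential, integral_congr_ae (potential_integrand_eq_trunc hψR (x := x)
        (R' := M + R) (by linarith [hM x hx]))]
    · rw [image_eq_zero_of_notMem_tsupport hx, mul_zero, mul_zero]
  rw [e1, integral_integral_swap hprod, ← integral_neg]
  refine integral_congr_ae ?_
  filter_upwards [hψR] with y hy
  rcases hy with hy | hy
  · simp [hy]
  · have e2 : ∀ x, T (x - y) * ψ y * θ x = ψ y * (h ‖x - y‖ * θ x) := by
      intro x
      by_cases hx : x ∈ tsupport θ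
      · simp only [T]
        rw [trunc, Set.indicator_of_mem]
        · ring
        · rw [mem_ball_zero_iff]
          exact (norm_sub_le _ _).trans_lt (by linarith [hM x hx])
      · simp [image_eq_zero_of_notMem_tsupport hx]
    simp only [e2]
    rw [integral_const_mul]
    have hφy : ContDiff ℝ 2 fun z => φ (z + y) :=
      hφ.contDiff_two.comp (contDiff_id.add contDiff_const)
    have e3 := H.integral_mul_helmholtz hn hφy (hφ.2.comp_homeomorph (Homeomorph.addRight y))
    simp only [laplacian_comp_add_right hφ.contDiff_two, zero_add] at e3
    rw [← integral_add_right_eq_self _ y]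
    simp only [add_sub_cancel_right, hθ]
    rw [e3]; ring

lemma exists_deriv_bound (H : OutgoingKernel n k h h₁) :
    ∃ C, 0 ≤ C ∧ (∀ r : ℝ, 1 ≤ r → ‖h₁ r‖ ≤ C * r ^ (-(((n : ℝ) - 1) / 2))) ∧
      ∀ r : ℝ, 1 ≤ r → ‖h₁ r - Complex.I * k * h r‖ ≤ C * r ^ (-(((n : ℝ) + 1) / 2)) := by
  obtain ⟨C, hC0, hC⟩ := H.exists_bound
  obtain ⟨D, hD⟩ := H.radiation
  have hD0 : 0 ≤ D := by simpa using (norm_nonneg _).trans (hD 1 one_pos)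
  refine ⟨D + |k| * C, by positivity, fun r hr => ?_, fun r hr => ?_⟩
  · have hr0 : 0 < r := by linarith
    have h1 : ‖h₁ r‖ ≤ ‖h₁ r - Complex.I * k * h r‖ + |k| * ‖h r‖ := by
      have := norm_le_norm_sub_add (h₁ r) (Complex.I * k * h r)
      simpa using this
    refine h1.trans ?_
    rw [add_mul, mul_assoc (|k|)]
    refine add_le_add ((hD r hr0).trans ?_) (by gcongr; exact hC r hr0)
    gcongr
    linarith
  · have hr0 : 0 < r := by linarith
    refine (hD r hr0).trans ?_
    gcongr
    have : 0 ≤ |k| * C := by positivity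
    linarith

lemma hasFDerivAt_kernel (H : OutgoingKernel n k h h₁) {x y : E n} (hxy : x ≠ y) :
    HasFDerivAt (fun x' => h ‖x' - y‖)
      ((innerSL ℝ (‖x - y‖⁻¹ • (x - y))).smulRight (h₁ ‖x - y‖)) x := by
  have hne : x - y ≠ 0 := sub_ne_zero.2 hxy
  have hr := norm_pos_iff.2 hne
  have h1 : HasFDerivAt (fun x' : E n => ‖x' - y‖) (innerSL ℝ (‖x - y‖⁻¹ • (x - y))) x := by
    have h2 : HasFDerivAt (fun x' : E n => ‖x' - y‖ ^ 2) (2 • innerSL ℝ (x - y)) x :=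
      (((hasFDerivAt_id x).sub_const y).norm_sq).congr_fderiv (by ext v; simp)
    have h3 := h2.sqrt (by positivity)
    simp only [Real.sqrt_sq (norm_nonneg _)] at h3
    refine h3.congr_fderiv ?_
    ext v
    simp
    field_simp
  refine ((H.hasDerivAt _ hr).hasFDerivAt.comp x h1).congr_fderiv ?_
  ext v
  simp
  ring

/-- Outside a ball containing the support of the density one may differentiate the potential under
the integral sign. -/
lemma hasFDerivAt_potential (H : OutgoingKernel n k h h₁) (hn : 2 ≤ n) (hψ : MemLpComp 2 ψ)
    {R : ℝ} (hψR : ∀ᵐ y : E n, ψ y = 0 ∨ ‖y‖ < R) {x : E n} (hx : R + 2 ≤ ‖x‖) :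
    let F' : E n → (E n →L[ℝ] ℂ) := fun y =>
      (innerSL ℝ (‖x - y‖⁻¹ • (x - y))).smulRight (h₁ ‖x - y‖ * ψ y)
    Integrable F' ∧ HasFDerivAt (potential h ψ) (∫ y, F' y) x := by
  have : Nonempty (Fin n) := ⟨⟨0, by omega⟩⟩
  intro F'
  obtain ⟨C, hC0, hC1, -⟩ := H.exists_deriv_bound
  have hn' : (2 : ℝ) ≤ n := by exact_mod_cast hn
  have hmeas : ∀ x' : E n, AEStronglyMeasurable (fun y => h ‖x' - y‖ * ψ y) :=
    fun x' => (H.integrable_potential_integrand hn hψ x').1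
  have hnorm : ∀ x' y : E n, ‖(innerSL ℝ (‖x' - y‖⁻¹ • (x' - y))).smulRight (h₁ ‖x' - y‖ * ψ y)‖
      ≤ ‖h₁ ‖x' - y‖‖ * ‖ψ y‖ := by
    intro x' y
    rw [ContinuousLinearMap.norm_smulRight_apply, innerSL_apply_norm, norm_mul]
    have : ‖‖x' - y‖⁻¹ • (x' - y)‖ ≤ 1 := by
      rw [norm_smul, norm_inv, norm_norm]
      exact inv_mul_le_one
    have h0 : 0 ≤ ‖h₁ ‖x' - y‖‖ * ‖ψ y‖ := by positivity
    nlinarith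
  have hfar : ∀ x' ∈ Metric.ball x 1, ∀ y : E n, ‖y‖ < R → 1 ≤ ‖x' - y‖ := by
    intro x' hx' y hy
    rw [Metric.mem_ball, dist_eq_norm] at hx'
    have h1 := norm_le_norm_add_norm_sub' x x'
    have h2 := norm_le_norm_add_norm_sub' x' y
    rw [norm_sub_rev] at h1
    linarith
  have hFm : AEStronglyMeasurable F' := by
    have m1 : AEStronglyMeasurable (fun y : E n => innerSL ℝ (‖x - y‖⁻¹ • (x - y))) := by
      have c : Measurable fun y : E n => ‖x - y‖⁻¹ • (x - y) := by fun_prop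
      exact (innerSL ℝ).continuous.comp_aestronglyMeasurable c.aestronglyMeasurable
    have hh1 : ContinuousOn (fun y : E n => h₁ ‖x - y‖) {x}ᶜ := by
      intro y hy
      have hr := norm_pos_iff.2 (sub_ne_zero.2 (Ne.symm hy))
      have c0 : ContinuousAt (fun y : E n => x - y) y := by fun_prop
      exact (ContinuousAt.comp (g := h₁) (f := fun y => ‖x - y‖) (H.hasDerivAt₁ _ hr).continuousAt
        c0.norm).continuousWithinAt
    have m2 := hh1.aestronglyMeasurable (μ := volume) (MeasurableSet.singleton _).compl
    rw [restrict_compl_singleton] at m2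
    exact (ContinuousLinearMap.smulRightL ℝ (E n) ℂ).aestronglyMeasurable_comp₂ m1 (m2.mul hψ.1.1)
  have hFb : ∀ᵐ y, ∀ x' ∈ Metric.ball x 1,
      ‖(innerSL ℝ (‖x' - y‖⁻¹ • (x' - y))).smulRight (h₁ ‖x' - y‖ * ψ y)‖ ≤ C * ‖ψ y‖ := by
    filter_upwards [hψR] with y hy x' hx'
    refine (hnorm x' y).trans ?_
    rcases hy with hy | hy
    · simp [hy]
    · have h1 := hfar x' hx' y hy
      gcongr
      refine (hC1 _ h1).trans ?_
      have : ‖x' - y‖ ^ (-(((n : ℝ) - 1) / 2)) ≤ 1 :=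
        Real.rpow_le_one_of_one_le_of_nonpos h1 (by linarith)
      nlinarith
  refine ⟨?_, ?_⟩
  · refine (hψ.integrable.norm.const_mul C).mono' hFm ?_
    filter_upwards [hFb] with y hy
    exact hy x (Metric.mem_ball_self one_pos)
  · refine hasFDerivAt_integral_of_dominated_of_fderiv_le (Metric.ball_mem_nhds x one_pos)
      (Eventually.of_forall hmeas) (H.integrable_potential_integrand hn hψ x) hFm hFb
      (hψ.integrable.norm.const_mul C) ?_
    filter_upwards [hψR] with y hy x' hx'
    rcases hy with hy | hy
    · simp only [hy, mul_zero]
      refine (hasFDerivAt_const (0 : ℂ) x').congr_fderiv ?_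
      ext v; simp
    · have h1 := hfar x' hx' y hy
      have hne : x' ≠ y := by
        rintro rfl
        simp at h1
        linarith
      refine ((H.hasFDerivAt_kernel hne).mul_const (ψ y)).congr_fderiv ?_
      ext v; simp; ring

/-- Volume potentials with an outgoing kernel satisfy Sommerfeld's radiation condition: the kernel
satisfies it with one power of `|x|` to spare, and the directions of `x` and `x - y` differ by
`O(1/|x|)` for `y` in a bounded set. -/
theorem radiation_potential (H : OutgoingKernel n k h h₁) (hn : 2 ≤ n) (hψ : MemLpComp 2 ψ) :
    (∀ᶠ x in Bornology.cobounded (E n), DifferentiableAt ℝ (potential h ψ) x) ∧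
    (fun x => fderiv ℝ (potential h ψ) x (‖x‖⁻¹ • x) - Complex.I * k * potential h ψ x)
      =o[Bornology.cobounded (E n)] fun x => ‖x‖ ^ (-(((n : ℝ) - 1) / 2)) := by
  have : Nonempty (Fin n) := ⟨⟨0, by omega⟩⟩
  obtain ⟨R, hR, hψR⟩ := hψ.exists_radius
  obtain ⟨C, hC0, hC1, hC2⟩ := H.exists_deriv_bound
  have hn' : (2 : ℝ) ≤ n := by exact_mod_cast hn
  set a : ℝ := ((n : ℝ) + 1) / 2 with ha
  set I : ℝ := ∫ y, ‖ψ y‖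
  have hI0 : 0 ≤ I := integral_nonneg fun _ => norm_nonneg _
  set D : ℝ := C * (1 + 2 * R) * 2 ^ a
  have hD0 : 0 ≤ D := by positivity
  have hlarge : ∀ A : ℝ, ∀ᶠ x in Bornology.cobounded (E n), A ≤ ‖x‖ := fun A =>
    tendsto_norm_cobounded_atTop.eventually (eventually_ge_atTop A)
  have key : ∀ x : E n, 2 * R + 2 ≤ ‖x‖ →
      ‖fderiv ℝ (potential h ψ) x (‖x‖⁻¹ • x) - Complex.I * k * potential h ψ x‖
        ≤ D * ‖x‖ ^ (-a) * I := by
    intro x hx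
    have hx0 : 0 < ‖x‖ := by linarith
    obtain ⟨hi, hd⟩ := H.hasFDerivAt_potential hn hψ hψR (x := x) (by linarith)
    rw [hd.fderiv, ContinuousLinearMap.integral_apply hi, potential, ← integral_const_mul,
      ← integral_sub (hi.apply_continuousLinearMap _)
        ((H.integrable_potential_integrand hn hψ x).const_mul _), ← integral_const_mul]
    refine norm_integral_le_of_norm_le (hψ.integrable.norm.const_mul _) ?_
    filter_upwards [hψR] with y hy
    rcases hy with hy | hy
    · simp [hy]
    · set r := ‖x - y‖ with hr
      have hr1 : ‖x‖ / 2 ≤ r := by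
        have h2 := norm_le_norm_add_norm_sub' x y
        linarith
      have hr2 : 1 ≤ r := by linarith
      have hr0 : 0 < r := by linarith
      have e : ((innerSL ℝ (r⁻¹ • (x - y))).smulRight (h₁ r * ψ y)) (‖x‖⁻¹ • x)
          - Complex.I * k * (h r * ψ y)
          = ((h₁ r - Complex.I * k * h r) +
            ((inner ℝ (r⁻¹ • (x - y)) (‖x‖⁻¹ • x) - 1 : ℝ) : ℂ) * h₁ r) * ψ y := by
        simp only [ContinuousLinearMap.smulRight_apply, innerSL_apply_apply, Complex.real_smul]
        push_cast; ring
      have hang : |inner ℝ (r⁻¹ • (x - y)) (‖x‖⁻¹ • x) - 1| ≤ 2 * R / r := by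
        rw [inner_smul_left, inner_smul_right, inner_sub_left, real_inner_self_eq_norm_sq]
        have h1 : |(inner ℝ y x : ℝ)| ≤ ‖y‖ * ‖x‖ := abs_real_inner_le_norm y x
        have h2 : |‖x‖ - r| ≤ ‖y‖ := by
          have := abs_norm_sub_norm_le x (x - y)
          simpa using this
        have e2 : (starRingEnd ℝ) r⁻¹ * (‖x‖⁻¹ * (‖x‖ ^ 2 - inner ℝ y x)) - 1
            = ((‖x‖ - r) - ‖x‖⁻¹ * inner ℝ y x) / r := by
          simp only [conj_trivial]; field_simp; ring
        rw [e2, abs_div, abs_of_pos hr0]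
        gcongr
        refine (abs_sub _ _).trans ?_
        have h3 : |‖x‖⁻¹ * inner ℝ y x| ≤ ‖y‖ := by
          rw [abs_mul, abs_of_pos (inv_pos.2 hx0), inv_mul_le_iff₀ hx0]
          linarith
        linarith
      rw [e, norm_mul]
      refine mul_le_mul_of_nonneg_right ?_ (norm_nonneg _)
      have hra : r ^ (-a) ≤ 2 ^ a * ‖x‖ ^ (-a) := by
        have h1 : r ^ (-a) ≤ (‖x‖ / 2) ^ (-a) :=
          Real.rpow_le_rpow_of_nonpos (by positivity) hr1 (by simp only [ha]; linarith)
        rw [Real.div_rpow hx0.le (by norm_num), Real.rpow_neg (by norm_num : (0 : ℝ) ≤ 2)] at h1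
        refine h1.trans_eq ?_
        rw [div_inv_eq_mul, mul_comm]
      calc _ ≤ C * r ^ (-a) + 2 * R / r * (C * r ^ (-(((n : ℝ) - 1) / 2))) := by
            refine (norm_add_le _ _).trans (add_le_add (hC2 r hr2) ?_)
            rw [norm_mul, Complex.norm_real, Real.norm_eq_abs]
            exact mul_le_mul hang (hC1 r hr2) (norm_nonneg _) (by positivity)
        _ = C * (1 + 2 * R) * r ^ (-a) := by
            have : r ^ (-(((n : ℝ) - 1) / 2)) = r ^ (-a) * r := by
              rw [← Real.rpow_add_one hr0.ne']; congr 1; simp only [ha]; ring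
            rw [this]; field_simp
        _ ≤ D * ‖x‖ ^ (-a) := by
            have := mul_le_mul_of_nonneg_left hra (show 0 ≤ C * (1 + 2 * R) by positivity)
            simp only [D]; linarith
  refine ⟨?_, ?_⟩
  · filter_upwards [hlarge (2 * R + 2)] with x hx
    exact (H.hasFDerivAt_potential hn hψ hψR (x := x) (by linarith)).2.differentiableAt
  · refine isLittleO_iff.2 fun c hc => ?_
    filter_upwards [hlarge (2 * R + 2), hlarge (D * I / c)] with x hx hx2
    have hx0 : 0 < ‖x‖ := by linarith
    refine (key x hx).trans ?_
    rw [Real.norm_of_nonneg (by positivity)]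
    have : ‖x‖ ^ (-(((n : ℝ) - 1) / 2)) = ‖x‖ ^ (-a) * ‖x‖ := by
      rw [← Real.rpow_add_one hx0.ne']; congr 1; simp only [ha]; ring
    rw [this]
    have h3 : D * I ≤ c * ‖x‖ := by
      rw [div_le_iff₀ hc] at hx2; linarith
    have h4 : 0 ≤ ‖x‖ ^ (-a) := by positivity
    nlinarith

end OutgoingKernel

/-! ### Local square integrability -/

lemma exists_testFunction_eq_one {n : ℕ} (R : ℝ) :
    ∃ χ : E n → ℂ, IsTestFunction χ ∧ ∀ x ∈ Metric.closedBall (0 : E n) R, χ x = 1 := by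
  have hr : 0 < |R| + 1 := by positivity
  let b : ContDiffBump (0 : E n) := ⟨|R| + 1, |R| + 2, hr, by linarith⟩
  refine ⟨fun x => (b x : ℂ), ⟨?_, ?_⟩, fun x hx => ?_⟩
  · exact Complex.ofRealCLM.contDiff.comp b.contDiff
  · exact b.hasCompactSupport.comp_left Complex.ofReal_zero
  · have : b x = 1 := b.one_of_mem_closedBall
      (Metric.closedBall_subset_closedBall (by linarith [le_abs_self R]) hx)
    simp [this]

lemma MemL2Loc.memLp_mul {n : ℕ} {u χ : E n → ℂ} (hu : MemL2Loc u) (hχ : Continuous χ)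
    (hc : HasCompactSupport χ) : MemLp (fun x => χ x * u x) 2 := by
  obtain ⟨B, hB⟩ := hχ.bounded_above_of_compact_support hc
  have hK := hc.isCompact
  have h1 : MemLp (fun x => χ x * u x) 2 (volume.restrict (tsupport χ)) :=
    MemLp.of_le_mul (c := B) (hu _ hK) (hχ.aestronglyMeasurable.mul (hu _ hK).1)
      (Eventually.of_forall fun x => by
        rw [norm_mul]; exact mul_le_mul_of_nonneg_right (hB x) (norm_nonneg _))
  have h2 := (memLp_indicator_iff_restrict hK.measurableSet).2 h1
  convert! h2 using 1
  ext x
  by_cases hx : x ∈ tsupport χ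
  · rw [Set.indicator_of_mem hx]
  · rw [Set.indicator_of_notMem hx, image_eq_zero_of_notMem_tsupport hx, zero_mul]

lemma MemL2Loc.integrable_mul {n : ℕ} {u χ : E n → ℂ} (hu : MemL2Loc u) (hχ : Continuous χ)
    (hc : HasCompactSupport χ) : Integrable fun x => χ x * u x := by
  refine MemLpComp.integrable ⟨hu.memLp_mul hχ hc, tsupport χ, hc.isCompact,
    Eventually.of_forall fun x hx => ?_⟩
  simp [image_eq_zero_of_notMem_tsupport hx]

lemma memL2Loc_of_cutoffs {n : ℕ} {u : E n → ℂ}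
    (h : ∀ χ : E n → ℂ, IsTestFunction χ → MemLp (fun x => χ x * u x) 2) : MemL2Loc u := by
  intro K hK
  obtain ⟨R, hR⟩ := hK.isBounded.subset_closedBall 0
  obtain ⟨χ, hχ, hχ1⟩ := exists_testFunction_eq_one (n := n) R
  refine ((h χ hχ).restrict K).ae_eq ?_
  refine ae_restrict_of_forall_mem hK.measurableSet fun x hx => ?_
  simp [hχ1 x (hR hx)]

lemma MemHLoc.memL2Loc {n : ℕ} {s : ℝ} {u : E n → ℂ} (hu : MemHLoc s u) : MemL2Loc u :=
  memL2Loc_of_cutoffs fun χ hχ => (hu χ hχ).1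

lemma MemL2Loc.congr {n : ℕ} {u v : E n → ℂ} (hu : MemL2Loc u) (h : u =ᵐ[volume] v) :
    MemL2Loc v := fun K hK => (hu K hK).ae_eq (ae_restrict_of_ae h)

lemma MemL2Loc.add {n : ℕ} {u v : E n → ℂ} (hu : MemL2Loc u) (hv : MemL2Loc v) :
    MemL2Loc fun x => u x + v x := fun K hK => (hu K hK).add (hv K hK)

lemma MemL2Loc.sub {n : ℕ} {u v : E n → ℂ} (hu : MemL2Loc u) (hv : MemL2Loc v) :
    MemL2Loc fun x => u x - v x := fun K hK => (hu K hK).sub (hv K hK)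

lemma MemL2Loc.const_mul {n : ℕ} {u : E n → ℂ} (hu : MemL2Loc u) (c : ℂ) :
    MemL2Loc fun x => c * u x := fun K hK => (hu K hK).const_mul c

lemma MemLpComp.memL2Loc {n : ℕ} {f : E n → ℂ} (hf : MemLpComp 2 f) : MemL2Loc f :=
  fun _ _ => hf.1.restrict _

lemma _root_.Continuous.memL2Loc {n : ℕ} {u : E n → ℂ} (hu : Continuous u) : MemL2Loc u := by
  intro K hK
  have : IsFiniteMeasure (volume.restrict K) := ⟨by simpa using hK.measure_lt_top⟩
  obtain ⟨B, hB⟩ := hK.exists_bound_of_continuousOn hu.continuousOn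
  exact MemLp.of_bound hu.aestronglyMeasurable B (ae_restrict_of_forall_mem hK.measurableSet hB)

/-- The product of a compactly supported `L^∞` function and an `L²_loc` function. -/
lemma MemLpComp.mul_memL2Loc {n : ℕ} {m u : E n → ℂ} (hm : MemLpComp ⊤ m) (hu : MemL2Loc u) :
    MemLpComp 2 fun x => m x * u x := by
  obtain ⟨K, hK, hKm⟩ := hm.2
  refine ⟨?_, K, hK, hKm.mono fun x hx hxK => by simp [hx hxK]⟩
  have h1 : MemLp (fun x => m x * u x) 2 (volume.restrict K) :=
    (hu K hK).mul (hm.1.restrict K)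
  refine ((memLp_indicator_iff_restrict hK.measurableSet).2 h1).ae_eq ?_
  filter_upwards [hKm] with x hx
  by_cases hxK : x ∈ K
  · rw [Set.indicator_of_mem hxK]
  · rw [Set.indicator_of_notMem hxK, hx hxK, zero_mul]

/-! ### Elliptic regularity -/

open FourierTransform TemperedDistribution LineDeriv

/-- The tempered distribution of an `L²` function. -/
abbrev tdist {n : ℕ} {g : E n → ℂ} (h : MemLp g 2) : 𝓢'(E n, ℂ) :=
  Lp.toTemperedDistribution (h.toLp g)

lemma tdist_apply {n : ℕ} {g : E n → ℂ} (h : MemLp g 2) (φ : 𝓢(E n, ℂ)) :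
    tdist h φ = ∫ x, φ x * g x := by
  rw [tdist, Lp.toTemperedDistribution_apply]
  refine integral_congr_ae ?_
  filter_upwards [h.coeFn_toLp] with x hx
  rw [hx, smul_eq_mul]

/-- The Bessel potential of order two is `1 - Δ/(4π²)`, in the normalization `e^{-2πi x·ξ}` of the
Fourier transform. -/
lemma besselPotential_two_eq {n : ℕ} (T : 𝓢'(E n, ℂ)) :
    besselPotential (E n) ℂ 2 T = T - (((2 * Real.pi) ^ 2)⁻¹ : ℂ) • (Δ T) := by
  rw [laplacian_eq_fourierMultiplierCLM, besselPotential]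
  have h1 : (fun x : E n => (((1 + ‖x‖ ^ 2) ^ ((2 : ℝ) / 2) : ℝ) : ℂ))
      = (fun _ => (1 : ℂ)) + fun x => ((‖x‖ ^ 2 : ℝ) : ℂ) := by
    ext x; simp
  have h2 : fourierMultiplierCLM ℂ (fun x : E n => (((1 + ‖x‖ ^ 2) ^ ((2 : ℝ) / 2) : ℝ) : ℂ)) T
      = T + fourierMultiplierCLM ℂ (fun x : E n => ((‖x‖ ^ 2 : ℝ) : ℂ)) T := by
    rw [h1, fourierMultiplierCLM_apply, fourierMultiplierCLM_apply,
      smulLeftCLM_add (by fun_prop) (by fun_prop), add_apply,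
      smulLeftCLM_const, one_smul, FourierTransform.fourierInv_add,
      FourierTransform.fourierInv_fourier_eq]
  rw [h2, sub_eq_add_neg]
  congr 1
  ext φ
  set M := fourierMultiplierCLM ℂ (fun x : E n => ((‖x‖ ^ 2 : ℝ) : ℂ)) T
  change M φ = -((((2 * Real.pi) ^ 2)⁻¹ : ℂ) * ((-(2 * Real.pi) ^ 2 : ℝ) • M φ))
  rw [Complex.real_smul]
  have : (Real.pi : ℂ) ≠ 0 := by exact_mod_cast Real.pi_ne_zero
  push_cast
  field_simp

lemma sum_apply_schwartz {n : ℕ} {ι : Type*} (t : Finset ι) (T : ι → 𝓢'(E n, ℂ))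
    (φ : 𝓢(E n, ℂ)) : (∑ i ∈ t, T i) φ = ∑ i ∈ t, T i φ := by
  classical
  induction t using Finset.induction_on with
  | empty => rfl
  | insert a t ha ih =>
    rw [Finset.sum_insert ha, Finset.sum_insert ha, ← ih]
    rfl

/-- Two derivatives are gained from the Laplacian. -/
lemma memSobolev_of_laplacian {n : ℕ} {T : 𝓢'(E n, ℂ)} {s : ℝ} (h1 : MemSobolev s 2 T)
    (h2 : MemSobolev s 2 (Δ T)) : MemSobolev (2 + s) 2 T := by
  rw [← memSobolev_besselPotential_iff, besselPotential_two_eq]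
  exact h1.sub (h2.smul _)

lemma MemSobolev.finset_sum {n : ℕ} {ι : Type*} (t : Finset ι) {T : ι → 𝓢'(E n, ℂ)} {s : ℝ}
    (h : ∀ i ∈ t, MemSobolev s 2 (T i)) : MemSobolev s 2 (∑ i ∈ t, T i) := by
  classical
  induction t using Finset.induction_on with
  | empty => simp
  | insert a t ha ih =>
    rw [Finset.sum_insert ha]
    exact (h a (Finset.mem_insert_self _ _)).add
      (ih fun i hi => h i (Finset.mem_insert_of_mem hi))

lemma laplacian_tdist_apply {n : ℕ} {g : E n → ℂ} (h : MemLp g 2) (φ : 𝓢(E n, ℂ)) :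
    (Δ (tdist h)) φ = ∫ x, (Δ ⇑φ) x * g x := by
  rw [laplacian_apply_apply, tdist_apply]
  simp only [SchwartzMap.laplacian_apply]

lemma lineDeriv_tdist_apply {n : ℕ} {g : E n → ℂ} (h : MemLp g 2) (i : Fin n) (φ : 𝓢(E n, ℂ)) :
    (∂_{EuclideanSpace.single i (1 : ℝ)} (tdist h) : 𝓢'(E n, ℂ)) φ = -∫ x, pderiv i φ x * g x := by
  rw [lineDerivOp_apply_apply, map_neg, tdist_apply]
  simp only [SchwartzMap.lineDerivOp_apply_eq_fderiv, pderiv]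

/-- The equation for `χ w` when `Δw = F`: `Δ(χw) = χF + 2∇·(w∇χ) - wΔχ`, tested against `p`. -/
lemma integral_mul_laplacian_cutoff {n : ℕ} {w F : E n → ℂ} (hw : MemL2Loc w)
    (hwF : ∀ φ : E n → ℂ, IsTestFunction φ → ∫ x, w x * (Δ φ) x = ∫ x, F x * φ x)
    {χ : E n → ℂ} (hχ : IsTestFunction χ) {p : E n → ℂ} (hp : ContDiff ℝ ∞ p) :
    ∫ x, (Δ p) x * (χ x * w x) = (∫ x, p x * (χ x * F x))
      + 2 * (∑ i, -∫ x, pderiv i p x * (pderiv i χ x * w x)) - ∫ x, p x * ((Δ χ) x * w x) := by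
  have hp2 : ContDiff ℝ 2 p := hp.of_le (WithTop.coe_le_coe.2 le_top)
  have key := hwF _ (⟨hχ.1.mul hp, hχ.2.mul_right⟩ : IsTestFunction fun x => χ x * p x)
  have e : ∀ x, w x * (Δ fun y => χ y * p y) x
      = (Δ p) x * (χ x * w x) + 2 * ∑ i, pderiv i p x * (pderiv i χ x * w x)
        + p x * ((Δ χ) x * w x) := by
    intro x
    rw [laplacian_mul hχ.contDiff_two hp2]
    simp only [Finset.mul_sum, mul_add]
    congr 1
    · congr 1
      · ring
      · exact Finset.sum_congr rfl fun i _ => by ring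
    · ring
  have i1 : ∀ L : E n → ℂ, Continuous L → Integrable fun x => L x * (χ x * w x) := by
    intro L hL
    have := hw.integrable_mul (χ := fun x => L x * χ x) (hL.mul hχ.1.continuous) hχ.2.mul_left
    simpa only [mul_assoc] using this
  have i2 : ∀ i, Integrable fun x => pderiv i p x * (pderiv i χ x * w x) := by
    intro i
    have := hw.integrable_mul (χ := fun x => pderiv i p x * pderiv i χ x)
      ((contDiff_pderiv (p := 1) hp2 (by norm_num) i).continuous.mul (hχ.pderiv i).1.continuous)
      (hχ.pderiv i).2.mul_left
    simpa only [mul_assoc] using this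
  have i3 : ∀ L : E n → ℂ, IsTestFunction L → Integrable fun x => p x * (L x * w x) := by
    intro L hL
    have := hw.integrable_mul (χ := fun x => p x * L x)
      (hp.continuous.mul hL.1.continuous) hL.2.mul_left
    simpa only [mul_assoc] using this
  simp only [e] at key
  have i4 : Integrable fun x => 2 * ∑ i, pderiv i p x * (pderiv i χ x * w x) :=
    (integrable_finsetSum _ fun i _ => i2 i).const_mul 2
  rw [integral_add (by exact (i1 _ (continuous_laplacian hp2)).add i4) (i3 _ hχ.laplacian),
    integral_add (i1 _ (continuous_laplacian hp2)) i4,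
    integral_const_mul, integral_finsetSum _ fun i _ => i2 i] at key
  have e3 : ∫ x, F x * (χ x * p x) = ∫ x, p x * (χ x * F x) :=
    integral_congr_ae (Eventually.of_forall fun x => by simp only; ring)
  rw [e3] at key
  rw [Finset.sum_neg_distrib]
  linear_combination key

/-- The Laplacian of a localized distributional solution of `Δw = F`. -/
lemma laplacian_tdist_cutoff {n : ℕ} {w F : E n → ℂ} (hw : MemL2Loc w) (hF : MemL2Loc F)
    (hwF : ∀ φ : E n → ℂ, IsTestFunction φ → ∫ x, w x * (Δ φ) x = ∫ x, F x * φ x)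
    {χ : E n → ℂ} (hχ : IsTestFunction χ) :
    Δ (tdist (hw.memLp_mul hχ.1.continuous hχ.2))
      = tdist (hF.memLp_mul hχ.1.continuous hχ.2)
        + (2 : ℂ) • ∑ i, ∂_{EuclideanSpace.single i (1 : ℝ)}
          (tdist (hw.memLp_mul (hχ.pderiv i).1.continuous (hχ.pderiv i).2))
        - tdist (hw.memLp_mul hχ.laplacian.1.continuous hχ.laplacian.2) := by
  ext φ
  change _ = tdist _ φ + (2 : ℂ) * (∑ i, ∂_{EuclideanSpace.single i (1 : ℝ)}
      (tdist (hw.memLp_mul (hχ.pderiv i).1.continuous (hχ.pderiv i).2)) : 𝓢'(E n, ℂ)) φ - tdist _ φ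
  rw [laplacian_tdist_apply, tdist_apply, tdist_apply, sum_apply_schwartz,
    Finset.sum_congr rfl fun i _ => lineDeriv_tdist_apply _ i φ]
  exact integral_mul_laplacian_cutoff hw hwF hχ (φ.smooth ⊤)

/-- A step of the bootstrap: if `Δw = F` with `w ∈ H^s_loc` and `F ∈ H^{s-1}_loc`, then
`w ∈ H^{s+1}_loc`. -/
lemma memHLoc_succ {n : ℕ} {w F : E n → ℂ} (hw : MemL2Loc w) (hF : MemL2Loc F)
    (hwF : ∀ φ : E n → ℂ, IsTestFunction φ → ∫ x, w x * (Δ φ) x = ∫ x, F x * φ x) {s : ℝ}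
    (hws : MemHLoc s w)
    (hFs : ∀ χ : E n → ℂ, (hχ : IsTestFunction χ) →
      MemSobolev (s - 1) 2 (tdist (hF.memLp_mul hχ.1.continuous hχ.2))) :
    MemHLoc (s + 1) w := by
  intro χ hχ
  refine ⟨hw.memLp_mul hχ.1.continuous hχ.2, ?_⟩
  have hw' : ∀ χ : E n → ℂ, (hχ : IsTestFunction χ) →
      MemSobolev s 2 (tdist (hw.memLp_mul hχ.1.continuous hχ.2)) := fun χ hχ => (hws χ hχ).2
  rw [show s + 1 = 2 + (s - 1) by ring]
  refine memSobolev_of_laplacian ((hw' χ hχ).mono (by linarith)) ?_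
  rw [laplacian_tdist_cutoff hw hF hwF hχ]
  refine ((hFs χ hχ).add ((MemSobolev.finset_sum _ fun i _ => ?_).smul 2)).sub
    ((hw' _ hχ.laplacian).mono (by linarith))
  exact (hw' _ (hχ.pderiv i)).lineDerivOp

lemma memSobolev_zero_tdist {n : ℕ} {g : E n → ℂ} (h : MemLp g 2) : MemSobolev 0 2 (tdist h) :=
  memSobolev_zero_iff.2 ⟨_, rfl⟩

/-- Elliptic regularity: `w, Δw ∈ L²_loc` implies `w ∈ H²_loc`. -/
theorem memHLoc_two {n : ℕ} {w F : E n → ℂ} (hw : MemL2Loc w) (hF : MemL2Loc F)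
    (hwF : ∀ φ : E n → ℂ, IsTestFunction φ → ∫ x, w x * (Δ φ) x = ∫ x, F x * φ x) :
    MemHLoc 2 w := by
  have h0 : MemHLoc 0 w := fun χ hχ =>
    ⟨hw.memLp_mul hχ.1.continuous hχ.2, memSobolev_zero_tdist _⟩
  have h1 := memHLoc_succ hw hF hwF h0 fun χ hχ => (memSobolev_zero_tdist _).mono (by norm_num)
  rw [zero_add] at h1
  have h2 := memHLoc_succ hw hF hwF h1 fun χ hχ => by
    rw [sub_self]; exact memSobolev_zero_tdist _
  rwa [one_add_one_eq_two] at h2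

lemma MemHLoc.mono {n : ℕ} {s t : ℝ} {u : E n → ℂ} (hu : MemHLoc s u) (h : t ≤ s) :
    MemHLoc t u := fun χ hχ => ⟨(hu χ hχ).1, (hu χ hχ).2.mono h⟩

/-- A distributional solution of the homogeneous Helmholtz equation is locally in every `H^s`. -/
lemma memHLoc_nat_of_helmholtz {n : ℕ} {k : ℝ} {w : E n → ℂ} (hw : MemL2Loc w)
    (hwk : ∀ φ : E n → ℂ, IsTestFunction φ → ∫ x, w x * ((Δ φ) x + k ^ 2 * φ x) = 0) (N : ℕ) :
    MemHLoc (N : ℝ) w := by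
  have hF : MemL2Loc fun x => (-(k : ℂ) ^ 2) * w x := hw.const_mul _
  have hwF : ∀ φ : E n → ℂ, IsTestFunction φ →
      ∫ x, w x * (Δ φ) x = ∫ x, (-(k : ℂ) ^ 2 * w x) * φ x := by
    intro φ hφ
    have i1 : Integrable fun x => w x * (Δ φ) x := by
      simpa only [mul_comm] using hw.integrable_mul hφ.laplacian.1.continuous hφ.laplacian.2
    have i2 : Integrable fun x => w x * φ x := by
      simpa only [mul_comm] using hw.integrable_mul hφ.1.continuous hφ.2
    have h1 := hwk φ hφ
    have h2 : ∫ x, w x * ((Δ φ) x + k ^ 2 * φ x)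
        = ∫ x, w x * (Δ φ) x + (k : ℂ) ^ 2 * (w x * φ x) :=
      integral_congr_ae (Eventually.of_forall fun x => by simp only; ring)
    rw [h2, integral_add i1 (i2.const_mul _), integral_const_mul] at h1
    simp only [mul_assoc]
    rw [integral_const_mul]
    linear_combination h1
  induction N with
  | zero => exact fun χ hχ => ⟨hw.memLp_mul hχ.1.continuous hχ.2, by
      rw [Nat.cast_zero]; exact memSobolev_zero_tdist _⟩
  | succ N ih =>
    rw [Nat.cast_succ]
    refine memHLoc_succ hw hF hwF ih fun χ hχ => ?_
    have e : tdist (hF.memLp_mul hχ.1.continuous hχ.2)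
        = (-(k : ℂ) ^ 2) • tdist (hw.memLp_mul hχ.1.continuous hχ.2) := by
      ext φ
      change _ = (-(k : ℂ) ^ 2) * tdist _ φ
      rw [tdist_apply, tdist_apply, ← integral_const_mul]
      refine integral_congr_ae (Eventually.of_forall fun x => ?_)
      simp only; ring
    rw [e]
    exact ((ih χ hχ).2.mono (by linarith)).smul _

/-! ### Interior smoothness -/

lemma ae_eq_of_forall_testFunction {n : ℕ} {g g' : E n → ℂ} (hg : LocallyIntegrable g)
    (hg' : LocallyIntegrable g')
    (h : ∀ φ : E n → ℂ, IsTestFunction φ → ∫ x, φ x * g x = ∫ x, φ x * g' x) :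
    g =ᵐ[volume] g' := by
  refine ae_eq_of_integral_contDiff_smul_eq hg hg' fun φ hφ hc => ?_
  have := h (fun x => (φ x : ℂ)) ⟨Complex.ofRealCLM.contDiff.comp hφ,
    hc.comp_left Complex.ofReal_zero⟩
  simpa only [Complex.real_smul] using this

lemma MemLp.locallyIntegrable_two {n : ℕ} {g : E n → ℂ} (hg : MemLp g 2) :
    LocallyIntegrable g := hg.locallyIntegrable (by norm_num)

/-- A square-integrable function in every Sobolev space is smooth up to a null set. -/
theorem exists_contDiff_of_memSobolev {n : ℕ} {g : E n → ℂ} (hg : MemLp g 2)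
    (h : ∀ N : ℕ, MemSobolev N 2 (tdist hg)) : ∃ G : E n → ℂ, ContDiff ℝ ∞ G ∧ G =ᵐ[volume] g := by
  set v : Lp (α := E n) ℂ 2 volume := 𝓕 (hg.toLp g) with hv
  have hvT : 𝓕 (tdist hg) = (v : 𝓢'(E n, ℂ)) := Lp.fourier_toTemperedDistribution_eq _
  -- all weighted versions of the Fourier transform are square-integrable
  have hw : ∀ N : ℕ, MemLp (fun x : E n => (((1 + ‖x‖ ^ 2) ^ ((N : ℝ) / 2) : ℝ) : ℂ) * v x) 2 := by
    intro N
    obtain ⟨f', hf'⟩ := memSobolev_iff_exists_smulLeftCLM_fourier.1 (h N)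
    refine (Lp.memLp f').ae_eq (ae_eq_of_forall_testFunction
      (MemLp.locallyIntegrable_two (Lp.memLp f')) ?_ fun φ hφ => ?_)
    · have c : Continuous fun x : E n => (((1 + ‖x‖ ^ 2) ^ ((N : ℝ) / 2) : ℝ) : ℂ) :=
        Complex.continuous_ofReal.comp (Continuous.rpow_const (by fun_prop)
          fun x => Or.inl (by positivity))
      exact (MemLp.locallyIntegrable_two (Lp.memLp v)).continuous_smul c
    · have h1 := congrArg (fun T : 𝓢'(E n, ℂ) => T (hφ.2.toSchwartzMap hφ.1)) hf'
      simp only [hvT] at h1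
      rw [smulLeftCLM_apply_apply, Lp.toTemperedDistribution_apply,
        Lp.toTemperedDistribution_apply] at h1
      simp only [smul_eq_mul] at h1
      have h2 : ∀ x, (SchwartzMap.smulLeftCLM ℂ
          (fun x : E n => (((1 + ‖x‖ ^ 2) ^ ((N : ℝ) / 2) : ℝ) : ℂ))
          (hφ.2.toSchwartzMap hφ.1)) x = (((1 + ‖x‖ ^ 2) ^ ((N : ℝ) / 2) : ℝ) : ℂ) * φ x := by
        intro x
        rw [SchwartzMap.smulLeftCLM_apply_apply (by fun_prop)]
        rfl
      simp only [h2] at h1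
      change _ = ∫ x, φ x * f' x at h1
      rw [← h1]
      refine integral_congr_ae (Eventually.of_forall fun x => ?_)
      simp only; ring
  -- hence the Fourier transform has integrable moments
  have hmom : ∀ j : ℕ, Integrable fun x : E n => ‖x‖ ^ j * ‖v x‖ := by
    intro j
    have h1 : MemLp (fun x : E n => (1 + ‖x‖ ^ 2) ^ (-((n : ℝ) + 1) / 2)) 2 := by
      have c : Continuous fun x : E n => (1 + ‖x‖ ^ 2) ^ (-((n : ℝ) + 1) / 2) :=
        Continuous.rpow_const (by fun_prop) fun x => Or.inl (by positivity)
      rw [memLp_two_iff_integrable_sq c.aestronglyMeasurable]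
      have := integrable_rpow_neg_one_add_norm_sq (E := E n) (μ := volume) (r := 2 * ((n : ℝ) + 1))
        (by rw [finrank_euclideanSpace_fin]; have : (0 : ℝ) ≤ n := by positivity
            linarith)
      refine this.congr (Eventually.of_forall fun x => ?_)
      simp only
      rw [← Real.rpow_natCast (_ ^ (_ : ℝ)) 2, ← Real.rpow_mul (by positivity)]
      congr 1; push_cast; ring
    have h2 := (hw (j + n + 1)).norm
    refine (h1.integrable_mul h2).mono' ?_ (Eventually.of_forall fun x => ?_)
    · exact (by fun_prop : Continuous fun x : E n => ‖x‖ ^ j).aestronglyMeasurable.mul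
        (Lp.memLp v).1.norm
    · rw [Real.norm_of_nonneg (by positivity)]
      simp only [Pi.mul_apply]
      rw [norm_mul, Complex.norm_real, Real.norm_of_nonneg (by positivity), ← mul_assoc,
        ← Real.rpow_add (by positivity)]
      refine mul_le_mul_of_nonneg_right ?_ (norm_nonneg _)
      have e : -((n : ℝ) + 1) / 2 + ((j + n + 1 : ℕ) : ℝ) / 2 = (j : ℝ) / 2 := by
        push_cast; ring
      rw [e, ← Real.rpow_natCast]
      have e2 : ‖x‖ ^ (j : ℝ) = (‖x‖ ^ 2) ^ ((j : ℝ) / 2) := by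
        rw [← Real.rpow_natCast, ← Real.rpow_mul (norm_nonneg _)]
        congr 1; push_cast; ring
      rw [e2]
      exact Real.rpow_le_rpow (by positivity) (by linarith) (by positivity)
  set vn : E n → ℂ := fun x => v (-x) with hvn
  have hvni : Integrable vn := by
    have := (hmom 0)
    simp only [pow_zero, one_mul] at this
    have h3 : Integrable (v : E n → ℂ) :=
      (integrable_norm_iff (Lp.memLp v).1).1 this
    exact h3.comp_neg
  refine ⟨𝓕 vn, ?_, ?_⟩
  · refine Real.contDiff_fourier (N := ⊤) fun j _ => ?_
    have := (hmom j).comp_neg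
    simpa only [norm_neg] using this
  · refine ae_eq_of_forall_testFunction ?_ (MemLp.locallyIntegrable_two hg) fun φ hφ => ?_
    · have : Continuous (𝓕 vn) := VectorFourier.fourierIntegral_continuous
        Real.continuous_fourierChar (by exact continuous_inner) hvni
      exact this.locallyIntegrable
    · set Φ : 𝓢(E n, ℂ) := hφ.2.toSchwartzMap hφ.1
      have h1 : tdist hg Φ = ∫ x, φ x * g x := tdist_apply hg Φ
      have h2 : tdist hg = 𝓕⁻ (v : 𝓢'(E n, ℂ)) := by
        rw [← hvT, FourierTransform.fourierInv_fourier_eq]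
      rw [h2, fourierInv_apply, Lp.toTemperedDistribution_apply] at h1
      rw [← h1]
      simp only [smul_eq_mul]
      have h3 : ∀ x, (𝓕⁻ Φ) x = 𝓕 φ (-x) := by
        intro x
        rw [SchwartzMap.fourierInv_coe, Real.fourierInv_eq_fourier_neg]
        rfl
      simp only [h3]
      have h4 : ∫ x, 𝓕 φ (-x) * v x = ∫ x, 𝓕 φ x * vn x := by
        rw [← integral_neg_eq_self]
        simp only [neg_neg, hvn]
      rw [h4]
      have hφi : Integrable φ := hφ.1.continuous.integrable_of_hasCompactSupport hφ.2
      have h5 := VectorFourier.integral_fourierIntegral_smul_eq_flip (L := innerₗ (E n))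
        Real.continuous_fourierChar (by exact continuous_inner) hφi hvni
      rw [flip_innerₗ] at h5
      exact h5.symm

/-- Weyl's lemma: distributional solutions of the Helmholtz equation are smooth. -/
theorem exists_contDiff_of_helmholtz {n : ℕ} {k : ℝ} {w : E n → ℂ} (hw : MemL2Loc w)
    (hwk : ∀ φ : E n → ℂ, IsTestFunction φ → ∫ x, w x * ((Δ φ) x + k ^ 2 * φ x) = 0) :
    ∃ s : E n → ℂ, ContDiff ℝ ∞ s ∧ s =ᵐ[volume] w := by
  have hN := memHLoc_nat_of_helmholtz hw hwk
  have local_rep : ∀ R : ℝ, ∃ G : E n → ℂ, ContDiff ℝ ∞ G ∧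
      ∀ᵐ x, x ∈ Metric.ball (0 : E n) R → G x = w x := by
    intro R
    obtain ⟨χ, hχ, hχ1⟩ := exists_testFunction_eq_one (n := n) R
    obtain ⟨G, hG, hGe⟩ := exists_contDiff_of_memSobolev (hw.memLp_mul hχ.1.continuous hχ.2)
      fun N => (hN N χ hχ).2
    refine ⟨G, hG, hGe.mono fun x hx hxR => ?_⟩
    rw [hx]
    change χ x * w x = w x
    rw [hχ1 x (Metric.ball_subset_closedBall hxR), one_mul]
  choose G hG hGe using local_rep
  -- local representatives agree on the common ball
  have agree : ∀ R S : ℝ, R ≤ S → ∀ x ∈ Metric.ball (0 : E n) R, G R x = G S x := by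
    intro R S hRS
    refine Measure.eqOn_open_of_ae_eq (μ := volume) ?_ Metric.isOpen_ball
      (hG R).continuous.continuousOn (hG S).continuous.continuousOn
    rw [EventuallyEq, ae_restrict_iff' measurableSet_ball]
    filter_upwards [hGe R, hGe S] with x h1 h2 hx
    rw [h1 hx, h2 (Metric.ball_subset_ball hRS hx)]
  have hs : ∀ R x, x ∈ Metric.ball (0 : E n) R → G (‖x‖ + 1) x = G R x := by
    intro R x hx
    rcases le_total (‖x‖ + 1) R with h | h
    · exact agree _ _ h x (by simp)
    · exact (agree _ _ h x hx).symm
  refine ⟨fun x => G (‖x‖ + 1) x, ?_, ?_⟩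
  · rw [contDiff_iff_contDiffAt]
    intro x
    refine ((hG (‖x‖ + 1)).contDiffAt (x := x)).congr_of_eventuallyEq ?_
    filter_upwards [Metric.isOpen_ball.mem_nhds (show x ∈ Metric.ball (0 : E n) (‖x‖ + 1) by simp)]
      with y hy
    exact hs _ y hy
  · have : ∀ᵐ x, ∀ N : ℕ, x ∈ Metric.ball (0 : E n) N → G N x = w x :=
      ae_all_iff.2 fun N => hGe N
    filter_upwards [this] with x hx
    obtain ⟨N, hNx⟩ := exists_nat_gt ‖x‖
    have hm : x ∈ Metric.ball (0 : E n) (N : ℝ) := by simpa using hNx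
    rw [hs N x hm, hx N hm]

/-! ### Rellich's identity and uniqueness of radiating solutions -/

/-- The partial derivative of a real-valued function in the `i`-th coordinate direction. -/
def rpderiv {n : ℕ} (i : Fin n) (a : E n → ℝ) : E n → ℝ :=
  fun x => fderiv ℝ a x (EuclideanSpace.single i 1)

lemma contDiff_rpderiv {n : ℕ} {a : E n → ℝ} {p q : WithTop ℕ∞} (ha : ContDiff ℝ q a)
    (h : p + 1 ≤ q) (i : Fin n) : ContDiff ℝ p (rpderiv i a) :=
  (ha.fderiv_right h).clm_apply contDiff_const

lemma hasDerivAt_max_zero_sq (t : ℝ) : HasDerivAt (fun s : ℝ => max s 0 ^ 2) (2 * max t 0) t := by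
  rcases lt_trichotomy t 0 with ht | ht | ht
  · rw [max_eq_right ht.le, mul_zero]
    refine (hasDerivAt_const t (0 : ℝ)).congr_of_eventuallyEq ?_
    filter_upwards [gt_mem_nhds ht] with s hs
    simp [max_eq_right hs.le]
  · subst ht
    rw [hasDerivAt_iff_isLittleO_nhds_zero]
    simp only [zero_add, max_self, ne_eq, OfNat.ofNat_ne_zero, not_false_eq_true, zero_pow,
      sub_zero, mul_zero, smul_eq_mul]
    have h1 : (fun h : ℝ => max h 0 ^ 2) =O[𝓝 0] fun h : ℝ => h ^ 2 := by
      refine IsBigO.of_bound 1 (Eventually.of_forall fun h => ?_)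
      rw [one_mul, Real.norm_of_nonneg (sq_nonneg _), Real.norm_of_nonneg (sq_nonneg _)]
      rcases le_total h 0 with h0 | h0
      · rw [max_eq_right h0]; simpa using sq_nonneg h
      · rw [max_eq_left h0]
    refine h1.trans_isLittleO ?_
    simpa using isLittleO_pow_pow (𝕜 := ℝ) (m := 1) (n := 2) (by norm_num)
  · rw [max_eq_left ht.le]
    have : HasDerivAt (fun s : ℝ => s ^ 2) (2 * t) t := by simpa using hasDerivAt_pow 2 t
    refine this.congr_of_eventuallyEq ?_
    filter_upwards [lt_mem_nhds ht] with s hs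
    rw [max_eq_left hs.le]

/-- The cutoff `(R² - |x|²)₊`. -/
def cap {n : ℕ} (R : ℝ) (x : E n) : ℝ := max (R ^ 2 - ‖x‖ ^ 2) 0

lemma cap_nonneg {n : ℕ} (R : ℝ) (x : E n) : 0 ≤ cap R x := le_max_right _ _

lemma cap_le {n : ℕ} (R : ℝ) (x : E n) : cap R x ≤ R ^ 2 :=
  max_le (by linarith [sq_nonneg ‖x‖]) (sq_nonneg _)

lemma continuous_cap {n : ℕ} (R : ℝ) : Continuous (cap (n := n) R) := by
  unfold cap; fun_prop

lemma cap_eq_zero {n : ℕ} {R : ℝ} (hR : 0 ≤ R) {x : E n} (hx : R ≤ ‖x‖) : cap R x = 0 :=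
  max_eq_right (by nlinarith)

lemma cap_mul_norm_sq {n : ℕ} (R : ℝ) (x : E n) :
    cap R x * ‖x‖ ^ 2 = R ^ 2 * cap R x - cap R x ^ 2 := by
  unfold cap
  rcases le_total (R ^ 2 - ‖x‖ ^ 2) 0 with h | h
  · rw [max_eq_right h]; ring
  · rw [max_eq_left h]; ring

lemma hasCompactSupport_cap {n : ℕ} {R : ℝ} (hR : 0 ≤ R) : HasCompactSupport (cap (n := n) R) := by
  refine HasCompactSupport.intro (isCompact_closedBall (0 : E n) R) fun x hx => ?_
  refine cap_eq_zero hR ?_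
  simp only [Metric.mem_closedBall, dist_zero_right, not_le] at hx
  exact hx.le

lemma hasFDerivAt_cap_sq {n : ℕ} (R : ℝ) (x : E n) :
    HasFDerivAt (fun y : E n => cap R y ^ 2) ((-4 * cap R x) • innerSL ℝ x) x := by
  have h1 : HasFDerivAt (fun y : E n => R ^ 2 - ‖y‖ ^ 2) (-(2 • innerSL ℝ x)) x := by
    simpa using ((hasStrictFDerivAt_norm_sq x).hasFDerivAt).const_sub (R ^ 2)
  have h2 := (hasDerivAt_max_zero_sq (R ^ 2 - ‖x‖ ^ 2)).comp_hasFDerivAt x h1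
  refine h2.congr_fderiv ?_
  ext v
  simp [cap]; ring

lemma rpderiv_cap_sq {n : ℕ} (R : ℝ) (x : E n) (i : Fin n) :
    rpderiv i (fun y : E n => cap R y ^ 2) x = -4 * cap R x * x i := by
  rw [rpderiv, (hasFDerivAt_cap_sq R x).fderiv]
  simp [EuclideanSpace.inner_single_right]

lemma integrable_cap_mul {n : ℕ} {R : ℝ} (hR : 0 ≤ R) {g : E n → ℝ} (hg : Continuous g) :
    Integrable fun x => cap R x * g x :=
  ((continuous_cap R).mul hg).integrable_of_hasCompactSupport (hasCompactSupport_cap hR).mul_right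

lemma integrable_cap_sq_mul {n : ℕ} {R : ℝ} (hR : 0 ≤ R) {g : E n → ℝ} (hg : Continuous g) :
    Integrable fun x => cap R x ^ 2 * g x := by
  have : Integrable fun x : E n => cap R x * (cap R x * g x) :=
    integrable_cap_mul hR ((continuous_cap R).mul hg)
  simpa only [sq, mul_assoc] using this

/-- The divergence theorem, tested against `(R² - |x|²)₊²`. -/
lemma integral_cap_sq_mul_div {n : ℕ} {R : ℝ} (hR : 0 ≤ R) {F : Fin n → E n → ℝ}
    (hF : ∀ i, ContDiff ℝ 1 (F i)) :
    ∫ x, cap R x ^ 2 * ∑ i, rpderiv i (F i) x = 4 * ∫ x, cap R x * ∑ i, x i * F i x := by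
  have c : ∀ i, Continuous (rpderiv i (F i)) := fun i =>
    (contDiff_rpderiv (p := 0) (hF i) (by norm_num) i).continuous
  have i1 : ∀ i, Integrable fun x : E n => cap R x * (x i * F i x) := fun i =>
    integrable_cap_mul hR (Continuous.mul (by fun_prop) (hF i).continuous)
  have key : ∀ i, ∫ x, cap R x ^ 2 * rpderiv i (F i) x = 4 * ∫ x, cap R x * (x i * F i x) := by
    intro i
    have e : ∀ x : E n, fderiv ℝ (fun y : E n => cap R y ^ 2) x (EuclideanSpace.single i 1) * F i x
        = -4 * (cap R x * (x i * F i x)) := by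
      intro x
      have := rpderiv_cap_sq R x i
      rw [rpderiv] at this
      rw [this]; ring
    have := integral_mul_fderiv_eq_neg_fderiv_mul_of_integrable (μ := volume)
      (f := fun y : E n => cap R y ^ 2) (g := F i) (v := EuclideanSpace.single i 1) (𝕜 := ℝ)
      (by simp only [e]; exact (i1 i).const_mul _) (integrable_cap_sq_mul hR (c i))
      (integrable_cap_sq_mul hR (hF i).continuous)
      (fun x _ => (hasFDerivAt_cap_sq R x).differentiableAt)
      (fun x _ => (hF i).differentiable (by norm_num) x)
    simp only [e] at this
    rw [integral_const_mul] at this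
    rw [show (fun x => cap R x ^ 2 * rpderiv i (F i) x)
      = fun x => cap R x ^ 2 * fderiv ℝ (F i) x (EuclideanSpace.single i 1) from rfl, this]
    ring
  simp only [Finset.mul_sum]
  rw [integral_finsetSum _ fun i _ => integrable_cap_sq_mul hR (c i),
    integral_finsetSum _ fun i _ => i1 i, Finset.mul_sum]
  exact Finset.sum_congr rfl fun i _ => key i

lemma hasDerivAt_line {n : ℕ} {f : E n → ℝ} (hf : ContDiff ℝ 1 f) (x : E n) (i : Fin n) :
    HasDerivAt (fun t : ℝ => f (x + t • EuclideanSpace.single i (1 : ℝ))) (rpderiv i f x) 0 :=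
  ((hf.differentiable (by norm_num) x).hasFDerivAt.hasLineDerivAt (EuclideanSpace.single i 1))

lemma rpderiv_eq_of_hasDerivAt {n : ℕ} {f : E n → ℝ} (hf : ContDiff ℝ 1 f) {x : E n} {i : Fin n}
    {d : ℝ} (h : HasDerivAt (fun t : ℝ => f (x + t • EuclideanSpace.single i (1 : ℝ))) d 0) :
    rpderiv i f x = d := (hasDerivAt_line hf x i).unique h

lemma rpderiv_comm {n : ℕ} {a : E n → ℝ} (ha : ContDiff ℝ 2 a) (i j : Fin n) (x : E n) :
    rpderiv i (rpderiv j a) x = rpderiv j (rpderiv i a) x := by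
  have h1 : DifferentiableAt ℝ (fderiv ℝ a) x :=
    (ha.fderiv_right (m := 1) (by norm_num)).differentiable (by norm_num) x
  have h2 : ∀ i j, rpderiv i (rpderiv j a) x
      = fderiv ℝ (fderiv ℝ a) x (EuclideanSpace.single i 1) (EuclideanSpace.single j 1) := by
    intro i j
    have h2 : HasFDerivAt (rpderiv j a)
        ((fderiv ℝ (fderiv ℝ a) x).flip (EuclideanSpace.single j 1)) x := by
      refine (h1.hasFDerivAt.clm_apply
        (hasFDerivAt_const (𝕜 := ℝ) (EuclideanSpace.single j (1 : ℝ)) x)).congr_fderiv ?_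
      ext v; simp
    rw [rpderiv, h2.fderiv]
    rfl
  rw [h2, h2]
  exact (ha.contDiffAt.isSymmSndFDerivAt (by simp)).eq _ _

/-- The Euler derivative `x · ∇a`. -/
def euler {n : ℕ} (a : E n → ℝ) (x : E n) : ℝ := ∑ j, x j * rpderiv j a x

/-- `|∇a|²`. -/
def gradSq {n : ℕ} (a : E n → ℝ) (x : E n) : ℝ := ∑ j, rpderiv j a x ^ 2

lemma continuous_euler {n : ℕ} {a : E n → ℝ} (ha : ContDiff ℝ 2 a) : Continuous (euler a) :=
  continuous_finsetSum _ fun j _ => Continuous.mul (by fun_prop)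
    (contDiff_rpderiv (p := 0) ha (by norm_num) j).continuous

lemma continuous_gradSq {n : ℕ} {a : E n → ℝ} (ha : ContDiff ℝ 2 a) : Continuous (gradSq a) :=
  continuous_finsetSum _ fun j _ =>
    (contDiff_rpderiv (p := 0) ha (by norm_num) j).continuous.pow 2

lemma euler_eq_fderiv {n : ℕ} {a : E n → ℝ} (x : E n) : euler a x = fderiv ℝ a x x := by
  have h : ∀ L : E n →L[ℝ] ℝ, L x = ∑ j, x j * L (EuclideanSpace.single j 1) := by
    intro L
    conv_lhs => rw [← (EuclideanSpace.basisFun (Fin n) ℝ).sum_repr x]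
    simp [map_sum]
  exact (h _).symm

lemma euler_sq_le {n : ℕ} (a : E n → ℝ) (x : E n) : euler a x ^ 2 ≤ ‖x‖ ^ 2 * gradSq a x := by
  rw [EuclideanSpace.real_norm_sq_eq]
  exact Finset.sum_mul_sq_le_sq_mul_sq _ _ _

/-- The Rellich–Pohozaev identity: `Δa = -k²a` is multiplied by `x · ∇a + (n-1)/2 a`. -/
lemma integral_rellich {n : ℕ} {a : E n → ℝ} {k R : ℝ} (hR : 0 ≤ R) (ha : ContDiff ℝ 2 a)
    (hΔ : ∀ x, ∑ i, rpderiv i (rpderiv i a) x = -(k ^ 2 * a x)) :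
    ∫ x, cap R x ^ 2 * (gradSq a x + k ^ 2 * a x ^ 2)
      = 4 * ∫ x, cap R x * (2 * euler a x ^ 2 + (k ^ 2 * a x ^ 2 - gradSq a x) * ‖x‖ ^ 2
          + ((n : ℝ) - 1) * (a x * euler a x)) := by
  have ha1 : ContDiff ℝ 1 a := ha.of_le (by norm_num)
  have hG : ∀ i, ContDiff ℝ 1 (rpderiv i a) := fun i => contDiff_rpderiv ha (by norm_num) i
  have hx : ∀ i : Fin n, ContDiff ℝ 1 fun x : E n => x i := fun i => by fun_prop
  have hT : ContDiff ℝ 1 (euler a) := ContDiff.sum fun j _ => (hx j).mul (hG j)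
  have hS : ContDiff ℝ 1 (gradSq a) := ContDiff.sum fun j _ => (hG j).pow 2
  set F : Fin n → E n → ℝ := fun i x => 2 * euler a x * rpderiv i a x
    + (k ^ 2 * a x ^ 2 - gradSq a x) * x i + ((n : ℝ) - 1) * (a x * rpderiv i a x) with hFdef
  have hF : ∀ i, ContDiff ℝ 1 (F i) := fun i =>
    (((contDiff_const.mul hT).mul (hG i)).add (((contDiff_const.mul (ha1.pow 2)).sub hS).mul
      (hx i))).add (contDiff_const.mul (ha1.mul (hG i)))
  have hd : ∀ i x, rpderiv i (F i) x
      = 2 * (rpderiv i a x + ∑ j, x j * rpderiv i (rpderiv j a) x) * rpderiv i a x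
        + 2 * euler a x * rpderiv i (rpderiv i a) x
        + ((k ^ 2 * (2 * a x * rpderiv i a x)
            - ∑ j, 2 * rpderiv j a x * rpderiv i (rpderiv j a) x) * x i
          + (k ^ 2 * a x ^ 2 - gradSq a x))
        + ((n : ℝ) - 1) * (rpderiv i a x * rpderiv i a x + a x * rpderiv i (rpderiv i a) x) := by
    intro i x
    refine rpderiv_eq_of_hasDerivAt (hF i) ?_
    have d0 := hasDerivAt_line ha1 x i
    have dG := fun j => hasDerivAt_line (hG j) x i
    have dx : ∀ j, HasDerivAt (fun t : ℝ => (x + t • EuclideanSpace.single i (1 : ℝ)) j)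
        (if j = i then 1 else 0) 0 := by
      intro j
      have := ((hasDerivAt_id (0 : ℝ)).mul_const (if j = i then (1 : ℝ) else 0)).const_add (x j)
      simpa [Pi.single_apply] using this
    have dT : HasDerivAt (fun t : ℝ => euler a (x + t • EuclideanSpace.single i (1 : ℝ)))
        (rpderiv i a x + ∑ j, x j * rpderiv i (rpderiv j a) x) 0 := by
      have := HasDerivAt.fun_sum (u := Finset.univ) fun j _ => (dx j).mul (dG j)
      refine this.congr_deriv ?_
      simp [Finset.sum_add_distrib]
    have dS : HasDerivAt (fun t : ℝ => gradSq a (x + t • EuclideanSpace.single i (1 : ℝ)))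
        (∑ j, 2 * rpderiv j a x * rpderiv i (rpderiv j a) x) 0 := by
      have := HasDerivAt.fun_sum (u := Finset.univ) fun j _ => (dG j).pow 2
      refine this.congr_deriv ?_
      simp
    have := (((dT.const_mul 2).mul (dG i)).add ((((d0.pow 2).const_mul (k ^ 2)).sub dS).mul
      (dx i))).add ((d0.mul (dG i)).const_mul ((n : ℝ) - 1))
    refine this.congr_deriv ?_
    simp
  have hdiv : ∀ x, ∑ i, rpderiv i (F i) x = gradSq a x + k ^ 2 * a x ^ 2 := by
    intro x
    have e1 : ∑ i, (∑ j, x j * rpderiv i (rpderiv j a) x) * rpderiv i a x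
        = ∑ i, (∑ j, rpderiv j a x * rpderiv i (rpderiv j a) x) * x i := by
      simp only [Finset.sum_mul]
      rw [Finset.sum_comm]
      refine Finset.sum_congr rfl fun i _ => Finset.sum_congr rfl fun j _ => ?_
      rw [rpderiv_comm ha j i]; ring
    have e2 : ∀ i, rpderiv i (F i) x
        = 2 * rpderiv i a x ^ 2 + 2 * ((∑ j, x j * rpderiv i (rpderiv j a) x) * rpderiv i a x)
          + (2 * euler a x + ((n : ℝ) - 1) * a x) * rpderiv i (rpderiv i a) x
          + (2 * k ^ 2 * a x) * (x i * rpderiv i a x)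
          - 2 * ((∑ j, rpderiv j a x * rpderiv i (rpderiv j a) x) * x i)
          + (k ^ 2 * a x ^ 2 - gradSq a x) + ((n : ℝ) - 1) * rpderiv i a x ^ 2 := by
      intro i
      have : ∑ j, 2 * rpderiv j a x * rpderiv i (rpderiv j a) x
          = 2 * ∑ j, rpderiv j a x * rpderiv i (rpderiv j a) x := by
        rw [Finset.mul_sum]; exact Finset.sum_congr rfl fun j _ => by ring
      rw [hd, this]; ring
    simp only [e2, Finset.sum_add_distrib, Finset.sum_sub_distrib, ← Finset.mul_sum, e1, hΔ,
      Finset.sum_const, Finset.card_univ, Fintype.card_fin, nsmul_eq_mul]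
    simp only [euler, gradSq]
    ring
  have key := integral_cap_sq_mul_div hR hF
  simp only [hdiv] at key
  rw [key]
  congr 1
  refine integral_congr_ae (Eventually.of_forall fun x => ?_)
  simp only
  congr 1
  rw [EuclideanSpace.real_norm_sq_eq]
  have e3 : ∀ i, x i * F i x = 2 * euler a x * (x i * rpderiv i a x)
      + (k ^ 2 * a x ^ 2 - gradSq a x) * x i ^ 2
      + ((n : ℝ) - 1) * a x * (x i * rpderiv i a x) := by
    intro i; simp only [hFdef]; ring
  simp only [e3, Finset.sum_add_distrib, ← Finset.mul_sum]
  simp only [euler]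
  ring

/-- Conservation of energy flux through spheres: the flux `Im(ū ∂u/∂r)` of `u = a + ib`, averaged
over spheres, vanishes. -/
lemma integral_flux {n : ℕ} {a b : E n → ℝ} {k R : ℝ} (hR : 0 ≤ R) (ha : ContDiff ℝ 2 a)
    (hb : ContDiff ℝ 2 b) (hΔa : ∀ x, ∑ i, rpderiv i (rpderiv i a) x = -(k ^ 2 * a x))
    (hΔb : ∀ x, ∑ i, rpderiv i (rpderiv i b) x = -(k ^ 2 * b x)) :
    ∫ x, cap R x * (a x * euler b x - b x * euler a x) = 0 := by
  have ha1 : ContDiff ℝ 1 a := ha.of_le (by norm_num)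
  have hb1 : ContDiff ℝ 1 b := hb.of_le (by norm_num)
  have hG : ∀ i, ContDiff ℝ 1 (rpderiv i a) := fun i => contDiff_rpderiv ha (by norm_num) i
  have hG' : ∀ i, ContDiff ℝ 1 (rpderiv i b) := fun i => contDiff_rpderiv hb (by norm_num) i
  set F : Fin n → E n → ℝ := fun i x => a x * rpderiv i b x - b x * rpderiv i a x with hFdef
  have hF : ∀ i, ContDiff ℝ 1 (F i) := fun i => (ha1.mul (hG' i)).sub (hb1.mul (hG i))
  have hd : ∀ i x, rpderiv i (F i) x
      = a x * rpderiv i (rpderiv i b) x - b x * rpderiv i (rpderiv i a) x := by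
    intro i x
    refine rpderiv_eq_of_hasDerivAt (hF i) ?_
    have := ((hasDerivAt_line ha1 x i).mul (hasDerivAt_line (hG' i) x i)).sub
      ((hasDerivAt_line hb1 x i).mul (hasDerivAt_line (hG i) x i))
    refine this.congr_deriv ?_
    simp; ring
  have key := integral_cap_sq_mul_div hR hF
  have hdiv : ∀ x, ∑ i, rpderiv i (F i) x = 0 := by
    intro x
    simp only [hd, Finset.sum_sub_distrib, ← Finset.mul_sum, hΔa, hΔb]
    ring
  have e : ∀ x, ∑ i, x i * F i x = a x * euler b x - b x * euler a x := by
    intro x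
    simp only [euler, Finset.mul_sum, ← Finset.sum_sub_distrib, hFdef]
    exact Finset.sum_congr rfl fun i _ => by ring
  simp only [hdiv, mul_zero, integral_zero, e] at key
  linarith

/-- The energy density of the complex-valued function `a + ib`. -/
def energy {n : ℕ} (k : ℝ) (a b : E n → ℝ) (x : E n) : ℝ :=
  gradSq a x + gradSq b x + k ^ 2 * (a x ^ 2 + b x ^ 2)

/-- The square of the modulus of `∂u/∂r - iku` for `u = a + ib`. -/
def defect {n : ℕ} (k : ℝ) (a b : E n → ℝ) (x : E n) : ℝ :=
  (‖x‖⁻¹ * euler a x + k * b x) ^ 2 + (‖x‖⁻¹ * euler b x - k * a x) ^ 2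

lemma norm_mul_radial {n : ℕ} (a : E n → ℝ) (x : E n) : ‖x‖ * (‖x‖⁻¹ * euler a x) = euler a x := by
  rcases eq_or_ne x 0 with rfl | hx
  · simp [euler]
  · field_simp [norm_ne_zero_iff.2 hx]

lemma radial_sq_le {n : ℕ} (a : E n → ℝ) (x : E n) : (‖x‖⁻¹ * euler a x) ^ 2 ≤ gradSq a x := by
  have hS : 0 ≤ gradSq a x := Finset.sum_nonneg fun i _ => sq_nonneg _
  rcases eq_or_ne x 0 with rfl | hx
  · simpa [euler] using hS
  · rw [mul_pow, inv_pow, inv_mul_le_iff₀ (by positivity)]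
    exact euler_sq_le a x

lemma continuous_energy {n : ℕ} {k : ℝ} {a b : E n → ℝ} (ha : ContDiff ℝ 2 a)
    (hb : ContDiff ℝ 2 b) : Continuous (energy k a b) :=
  ((continuous_gradSq ha).add (continuous_gradSq hb)).add
    (continuous_const.mul ((ha.continuous.pow 2).add (hb.continuous.pow 2)))

lemma energy_nonneg {n : ℕ} (k : ℝ) (a b : E n → ℝ) (x : E n) : 0 ≤ energy k a b x := by
  have h1 : 0 ≤ gradSq a x := Finset.sum_nonneg fun i _ => sq_nonneg _
  have h2 : 0 ≤ gradSq b x := Finset.sum_nonneg fun i _ => sq_nonneg _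
  unfold energy; positivity

lemma defect_le {n : ℕ} (k : ℝ) (a b : E n → ℝ) (x : E n) :
    defect k a b x ≤ 2 * energy k a b x := by
  have h1 := radial_sq_le a x
  have h2 := radial_sq_le b x
  unfold defect energy
  nlinarith [sq_nonneg (‖x‖⁻¹ * euler a x - k * b x), sq_nonneg (‖x‖⁻¹ * euler b x + k * a x)]

lemma measurable_defect {n : ℕ} {k : ℝ} {a b : E n → ℝ} (ha : ContDiff ℝ 2 a)
    (hb : ContDiff ℝ 2 b) : Measurable (defect k a b) := by
  have h1 := (continuous_euler ha).measurable
  have h2 := (continuous_euler hb).measurable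
  have h3 := ha.continuous.measurable
  have h4 := hb.continuous.measurable
  unfold defect
  fun_prop

section Energy

variable {n : ℕ} {k R : ℝ} {a b : E n → ℝ}

/-- Rellich's identity bounds the energy, weighted by `(R² - |x|²)₊²`, by an integral with weight
`(R² - |x|²)₊` of the radial energy `q = |∂u/∂r|² + k²|u|²`. The first bound follows from
`q ≤ energy`, and is a differential inequality in `R`; for the second, the flux identity replaces `q` by
`|∂u/∂r - iku|²`. -/
lemma integral_energy_le (hn : 1 ≤ n) (hk : 0 < k) (hR : 0 ≤ R) (ha : ContDiff ℝ 2 a)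
    (hb : ContDiff ℝ 2 b)
    (hΔa : ∀ x, ∑ i, rpderiv i (rpderiv i a) x = -(k ^ 2 * a x))
    (hΔb : ∀ x, ∑ i, rpderiv i (rpderiv i b) x = -(k ^ 2 * b x)) :
    5 * ∫ x, cap R x ^ 2 * energy k a b x
        ≤ (R + ((n : ℝ) - 1) / (2 * k)) * (4 * R * ∫ x, cap R x * energy k a b x) ∧
    ∫ x, cap R x ^ 2 * energy k a b x
        ≤ 4 * (R + ((n : ℝ) - 1) / (2 * k)) * ∫ x, cap R x * (‖x‖ * defect k a b x) := by
  set c : ℝ := ((n : ℝ) - 1) / (2 * k) with hc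
  have hn1 : (0 : ℝ) ≤ (n : ℝ) - 1 := by
    have : (1 : ℝ) ≤ n := by exact_mod_cast hn
    linarith
  have hc0 : 0 ≤ c := by positivity
  set q : E n → ℝ := fun x => (‖x‖⁻¹ * euler a x) ^ 2 + (‖x‖⁻¹ * euler b x) ^ 2
    + k ^ 2 * (a x ^ 2 + b x ^ 2) with hq
  have hq0 : ∀ x, 0 ≤ q x := fun x => by simp only [hq]; positivity
  have hqe : ∀ x, q x ≤ energy k a b x := fun x => by
    have h1 := radial_sq_le a x
    have h2 := radial_sq_le b x
    simp only [hq, energy]; linarith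
  have hqm : Measurable q := by
    have h1 := (continuous_euler ha).measurable
    have h2 := (continuous_euler hb).measurable
    have h3 := ha.continuous.measurable
    have h4 := hb.continuous.measurable
    simp only [hq]
    fun_prop
  have hce := continuous_energy (k := k) ha hb
  have hcn : Continuous fun x : E n => ‖x‖ := continuous_norm
  have iq : ∀ g : E n → ℝ, Continuous g → (∀ x, 0 ≤ g x) →
      Integrable fun x => cap R x * (g x * q x) := by
    intro g hg hg0
    refine (integrable_cap_mul hR (hg.mul hce)).mono'
      ((continuous_cap R).measurable.mul (hg.measurable.mul hqm)).aestronglyMeasurable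
      (Eventually.of_forall fun x => ?_)
    rw [Real.norm_of_nonneg (mul_nonneg (cap_nonneg _ _) (mul_nonneg (hg0 x) (hq0 x)))]
    exact mul_le_mul_of_nonneg_left (mul_le_mul_of_nonneg_left (hqe x) (hg0 x)) (cap_nonneg _ _)
  -- Rellich's identity for the real and imaginary parts
  have ra := integral_rellich hR ha hΔa
  have rb := integral_rellich hR hb hΔb
  have cr : ∀ {d : E n → ℝ}, ContDiff ℝ 2 d → Continuous fun x =>
      2 * euler d x ^ 2 + (k ^ 2 * d x ^ 2 - gradSq d x) * ‖x‖ ^ 2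
        + ((n : ℝ) - 1) * (d x * euler d x) := by
    intro d hd
    have h1 := continuous_euler hd
    have h2 := continuous_gradSq hd
    have h3 := hd.continuous
    fun_prop
  have cl : ∀ {d : E n → ℝ}, ContDiff ℝ 2 d → Continuous fun x => gradSq d x + k ^ 2 * d x ^ 2 := by
    intro d hd
    have h2 := continuous_gradSq hd
    have h3 := hd.continuous
    fun_prop
  have hP2 : ∫ x, cap R x ^ 2 * energy k a b x
      ≤ 4 * ∫ x, cap R x * ((‖x‖ ^ 2 + c * ‖x‖) * q x) := by
    have e1 : ∫ x, cap R x ^ 2 * energy k a b x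
        = (∫ x, cap R x ^ 2 * (gradSq a x + k ^ 2 * a x ^ 2))
          + ∫ x, cap R x ^ 2 * (gradSq b x + k ^ 2 * b x ^ 2) := by
      rw [← integral_add (integrable_cap_sq_mul hR (cl ha)) (integrable_cap_sq_mul hR (cl hb))]
      refine integral_congr_ae (Eventually.of_forall fun x => ?_)
      simp only [energy]; ring
    rw [e1, ra, rb, ← mul_add, ← integral_add (integrable_cap_mul hR (cr ha))
      (integrable_cap_mul hR (cr hb))]
    refine mul_le_mul_of_nonneg_left (integral_mono ?_ (iq _ (by fun_prop) fun x => by positivity)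
      fun x => ?_) (by norm_num)
    · exact (integrable_cap_mul hR (cr ha)).add (integrable_cap_mul hR (cr hb))
    simp only
    rw [← mul_add]
    refine mul_le_mul_of_nonneg_left ?_ (cap_nonneg _ _)
    -- the pointwise bound, separately for the two parts
    have pw : ∀ d : E n → ℝ, 2 * euler d x ^ 2 + (k ^ 2 * d x ^ 2 - gradSq d x) * ‖x‖ ^ 2
          + ((n : ℝ) - 1) * (d x * euler d x)
        ≤ (‖x‖ ^ 2 + c * ‖x‖) * ((‖x‖⁻¹ * euler d x) ^ 2 + k ^ 2 * d x ^ 2) := by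
      intro d
      have h1 := euler_sq_le d x
      have h2 := norm_mul_radial d x
      set v := ‖x‖⁻¹ * euler d x
      have h3 : ((n : ℝ) - 1) * (d x * v) ≤ c * (v ^ 2 + k ^ 2 * d x ^ 2) := by
        have : ((n : ℝ) - 1) = c * (2 * k) := by rw [hc]; field_simp
        rw [this, mul_assoc]
        exact mul_le_mul_of_nonneg_left (by nlinarith [sq_nonneg (v - k * d x)]) hc0
      have h4 := mul_le_mul_of_nonneg_left h3 (norm_nonneg x)
      rw [← h2] at h1 ⊢
      nlinarith
    have := add_le_add (pw a) (pw b)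
    refine this.trans (le_of_eq ?_)
    simp only [hq]; ring
  constructor
  · have h1 : ∫ x, cap R x * ((‖x‖ ^ 2 + c * ‖x‖) * q x)
        ≤ ∫ x, ((R ^ 2 + c * R) * (cap R x * energy k a b x) - cap R x ^ 2 * energy k a b x) := by
      refine integral_mono (iq _ (by fun_prop) fun x => by positivity)
        (((integrable_cap_mul hR hce).const_mul _).sub (integrable_cap_sq_mul hR hce)) fun x => ?_
      have h2 : cap R x * ((‖x‖ ^ 2 + c * ‖x‖) * q x)
          ≤ cap R x * ((‖x‖ ^ 2 + c * ‖x‖) * energy k a b x) :=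
        mul_le_mul_of_nonneg_left (mul_le_mul_of_nonneg_left (hqe x) (by positivity))
          (cap_nonneg _ _)
      have h3 : cap R x * ‖x‖ ≤ cap R x * R := by
        rcases le_total R ‖x‖ with h | h
        · simp [cap_eq_zero hR h]
        · exact mul_le_mul_of_nonneg_left h (cap_nonneg _ _)
      have h4 := mul_le_mul_of_nonneg_right (mul_le_mul_of_nonneg_left h3 hc0)
        (energy_nonneg k a b x)
      have h5 := congrArg (· * energy k a b x) (cap_mul_norm_sq R x)
      simp only at h5 ⊢
      nlinarith
    rw [integral_sub ((integrable_cap_mul hR hce).const_mul _) (integrable_cap_sq_mul hR hce),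
      integral_const_mul] at h1
    nlinarith
  · have hdm := measurable_defect (k := k) ha hb
    have id : Integrable fun x => cap R x * (‖x‖ * defect k a b x) := by
      refine (integrable_cap_mul hR (hcn.mul (hce.const_mul 2))).mono'
        ((continuous_cap R).measurable.mul (hcn.measurable.mul hdm)).aestronglyMeasurable
        (Eventually.of_forall fun x => ?_)
      have hd0 : 0 ≤ defect k a b x := by unfold defect; positivity
      rw [Real.norm_of_nonneg (mul_nonneg (cap_nonneg _ _) (mul_nonneg (norm_nonneg _) hd0))]
      exact mul_le_mul_of_nonneg_left (mul_le_mul_of_nonneg_left (defect_le k a b x)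
        (norm_nonneg _)) (cap_nonneg _ _)
    have hflux := integral_flux hR ha hb hΔa hΔb
    have ifl : Integrable fun x => cap R x * (a x * euler b x - b x * euler a x) :=
      integrable_cap_mul hR ((ha.continuous.mul (continuous_euler hb)).sub
        (hb.continuous.mul (continuous_euler ha)))
    have e2 : ∫ x, cap R x * (‖x‖ * q x) = ∫ x, cap R x * (‖x‖ * defect k a b x) := by
      have : ∀ x, cap R x * (‖x‖ * q x) = cap R x * (‖x‖ * defect k a b x)
          + (2 * k) * (cap R x * (a x * euler b x - b x * euler a x)) := by
        intro x
        simp only [hq, defect]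
        linear_combination (-(2 * k * cap R x * b x)) * norm_mul_radial a x
          + (2 * k * cap R x * a x) * norm_mul_radial b x
      simp only [this]
      rw [integral_add id (ifl.const_mul _), integral_const_mul, hflux]
      ring
    have h1 : ∫ x, cap R x * ((‖x‖ ^ 2 + c * ‖x‖) * q x)
        ≤ ∫ x, (R + c) * (cap R x * (‖x‖ * q x)) := by
      refine integral_mono (iq _ (by fun_prop) fun x => by positivity)
        ((iq _ hcn fun x => norm_nonneg x).const_mul _) fun x => ?_
      have h3 : cap R x * ‖x‖ ≤ cap R x * R := by
        rcases le_total R ‖x‖ with h | h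
        · simp [cap_eq_zero hR h]
        · exact mul_le_mul_of_nonneg_left h (cap_nonneg _ _)
      have h4 := mul_le_mul_of_nonneg_right h3 (mul_nonneg (norm_nonneg x) (hq0 x))
      simp only
      nlinarith
    rw [integral_const_mul, e2] at h1
    linarith

/-- The derivative in `R` of the weighted energy. -/
lemma hasDerivAt_integral_cap_sq {e : E n → ℝ} (he : Continuous e) (hR : 0 < R) :
    HasDerivAt (fun S => ∫ x, cap S x ^ 2 * e x) (4 * R * ∫ x, cap R x * e x) R := by
  have hd : ∀ x : E n, ∀ S : ℝ, HasDerivAt (fun S => cap S x ^ 2 * e x)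
      (4 * S * (cap S x * e x)) S := by
    intro x S
    have h1 : HasDerivAt (fun S : ℝ => S ^ 2 - ‖x‖ ^ 2) (2 * S) S := by
      simpa using (hasDerivAt_pow 2 S).sub_const (‖x‖ ^ 2)
    have := ((hasDerivAt_max_zero_sq (S ^ 2 - ‖x‖ ^ 2)).comp S h1).mul_const (e x)
    refine this.congr_deriv ?_
    simp only [cap]; ring
  have hmono : ∀ x : E n, ∀ S ∈ Set.Ioo 0 (R + 1), cap S x ≤ cap (R + 1) x := by
    intro x S hS
    refine max_le_max ?_ le_rfl
    nlinarith [hS.1, hS.2]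
  have h := hasDerivAt_integral_of_dominated_loc_of_deriv_le (μ := volume) (𝕜 := ℝ)
    (F := fun S x => cap S x ^ 2 * e x) (F' := fun S x => 4 * S * (cap S x * e x)) (x₀ := R)
    (s := Set.Ioo 0 (R + 1)) (bound := fun x => 4 * (R + 1) * (cap (R + 1) x * |e x|))
    (Ioo_mem_nhds hR (by linarith))
    (Eventually.of_forall fun S =>
      (((continuous_cap S).pow 2).mul he).aestronglyMeasurable)
    (integrable_cap_sq_mul hR.le he)
    ((continuous_const.mul ((continuous_cap R).mul he)).aestronglyMeasurable)
    (Eventually.of_forall fun x S hS => ?_)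
    ((integrable_cap_mul (by linarith) he.abs).const_mul _)
    (Eventually.of_forall fun x S _ => hd x S)
  · refine h.2.congr_deriv ?_
    rw [integral_const_mul]
  · rw [Real.norm_eq_abs, abs_mul, abs_mul, abs_mul, abs_of_nonneg (cap_nonneg S x),
      abs_of_pos hS.1, abs_of_pos (by norm_num : (0 : ℝ) < 4)]
    exact mul_le_mul (by linarith [hS.2]) (mul_le_mul_of_nonneg_right (hmono x S hS)
      (abs_nonneg _)) (mul_nonneg (cap_nonneg _ _) (abs_nonneg _)) (by linarith)

end Energy

lemma setIntegral_ball_rpow {n : ℕ} {R : ℝ} (hR : 0 < R) :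
    ∫ x in Metric.ball (0 : E n) R, ‖x‖ ^ (-((n : ℝ) - 1))
      = R * ∫ x in Metric.ball (0 : E n) 1, ‖x‖ ^ (-((n : ℝ) - 1)) := by
  have h := Measure.setIntegral_comp_smul_of_pos (volume : Measure (E n))
    (fun x => ‖x‖ ^ (-((n : ℝ) - 1))) (Metric.ball (0 : E n) 1) hR
  rw [smul_unitBall_of_pos hR, finrank_euclideanSpace_fin] at h
  have e : ∀ x : E n,
      ‖R • x‖ ^ (-((n : ℝ) - 1)) = R ^ (-((n : ℝ) - 1)) * ‖x‖ ^ (-((n : ℝ) - 1)) := by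
    intro x
    rw [norm_smul, Real.norm_of_nonneg hR.le, Real.mul_rpow hR.le (norm_nonneg _)]
  simp only [e] at h
  rw [integral_const_mul, smul_eq_mul, eq_inv_mul_iff_mul_eq₀ (by positivity)] at h
  rw [← h, ← mul_assoc, ← Real.rpow_natCast, ← Real.rpow_add hR]
  congr 1
  rw [show (n : ℝ) + -((n : ℝ) - 1) = 1 by ring, Real.rpow_one]

lemma rpderiv_clm_comp {n : ℕ} (L : ℂ →L[ℝ] ℝ) {s : E n → ℂ} {x : E n}
    (hs : DifferentiableAt ℝ s x) (i : Fin n) :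
    rpderiv i (fun y => L (s y)) x = L (pderiv i s x) := by
  have := (L.hasFDerivAt.comp x hs.hasFDerivAt).fderiv
  rw [rpderiv]
  change fderiv ℝ (L ∘ s) x _ = _
  rw [this]
  rfl

lemma euler_clm_comp {n : ℕ} (L : ℂ →L[ℝ] ℝ) {s : E n → ℂ} {x : E n}
    (hs : DifferentiableAt ℝ s x) : euler (fun y => L (s y)) x = L (fderiv ℝ s x x) := by
  have := (L.hasFDerivAt.comp x hs.hasFDerivAt).fderiv
  rw [euler_eq_fderiv]
  change fderiv ℝ (L ∘ s) x _ = _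
  rw [this]
  rfl

lemma sum_rpderiv_clm_comp {n : ℕ} {k : ℝ} (L : ℂ →L[ℝ] ℝ) {s : E n → ℂ} (hs : ContDiff ℝ 2 s)
    (hΔ : ∀ x, (Δ s) x + (k : ℂ) ^ 2 * s x = 0) (x : E n) :
    ∑ i, rpderiv i (rpderiv i fun y => L (s y)) x = -(k ^ 2 * L (s x)) := by
  have h1 : ∀ i, rpderiv i (fun y => L (s y)) = fun y => L (pderiv i s y) := fun i =>
    funext fun y => rpderiv_clm_comp L (hs.differentiable (by norm_num) y) i
  have h2 : ∀ i, rpderiv i (rpderiv i fun y => L (s y)) x = L (pderiv i (pderiv i s) x) := by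
    intro i
    rw [h1]
    exact rpderiv_clm_comp L
      ((contDiff_pderiv (p := 1) hs (by norm_num) i).differentiable (by norm_num) x) i
  simp only [h2]
  rw [← map_sum, ← laplacian_eq_sum_pderiv hs.contDiffAt, eq_neg_of_add_eq_zero_left (hΔ x),
    map_neg, ← Complex.ofReal_pow, ← Complex.real_smul, map_smul, smul_eq_mul]

lemma defect_eq_norm_sq {n : ℕ} {k : ℝ} {s : E n → ℂ} (hs : ContDiff ℝ 2 s) (x : E n) :
    defect k (fun y => (s y).re) (fun y => (s y).im) x
      = ‖fderiv ℝ s x (‖x‖⁻¹ • x) - Complex.I * k * s x‖ ^ 2 := by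
  have hd := hs.differentiable (by norm_num) x
  have h1 := euler_clm_comp Complex.reCLM hd
  have h2 := euler_clm_comp Complex.imCLM hd
  simp only [Complex.reCLM_apply, Complex.imCLM_apply] at h1 h2
  rw [defect, h1, h2, map_smul, ← Complex.normSq_eq_norm_sq, Complex.normSq_apply]
  simp
  ring

/-- A radiating defect is small in the mean over large balls. -/
lemma eventually_integral_defect_le {n : ℕ} (hn : 2 ≤ n) {k : ℝ} {s : E n → ℂ}
    (hs : ContDiff ℝ 2 s)
    (hrad : (fun x => fderiv ℝ s x (‖x‖⁻¹ • x) - Complex.I * k * s x)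
      =o[Bornology.cobounded (E n)] fun x => ‖x‖ ^ (-(((n : ℝ) - 1) / 2))) {ε : ℝ} (hε : 0 < ε) :
    ∀ᶠ R : ℝ in atTop, ∫ x, cap R x * (‖x‖ * defect k (fun y => (s y).re) (fun y => (s y).im) x)
      ≤ ε * R ^ 4 := by
  set D := defect k (fun y => (s y).re) (fun y => (s y).im) with hD
  have ha : ContDiff ℝ 2 fun y => (s y).re := Complex.reCLM.contDiff.comp hs
  have hb : ContDiff ℝ 2 fun y => (s y).im := Complex.imCLM.contDiff.comp hs
  have hD0 : ∀ x, 0 ≤ D x := fun x => by rw [hD, defect_eq_norm_sq hs]; positivity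
  set K := ∫ x in Metric.ball (0 : E n) 1, ‖x‖ ^ (-((n : ℝ) - 1)) with hK
  have hK0 : 0 ≤ K := integral_nonneg fun x => by positivity
  set δ := ε / (2 * (K + 1)) with hδ
  have hδ0 : 0 < δ := by positivity
  -- the defect is `≤ δ |x|^{1-n}` far away
  have h1 := hrad.def (Real.sqrt_pos.2 hδ0)
  rw [← comap_norm_atTop, eventually_comap] at h1
  obtain ⟨R₀, hR₀⟩ := eventually_atTop.1 (h1.and (eventually_gt_atTop 0))
  have hR₀0 : 0 < R₀ := (hR₀ R₀ le_rfl).2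
  have hfar : ∀ x : E n, R₀ ≤ ‖x‖ → D x ≤ δ * ‖x‖ ^ (-((n : ℝ) - 1)) := by
    intro x hx
    have h2 := (hR₀ ‖x‖ hx).1 x rfl
    have hx0 : 0 < ‖x‖ := hR₀0.trans_le hx
    rw [hD, defect_eq_norm_sq hs, ← OutgoingKernel.rpow_half_sq hx0, ← Real.sq_sqrt hδ0.le,
      ← mul_pow]
    refine pow_le_pow_left₀ (norm_nonneg _) (h2.trans (le_of_eq ?_)) 2
    rw [Real.norm_of_nonneg (by positivity)]
  -- and bounded close to the origin
  obtain ⟨M, hM⟩ := (isCompact_closedBall (0 : E n) R₀).exists_bound_of_continuousOn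
    ((continuous_energy (k := k) ha hb).continuousOn)
  have hM0 : 0 ≤ M := (norm_nonneg _).trans (hM 0 (by simp [hR₀0.le]))
  set B := ∫ x : E n, (Metric.closedBall (0 : E n) R₀).indicator (fun _ => 2 * M) x with hB
  have iB : Integrable fun x : E n =>
      (Metric.closedBall (0 : E n) R₀).indicator (fun _ => 2 * M) x :=
    (integrable_indicator_iff measurableSet_closedBall).2
      (integrableOn_const (hs := by exact (measure_closedBall_lt_top).ne))
  filter_upwards [eventually_gt_atTop 0, eventually_ge_atTop (2 * B / ε)] with R hR hRB
  have iK : Integrable fun x : E n =>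
      (Metric.ball (0 : E n) R).indicator (fun x => ‖x‖ ^ (-((n : ℝ) - 1))) x := by
    have := (integrable_indicator_iff measurableSet_ball).2
      (OutgoingKernel.integrableOn_rpow_norm hn 1 R)
    simpa using this
  have hle : ∀ x : E n, cap R x * (‖x‖ * D x) ≤ R ^ 3 *
      ((Metric.closedBall (0 : E n) R₀).indicator (fun _ => 2 * M) x
        + δ * (Metric.ball (0 : E n) R).indicator (fun x => ‖x‖ ^ (-((n : ℝ) - 1))) x) := by
    intro x
    rcases le_or_gt R ‖x‖ with h | h
    · rw [cap_eq_zero hR.le h, zero_mul]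
      refine mul_nonneg (by positivity) (add_nonneg
        (Set.indicator_nonneg (fun _ _ => by positivity) _)
        (mul_nonneg hδ0.le (Set.indicator_nonneg (fun _ _ => by positivity) _)))
    · have hxR : x ∈ Metric.ball (0 : E n) R := by simpa using h
      have h3 : cap R x * (‖x‖ * D x) ≤ R ^ 3 * D x := by
        have := mul_le_mul (cap_le R x) h.le (norm_nonneg x) (sq_nonneg R)
        nlinarith [hD0 x, mul_le_mul_of_nonneg_right this (hD0 x)]
      refine h3.trans (mul_le_mul_of_nonneg_left ?_ (by positivity))
      rw [Set.indicator_of_mem hxR]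
      by_cases hx : x ∈ Metric.closedBall (0 : E n) R₀
      · rw [Set.indicator_of_mem hx]
        have h4 := defect_le k (fun y => (s y).re) (fun y => (s y).im) x
        have h5 := (le_abs_self _).trans (hM x hx)
        have : 0 ≤ δ * ‖x‖ ^ (-((n : ℝ) - 1)) := by positivity
        linarith
      · rw [Set.indicator_of_notMem hx, zero_add]
        refine hfar x ?_
        simp only [Metric.mem_closedBall, dist_zero_right, not_le] at hx
        exact hx.le
  have h6 := integral_mono_of_nonneg (μ := volume)
    (Eventually.of_forall fun x => mul_nonneg (cap_nonneg R x) (mul_nonneg (norm_nonneg x) (hD0 x)))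
    ((iB.add (iK.const_mul δ)).const_mul (R ^ 3)) (Eventually.of_forall hle)
  refine h6.trans ?_
  have h7 : ∫ x : E n, ((Metric.closedBall (0 : E n) R₀).indicator (fun _ => 2 * M) x
        + δ * (Metric.ball (0 : E n) R).indicator (fun x => ‖x‖ ^ (-((n : ℝ) - 1))) x)
      = B + δ * (R * K) := by
    rw [integral_add iB (iK.const_mul δ), integral_const_mul, integral_indicator measurableSet_ball,
      setIntegral_ball_rpow hR]
  simp only [Pi.add_apply]
  rw [integral_const_mul, h7]
  have h8 : B ≤ ε / 2 * R := by
    rw [div_le_iff₀ hε] at hRB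
    linarith
  have h9 : δ * (R * K) ≤ ε / 2 * R := by
    have : δ * (K + 1) = ε / 2 := by rw [hδ]; field_simp
    nlinarith [mul_pos hδ0 hR]
  calc R ^ 3 * (B + δ * (R * K)) ≤ R ^ 3 * (ε * R) :=
        mul_le_mul_of_nonneg_left (by linarith) (by positivity)
    _ = ε * R ^ 4 := by ring

/-- Rellich's uniqueness theorem in the whole space: an entire solution of the Helmholtz equation
which satisfies the radiation condition vanishes. With `P(R)` the energy weighted by
`(R² - |x|²)₊²` and `c = (n-1)/(2k)`, the quotient `P(R)/(R+c)^5` is nondecreasing and tends to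
zero. -/
theorem eq_zero_of_radiating {n : ℕ} (hn : 2 ≤ n) {k : ℝ} (hk : 0 < k) {s : E n → ℂ}
    (hs : ContDiff ℝ 2 s) (hΔ : ∀ x, (Δ s) x + (k : ℂ) ^ 2 * s x = 0)
    (hrad : (fun x => fderiv ℝ s x (‖x‖⁻¹ • x) - Complex.I * k * s x)
      =o[Bornology.cobounded (E n)] fun x => ‖x‖ ^ (-(((n : ℝ) - 1) / 2))) (x : E n) :
    s x = 0 := by
  have ha : ContDiff ℝ 2 fun y => (s y).re := Complex.reCLM.contDiff.comp hs
  have hb : ContDiff ℝ 2 fun y => (s y).im := Complex.imCLM.contDiff.comp hs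
  have hΔa := sum_rpderiv_clm_comp Complex.reCLM hs hΔ
  have hΔb := sum_rpderiv_clm_comp Complex.imCLM hs hΔ
  set e := energy k (fun y => (s y).re) (fun y => (s y).im) with he
  have hec : Continuous e := continuous_energy ha hb
  have he0 : ∀ x, 0 ≤ e x := energy_nonneg k _ _
  set c : ℝ := ((n : ℝ) - 1) / (2 * k) with hc
  have hc0 : 0 ≤ c := by
    have : (2 : ℝ) ≤ n := by exact_mod_cast hn
    have : (0 : ℝ) ≤ (n : ℝ) - 1 := by linarith
    positivity
  set P : ℝ → ℝ := fun R => ∫ x, cap R x ^ 2 * e x with hP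
  have hPd : ∀ R : ℝ, 0 < R → HasDerivAt (fun S => P S / (S + c) ^ 5)
      (((4 * R * ∫ x, cap R x * e x) * (R + c) ^ 5 - P R * (5 * (R + c) ^ 4)) / ((R + c) ^ 5) ^ 2)
      R := by
    intro R hR
    have h1 : HasDerivAt (fun S : ℝ => (S + c) ^ 5) (5 * (R + c) ^ 4) R := by
      have := ((hasDerivAt_id R).add_const c).fun_pow 5
      simpa using this
    exact (hasDerivAt_integral_cap_sq hec hR).div h1 (by positivity)
  -- the normalized weighted energy is monotone
  have hmono : MonotoneOn (fun S => P S / (S + c) ^ 5) (Set.Ioi 0) := by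
    refine monotoneOn_of_deriv_nonneg (convex_Ioi 0)
      (fun R hR => (hPd R hR).continuousAt.continuousWithinAt)
      (fun R hR => ((hPd R (interior_subset hR)).differentiableAt).differentiableWithinAt)
      fun R hR => ?_
    have hR : 0 < R := interior_subset hR
    rw [(hPd R hR).deriv]
    refine div_nonneg ?_ (by positivity)
    have h1 := (integral_energy_le (by omega) hk hR.le ha hb hΔa hΔb).1
    have h2 : 0 ≤ (R + c) ^ 4 := by positivity
    have h3 := mul_le_mul_of_nonneg_left h1 h2
    simp only [hP]
    simp only [← he, ← hc] at h3
    linear_combination h3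
  -- and it tends to zero by the radiation condition
  have hsmall : ∀ R : ℝ, 0 < R → P R / (R + c) ^ 5 ≤ 0 := by
    intro R hR
    refine le_of_forall_pos_le_add fun ε hε => ?_
    obtain ⟨S, hS, hRS⟩ := ((eventually_integral_defect_le hn hs hrad
      (by positivity : (0 : ℝ) < ε / 4)).and (eventually_ge_atTop R)).exists
    have hS0 : 0 < S := hR.trans_le hRS
    refine (hmono hR hS0 hRS).trans ?_
    have h1 := (integral_energy_le (by omega) hk hS0.le ha hb hΔa hΔb).2
    simp only [zero_add]
    rw [div_le_iff₀ (by positivity)]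
    refine h1.trans ?_
    have h2 : 4 * (S + c) * (ε / 4 * S ^ 4) ≤ ε * (S + c) ^ 5 := by
      have : S ^ 4 ≤ (S + c) ^ 4 := pow_le_pow_left₀ hS0.le (by linarith) 4
      have h4 := mul_le_mul_of_nonneg_left this (by positivity : 0 ≤ ε * (S + c))
      nlinarith
    exact (mul_le_mul_of_nonneg_left hS (by positivity)).trans h2
  have hR : 0 < ‖x‖ + 1 := by positivity
  have hPz : P (‖x‖ + 1) = 0 := by
    have h1 := hsmall _ hR
    have h2 : 0 ≤ P (‖x‖ + 1) := integral_nonneg fun y => mul_nonneg (sq_nonneg _) (he0 y)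
    have h3 : 0 < (‖x‖ + 1 + c) ^ 5 := by positivity
    rw [div_le_iff₀ h3] at h1
    linarith
  have hcont : Continuous fun y : E n => cap (‖x‖ + 1) y ^ 2 * e y :=
    ((continuous_cap _).pow 2).mul hec
  have hz := (integral_eq_zero_iff_of_nonneg
    (fun y => mul_nonneg (sq_nonneg (cap (‖x‖ + 1) y)) (he0 y))
    (integrable_cap_sq_mul hR.le hec)).1 hPz
  have hz2 := congrFun ((Continuous.ae_eq_iff_eq volume hcont continuous_const).1 hz) x
  have hcap : 0 < cap (‖x‖ + 1) x := lt_max_of_lt_left (by nlinarith [norm_nonneg x])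
  have hex : e x = 0 := by
    rcases mul_eq_zero.1 hz2 with h | h
    · exact absurd h (by positivity)
    · exact h
  have h1 : 0 ≤ gradSq (fun y => (s y).re) x := Finset.sum_nonneg fun i _ => sq_nonneg _
  have h2 : 0 ≤ gradSq (fun y => (s y).im) x := Finset.sum_nonneg fun i _ => sq_nonneg _
  simp only [he, energy] at hex
  have h3 : k ^ 2 * ((s x).re ^ 2 + (s x).im ^ 2) = 0 :=
    le_antisymm (by linarith) (by positivity)
  have h4 : (s x).re ^ 2 + (s x).im ^ 2 = 0 := by
    rcases mul_eq_zero.1 h3 with h | h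
    · exact absurd h (by positivity)
    · exact h
  refine Complex.ext ?_ ?_
  · exact pow_eq_zero_iff two_ne_zero |>.1 (by nlinarith [sq_nonneg (s x).re, sq_nonneg (s x).im])
  · exact pow_eq_zero_iff two_ne_zero |>.1 (by nlinarith [sq_nonneg (s x).re, sq_nonneg (s x).im])

/-! ### The Laplace integral of the Hankel function -/

open Complex (I)

/-- The quadratic `t² - 2ixt` in the Laplace integral of the Hankel function. -/
def hq (x t : ℝ) : ℂ := (t : ℂ) ^ 2 - 2 * I * x * t

/-- The principal square root of `t² - 2ixt`. -/
def hroot (x t : ℝ) : ℂ := hq x t ^ (2 : ℂ)⁻¹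

lemma hq_re (x t : ℝ) : (hq x t).re = t ^ 2 := by
  simp [hq, ← Complex.ofReal_pow]

lemma hq_im (x t : ℝ) : (hq x t).im = -(2 * x * t) := by
  simp [hq, ← Complex.ofReal_pow]

lemma hq_mem_slitPlane (x : ℝ) {t : ℝ} (ht : 0 < t) : hq x t ∈ Complex.slitPlane :=
  Or.inl (by rw [hq_re]; positivity)

lemma hroot_sq (x t : ℝ) : hroot x t ^ 2 = hq x t := Complex.cpow_ofNat_inv_pow _ 2

lemma hroot_ne_zero (x : ℝ) {t : ℝ} (ht : 0 < t) : hroot x t ≠ 0 := fun h =>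
  Complex.slitPlane_ne_zero (hq_mem_slitPlane x ht) (by rw [← hroot_sq, h]; simp)

lemma hroot_re_nonneg (x t : ℝ) : 0 ≤ (hroot x t).re := by
  rcases eq_or_ne (hq x t) 0 with h | h
  · simp [hroot, h]
  · rw [hroot, Complex.cpow_def_of_ne_zero h, Complex.exp_re]
    refine mul_nonneg (Real.exp_pos _).le (Real.cos_nonneg_of_neg_pi_div_two_le_of_le ?_ ?_)
    all_goals
      have : (Complex.log (hq x t) * (2 : ℂ)⁻¹).im = (hq x t).arg / 2 := by
        rw [← div_eq_mul_inv, Complex.div_ofNat_im, Complex.log_im]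
      rw [this]
      linarith [Complex.arg_le_pi (hq x t), Complex.neg_pi_lt_arg (hq x t)]

lemma norm_hroot_sq (x t : ℝ) : ‖hroot x t‖ ^ 2 = ‖hq x t‖ := by rw [← norm_pow, hroot_sq]

lemma le_norm_hroot (x t : ℝ) : t ≤ ‖hroot x t‖ := by
  refine le_of_sq_le_sq ?_ (norm_nonneg _)
  rw [norm_hroot_sq]
  have := Complex.re_le_norm (hq x t)
  rwa [hq_re] at this

lemma rpow_le_norm_hroot_one {t : ℝ} (ht : 0 < t) : t ^ (1 / 2 : ℝ) ≤ ‖hroot 1 t‖ := by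
  rw [← Real.sqrt_eq_rpow]
  refine Real.sqrt_le_iff.2 ⟨norm_nonneg _, ?_⟩
  rw [norm_hroot_sq]
  have := Complex.abs_im_le_norm (hq 1 t)
  rw [hq_im, abs_neg, abs_of_pos (by positivity)] at this
  linarith

lemma norm_hroot_le {x t : ℝ} (hx : 0 ≤ x) (ht : 0 < t) : ‖hroot x t‖ ≤ t + 2 * x := by
  refine le_of_sq_le_sq ?_ (by positivity)
  rw [norm_hroot_sq]
  have : ‖hq x t‖ ≤ t ^ 2 + 2 * x * t := by
    unfold hq
    refine (norm_sub_le _ _).trans (le_of_eq ?_)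
    simp [abs_of_nonneg hx, abs_of_pos ht]
  nlinarith [mul_nonneg hx ht.le]

lemma hasDerivAt_hroot (x : ℝ) {t : ℝ} (ht : 0 < t) :
    HasDerivAt (hroot x) (((t : ℂ) - I * x) / hroot x t) t := by
  have h1 : HasDerivAt (hq x) (2 * (t : ℂ) - 2 * I * x) t := by
    have := ((Complex.ofRealCLM.hasDerivAt (x := t)).fun_pow 2).sub
      ((Complex.ofRealCLM.hasDerivAt (x := t)).const_mul (2 * I * (x : ℂ)))
    refine this.congr_deriv ?_
    simp
  have h2 : HasDerivAt (hroot x)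
      ((2 : ℂ)⁻¹ * hq x t ^ ((2 : ℂ)⁻¹ - 1) * (2 * (t : ℂ) - 2 * I * x)) t :=
    (Complex.hasStrictDerivAt_cpow_const (hq_mem_slitPlane x ht)).hasDerivAt.comp t h1
  refine h2.congr_deriv ?_
  have hr := hroot_ne_zero x ht
  have hq0 := Complex.slitPlane_ne_zero (hq_mem_slitPlane x ht)
  rw [Complex.cpow_sub _ _ hq0, Complex.cpow_one]
  change 2⁻¹ * (hroot x t / hq x t) * _ = _
  rw [← hroot_sq]
  field_simp

lemma continuousAt_hroot_left (x : ℝ) {t : ℝ} (ht : 0 < t) :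
    ContinuousAt (fun y => hroot y t) x := by
  unfold hroot
  refine ContinuousAt.cpow ?_ continuousAt_const (hq_mem_slitPlane x ht)
  have : Continuous fun y => hq y t := by unfold hq; fun_prop
  exact this.continuousAt

lemma continuous_hroot (x : ℝ) : Continuous (hroot x) := by
  have h1 : Continuous (hq x) := by unfold hq; fun_prop
  rw [continuous_iff_continuousAt]
  intro t
  by_cases h : hq x t ∈ Complex.slitPlane
  · exact h1.continuousAt.cpow continuousAt_const h
  · have h0 : hq x t = 0 := by
      have h2 : t ^ 2 ≤ 0 := by
        rw [Complex.mem_slitPlane_iff] at h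
        push Not at h
        rw [← hq_re x]; exact h.1
      have h3 : t = 0 := pow_eq_zero_iff two_ne_zero |>.1 (le_antisymm h2 (sq_nonneg t))
      simp [hq, h3]
    have h2 : hroot x t = 0 := by simp [hroot, h0]
    rw [ContinuousAt, h2, tendsto_zero_iff_norm_tendsto_zero]
    have h3 : ∀ s, ‖hroot x s‖ = √‖hq x s‖ := fun s => by
      rw [← norm_hroot_sq, Real.sqrt_sq (norm_nonneg _)]
    simp only [h3]
    have := (Real.continuous_sqrt.comp h1.norm).tendsto t
    simpa [h0, Function.comp_def] using this

lemma eq_of_sq_eq_sq_of_re_nonneg {z w : ℂ} (h : z ^ 2 = w ^ 2) (hz : 0 ≤ z.re) (hw : 0 ≤ w.re)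
    (h0 : 0 < (z ^ 2).re) : z = w := by
  rcases sq_eq_sq_iff_eq_or_eq_neg.1 h with h1 | h1
  · exact h1
  · have h2 : z.re = 0 := le_antisymm (by rw [h1, Complex.neg_re]; linarith) hz
    have h3 : (z ^ 2).re = z.re ^ 2 - z.im ^ 2 := by rw [sq, Complex.mul_re]; ring
    rw [h3, h2] at h0
    nlinarith [sq_nonneg z.im]

lemma hroot_scale {x t : ℝ} (hx : 0 < x) (ht : 0 < t) : hroot x (x * t) = x * hroot 1 t := by
  refine eq_of_sq_eq_sq_of_re_nonneg ?_ (hroot_re_nonneg _ _) ?_ ?_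
  · rw [mul_pow, hroot_sq, hroot_sq]
    simp only [hq]; push_cast; ring
  · rw [Complex.re_ofReal_mul]
    exact mul_nonneg hx.le (hroot_re_nonneg _ _)
  · rw [hroot_sq, hq_re]; positivity

lemma hroot_zero {t : ℝ} (ht : 0 < t) : hroot 0 t = t := by
  refine eq_of_sq_eq_sq_of_re_nonneg ?_ (hroot_re_nonneg _ _) (by simpa using ht.le) ?_
  · rw [hroot_sq]; simp [hq]
  · rw [hroot_sq, hq_re]; positivity

/-- The moments `∫₀^∞ s^j e^{-xs} (s² - 2is)^{-1/2} ds`. -/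
def hmom (j : ℕ) (x : ℝ) : ℂ :=
  ∫ s in Set.Ioi (0 : ℝ), ((s ^ j * Real.exp (-(x * s)) : ℝ) : ℂ) / hroot 1 s

lemma norm_hmom_integrand_le (j : ℕ) (x : ℝ) {s : ℝ} (hs : 0 < s) :
    ‖((s ^ j * Real.exp (-(x * s)) : ℝ) : ℂ) / hroot 1 s‖
      ≤ s ^ ((j : ℝ) + 1 / 2 - 1) * Real.exp (-(x * s)) := by
  rw [norm_div, Complex.norm_real, Real.norm_of_nonneg (by positivity), mul_div_right_comm]
  refine mul_le_mul_of_nonneg_right ?_ (Real.exp_pos _).le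
  rw [div_le_iff₀ (norm_pos_iff.2 (hroot_ne_zero 1 hs))]
  calc s ^ j = s ^ ((j : ℝ) + 1 / 2 - 1) * s ^ (1 / 2 : ℝ) := by
        rw [← Real.rpow_add hs, ← Real.rpow_natCast]; congr 1; ring
    _ ≤ _ := mul_le_mul_of_nonneg_left (rpow_le_norm_hroot_one hs) (by positivity)

lemma integrableOn_hmom_majorant (j : ℕ) {x : ℝ} (hx : 0 < x) :
    IntegrableOn (fun s : ℝ => s ^ ((j : ℝ) + 1 / 2 - 1) * Real.exp (-(x * s))) (Set.Ioi 0) := by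
  have := integrableOn_rpow_mul_exp_neg_mul_rpow (p := 1) (s := (j : ℝ) + 1 / 2 - 1) (b := x)
    (by have : (0 : ℝ) ≤ j := by positivity
        linarith) one_pos hx
  simpa using this

lemma aestronglyMeasurable_hmom_integrand (j : ℕ) (x : ℝ) :
    AEStronglyMeasurable (fun s : ℝ => ((s ^ j * Real.exp (-(x * s)) : ℝ) : ℂ) / hroot 1 s)
      (volume.restrict (Set.Ioi 0)) := by
  have h1 : Measurable (hroot 1) := (continuous_hroot 1).measurable
  have : Measurable fun s : ℝ => ((s ^ j * Real.exp (-(x * s)) : ℝ) : ℂ) / hroot 1 s := by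
    fun_prop
  exact this.aestronglyMeasurable

lemma integrableOn_hmom (j : ℕ) {x : ℝ} (hx : 0 < x) :
    IntegrableOn (fun s : ℝ => ((s ^ j * Real.exp (-(x * s)) : ℝ) : ℂ) / hroot 1 s)
      (Set.Ioi 0) :=
  (integrableOn_hmom_majorant j hx).mono' (aestronglyMeasurable_hmom_integrand j x)
    (ae_restrict_of_forall_mem measurableSet_Ioi fun _ hs => norm_hmom_integrand_le j x hs)

lemma norm_hmom_le (j : ℕ) {x : ℝ} (hx : 0 < x) :
    ‖hmom j x‖ ≤ Real.Gamma (j + 1 / 2) * x ^ (-((j : ℝ) + 1 / 2)) := by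
  have h := norm_integral_le_of_norm_le (integrableOn_hmom_majorant j hx)
    (ae_restrict_of_forall_mem measurableSet_Ioi fun s hs => norm_hmom_integrand_le j x hs)
  refine h.trans (le_of_eq ?_)
  rw [Real.integral_rpow_mul_exp_neg_mul_Ioi (by positivity) hx, one_div, Real.inv_rpow hx.le,
    Real.rpow_neg hx.le, mul_comm]

lemma hasDerivAt_hmom (j : ℕ) {x : ℝ} (hx : 0 < x) :
    HasDerivAt (hmom j) (-hmom (j + 1) x) x := by
  have h := hasDerivAt_integral_of_dominated_loc_of_deriv_le
    (μ := volume.restrict (Set.Ioi (0 : ℝ))) (𝕜 := ℝ)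
    (F := fun y s => ((s ^ j * Real.exp (-(y * s)) : ℝ) : ℂ) / hroot 1 s)
    (F' := fun y s => -(((s ^ (j + 1) * Real.exp (-(y * s)) : ℝ) : ℂ) / hroot 1 s)) (x₀ := x)
    (s := Set.Ioi (x / 2))
    (bound := fun s => s ^ (((j + 1 : ℕ) : ℝ) + 1 / 2 - 1) * Real.exp (-(x / 2 * s)))
    (Ioi_mem_nhds (by linarith))
    (Eventually.of_forall fun y => aestronglyMeasurable_hmom_integrand j y)
    (integrableOn_hmom j hx) (aestronglyMeasurable_hmom_integrand (j + 1) x).neg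
    (ae_restrict_of_forall_mem measurableSet_Ioi fun s hs y hy => ?_)
    (integrableOn_hmom_majorant (j + 1) (by positivity))
    (ae_restrict_of_forall_mem measurableSet_Ioi fun s hs y _ => ?_)
  · refine h.2.congr_deriv ?_
    rw [integral_neg]; rfl
  · rw [norm_neg]
    refine (norm_hmom_integrand_le (j + 1) y hs).trans ?_
    have hs : 0 < s := hs
    have hy : x / 2 < y := hy
    refine mul_le_mul_of_nonneg_left (Real.exp_le_exp.2 ?_) (by positivity)
    nlinarith
  · have h1 : HasDerivAt (fun y : ℝ => s ^ j * Real.exp (-(y * s)))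
        (-(s ^ (j + 1) * Real.exp (-(y * s)))) y := by
      have := (((hasDerivAt_id y).mul_const s).neg.exp).const_mul (s ^ j)
      refine this.congr_deriv ?_
      simp; ring
    have := h1.ofReal_comp.div_const (hroot 1 s)
    refine this.congr_deriv ?_
    push_cast; ring

/-- The Laplace integral satisfies a confluent hypergeometric equation: the integrand of the
left-hand side is the derivative of `-e^{-xs} √(s² - 2is)`. -/
lemma hmom_relation {x : ℝ} (hx : 0 < x) :
    (x : ℂ) * (hmom 2 x - 2 * I * hmom 1 x) - hmom 1 x + I * hmom 0 x = 0 := by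
  set f : ℝ → ℂ := fun s => (Real.exp (-(x * s)) : ℂ) * hroot 1 s with hf
  set f' : ℝ → ℂ := fun s => -((x : ℂ) * (((s ^ 2 * Real.exp (-(x * s)) : ℝ) : ℂ) / hroot 1 s
    - 2 * I * (((s ^ 1 * Real.exp (-(x * s)) : ℝ) : ℂ) / hroot 1 s))
    - ((s ^ 1 * Real.exp (-(x * s)) : ℝ) : ℂ) / hroot 1 s
    + I * (((s ^ 0 * Real.exp (-(x * s)) : ℝ) : ℂ) / hroot 1 s)) with hf'
  have hd : ∀ s ∈ Set.Ioi (0 : ℝ), HasDerivAt f (f' s) s := by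
    intro s hs
    have h1 : HasDerivAt (fun s : ℝ => Real.exp (-(x * s))) (-(x * Real.exp (-(x * s)))) s := by
      have := ((hasDerivAt_id s).const_mul x).neg.exp
      refine this.congr_deriv ?_
      simp; ring
    have h2 := h1.ofReal_comp.mul (hasDerivAt_hroot 1 hs)
    refine h2.congr_deriv ?_
    have hr := hroot_ne_zero 1 hs
    have hsq := hroot_sq 1 s
    simp only [hf', hq] at hsq ⊢
    push_cast at hsq ⊢
    field_simp
    rw [hsq]
    ring
  have i0 := integrableOn_hmom 0 hx
  have i1 := integrableOn_hmom 1 hx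
  have i2 := integrableOn_hmom 2 hx
  have c : ContinuousWithinAt f (Set.Ici 0) 0 := by
    have : Continuous f := by
      have := continuous_hroot 1
      simp only [hf]; fun_prop
    exact this.continuousWithinAt
  have hlim : Tendsto f atTop (𝓝 0) := by
    have h1 : Tendsto (fun s : ℝ => x⁻¹ * ((x * s) ^ 1 * Real.exp (-(x * s)))
        + 2 * ((x * s) ^ 0 * Real.exp (-(x * s)))) atTop (𝓝 (x⁻¹ * 0 + 2 * 0)) := by
      have h2 : Tendsto (fun s : ℝ => x * s) atTop atTop := tendsto_id.const_mul_atTop hx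
      exact (((Real.tendsto_pow_mul_exp_neg_atTop_nhds_zero 1).comp h2).const_mul _).add
        (((Real.tendsto_pow_mul_exp_neg_atTop_nhds_zero 0).comp h2).const_mul _)
    rw [mul_zero, mul_zero, add_zero] at h1
    refine squeeze_zero_norm' ?_ h1
    filter_upwards [eventually_gt_atTop 0] with s hs
    simp only [hf]
    rw [norm_mul, Complex.norm_real, Real.norm_of_nonneg (Real.exp_pos _).le]
    have h3 := mul_le_mul_of_nonneg_left (norm_hroot_le zero_le_one hs)
      (Real.exp_pos (-(x * s))).le
    refine h3.trans (le_of_eq ?_)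
    field_simp
  have hint : IntegrableOn f' (Set.Ioi 0) :=
    ((((i2.sub (i1.const_mul (2 * I))).const_mul (x : ℂ)).sub i1).add (i0.const_mul I)).neg
  have key := integral_Ioi_of_hasDerivAt_of_tendsto c hd hint hlim
  have hf0 : f 0 = 0 := by simp [hf, hroot, hq]
  rw [hf0, sub_zero] at key
  simp only [hf'] at key
  rw [integral_neg,
    integral_add (by exact ((i2.sub (i1.const_mul (2 * I))).const_mul (x : ℂ)).sub i1)
      (i0.const_mul I),
    integral_sub (by exact (i2.sub (i1.const_mul (2 * I))).const_mul (x : ℂ)) i1,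
    integral_const_mul, integral_sub i2 (i1.const_mul (2 * I)), integral_const_mul,
    integral_const_mul, neg_eq_zero] at key
  exact key

lemma hmom_one_scaled {x : ℝ} (hx : 0 < x) :
    (x : ℂ) * hmom 1 x = ∫ t in Set.Ioi (0 : ℝ), ((t * Real.exp (-t) : ℝ) : ℂ) / hroot x t := by
  have h := integral_comp_mul_left_Ioi
    (fun t : ℝ => ((t * Real.exp (-t) : ℝ) : ℂ) / hroot x t) 0 hx
  rw [mul_zero] at h
  have e : hmom 1 x = ∫ s in Set.Ioi (0 : ℝ),
      (((x * s) * Real.exp (-(x * s)) : ℝ) : ℂ) / hroot x (x * s) := by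
    refine setIntegral_congr_fun measurableSet_Ioi fun s hs => ?_
    have hx0 : (x : ℂ) ≠ 0 := by exact_mod_cast hx.ne'
    have hr := hroot_ne_zero 1 hs
    rw [hroot_scale hx hs]
    push_cast
    field_simp
  rw [e, h, Complex.real_smul]
  push_cast
  rw [← mul_assoc, mul_inv_cancel₀ (by exact_mod_cast hx.ne'), one_mul]

lemma hmom_zero_scaled {x : ℝ} (hx : 0 < x) :
    hmom 0 x = ∫ t in Set.Ioi (0 : ℝ), (Real.exp (-t) : ℂ) / hroot x t := by
  have h := integral_comp_mul_left_Ioi (fun t : ℝ => (Real.exp (-t) : ℂ) / hroot x t) 0 hx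
  rw [mul_zero] at h
  have e : hmom 0 x = x * ∫ s in Set.Ioi (0 : ℝ),
      (Real.exp (-(x * s)) : ℂ) / hroot x (x * s) := by
    rw [← integral_const_mul]
    refine setIntegral_congr_fun measurableSet_Ioi fun s hs => ?_
    have hx0 : (x : ℂ) ≠ 0 := by exact_mod_cast hx.ne'
    have hr := hroot_ne_zero 1 hs
    rw [hroot_scale hx hs]
    push_cast
    field_simp
  rw [e, h, Complex.real_smul]
  push_cast
  rw [← mul_assoc, mul_inv_cancel₀ (by exact_mod_cast hx.ne'), one_mul]

lemma integrableOn_exp_neg : IntegrableOn (fun t : ℝ => Real.exp (-t)) (Set.Ioi 0) := by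
  simpa using exp_neg_integrableOn_Ioi 0 one_pos

lemma norm_scaled_le (x : ℝ) {t : ℝ} (ht : 0 < t) :
    ‖((t * Real.exp (-t) : ℝ) : ℂ) / hroot x t‖ ≤ Real.exp (-t) := by
  rw [norm_div, Complex.norm_real, Real.norm_of_nonneg (by positivity),
    div_le_iff₀ (norm_pos_iff.2 (hroot_ne_zero x ht)), mul_comm]
  exact mul_le_mul_of_nonneg_left (le_norm_hroot x t) (Real.exp_pos _).le

lemma norm_mul_hmom_one_le {x : ℝ} (hx : 0 < x) : ‖(x : ℂ) * hmom 1 x‖ ≤ 1 := by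
  rw [hmom_one_scaled hx]
  have h := norm_integral_le_of_norm_le integrableOn_exp_neg
    (ae_restrict_of_forall_mem measurableSet_Ioi fun t ht => norm_scaled_le x ht)
  rwa [integral_exp_neg_Ioi_zero] at h

lemma tendsto_mul_hmom_one : Tendsto (fun x : ℝ => (x : ℂ) * hmom 1 x) (𝓝[>] 0) (𝓝 1) := by
  have h : Tendsto (fun x : ℝ => ∫ t in Set.Ioi (0 : ℝ), ((t * Real.exp (-t) : ℝ) : ℂ) / hroot x t)
      (𝓝[>] 0) (𝓝 (∫ t in Set.Ioi (0 : ℝ), (Real.exp (-t) : ℂ))) := by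
    refine tendsto_integral_filter_of_dominated_convergence (fun t => Real.exp (-t))
      (Eventually.of_forall fun x => ?_) (Eventually.of_forall fun x =>
        ae_restrict_of_forall_mem measurableSet_Ioi fun t ht => norm_scaled_le x ht)
      integrableOn_exp_neg (ae_restrict_of_forall_mem measurableSet_Ioi fun t ht => ?_)
    · have h1 : Measurable (hroot x) := (continuous_hroot x).measurable
      have : Measurable fun t : ℝ => ((t * Real.exp (-t) : ℝ) : ℂ) / hroot x t := by fun_prop
      exact this.aestronglyMeasurable
    · have h1 : Tendsto (fun x => hroot x t) (𝓝[>] 0) (𝓝 (hroot 0 t)) :=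
        (continuousAt_hroot_left 0 ht).tendsto.mono_left nhdsWithin_le_nhds
      have h2 := (tendsto_const_nhds (x := ((t * Real.exp (-t) : ℝ) : ℂ))).div h1
        (hroot_ne_zero 0 ht)
      rw [hroot_zero ht] at h2
      have : ((t * Real.exp (-t) : ℝ) : ℂ) / t = (Real.exp (-t) : ℂ) := by
        have : (t : ℂ) ≠ 0 := by exact_mod_cast (ne_of_gt ht)
        push_cast; field_simp
      rwa [this] at h2
  rw [integral_complex_ofReal, integral_exp_neg_Ioi_zero, Complex.ofReal_one] at h
  refine h.congr' ?_
  filter_upwards [self_mem_nhdsWithin] with x hx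
  exact (hmom_one_scaled hx).symm

/-- This integral is `Γ'(1)`. -/
lemma integral_exp_neg_mul_log :
    ∫ t in Set.Ioi (0 : ℝ), Real.exp (-t) * Real.log t = -Real.eulerMascheroniConstant := by
  have h1 := Complex.hasDerivAt_GammaIntegral (s := 1) (by simp)
  have h2 : HasDerivAt Complex.GammaIntegral (-(Real.eulerMascheroniConstant : ℂ)) 1 := by
    refine Complex.hasDerivAt_Gamma_one.congr_of_eventuallyEq ?_
    have : {z : ℂ | 0 < z.re} ∈ 𝓝 (1 : ℂ) :=
      (isOpen_lt continuous_const Complex.continuous_re).mem_nhds (by simp)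
    filter_upwards [this] with z hz
    exact (Complex.Gamma_eq_integral hz).symm
  have h3 := h1.unique h2
  simp only [sub_self, Complex.cpow_zero, one_mul] at h3
  have h4 : ∀ t : ℝ, (Real.log t : ℂ) * (Real.exp (-t) : ℂ)
      = ((Real.exp (-t) * Real.log t : ℝ) : ℂ) := fun t => by push_cast; ring
  simp only [h4] at h3
  rw [integral_complex_ofReal] at h3
  exact_mod_cast h3

/-- The argument of the logarithm in a primitive of `(t² - 2ixt)^{-1/2}`. -/
def hlin (x t : ℝ) : ℂ := (t : ℂ) - I * x + hroot x t

lemma hlin_re_ge (x t : ℝ) : t ≤ (hlin x t).re := by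
  have := hroot_re_nonneg x t
  simp [hlin]; exact this

lemma hlin_mem_slitPlane (x : ℝ) {t : ℝ} (ht : 0 < t) : hlin x t ∈ Complex.slitPlane :=
  Or.inl (ht.trans_le (hlin_re_ge x t))

lemma continuous_hlin (x : ℝ) : Continuous (hlin x) := by
  have := continuous_hroot x
  unfold hlin; fun_prop

lemma hasDerivAt_log_hlin (x : ℝ) {t : ℝ} (ht : 0 < t) :
    HasDerivAt (fun t => Complex.log (hlin x t)) (hroot x t)⁻¹ t := by
  have h1 : HasDerivAt (hlin x) (1 + ((t : ℂ) - I * x) / hroot x t) t :=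
    ((Complex.ofRealCLM.hasDerivAt (x := t)).sub_const (I * (x : ℂ))).add (hasDerivAt_hroot x ht)
  have h2 := h1.clog_real (hlin_mem_slitPlane x ht)
  refine h2.congr_deriv ?_
  have hr := hroot_ne_zero x ht
  have hz := Complex.slitPlane_ne_zero (hlin_mem_slitPlane x ht)
  rw [div_eq_iff hz]
  simp only [hlin]
  field_simp
  ring

lemma abs_log_le {t : ℝ} (ht : 0 < t) : |Real.log t| ≤ t + 2 * t ^ (-(1 / 2) : ℝ) := by
  have h0 : 0 < t ^ (-(1 / 2) : ℝ) := by positivity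
  have h1 := Real.log_le_self ht.le
  have h2 := Real.log_le_self h0.le
  rw [Real.log_rpow ht] at h2
  rw [abs_le]
  constructor <;> linarith

lemma norm_log_hlin_le {x t : ℝ} (hx : 0 < x) (hx1 : x ≤ 1) (ht : 0 < t) :
    ‖Complex.log (hlin x t)‖ ≤ 3 * t + 2 * t ^ (-(1 / 2) : ℝ) + 7 := by
  have h1 : t ≤ ‖hlin x t‖ := (hlin_re_ge x t).trans (Complex.re_le_norm _)
  have h2 : ‖hlin x t‖ ≤ 2 * t + 3 := by
    have h3 := norm_hroot_le hx.le ht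
    have h4 : ‖(t : ℂ) - I * x‖ ≤ t + x := by
      refine (norm_sub_le _ _).trans (le_of_eq ?_)
      simp [abs_of_pos hx, abs_of_pos ht]
    have := norm_add_le ((t : ℂ) - I * x) (hroot x t)
    unfold hlin
    linarith
  have h0 : 0 < ‖hlin x t‖ := ht.trans_le h1
  have h3 : |Real.log ‖hlin x t‖| ≤ 3 * t + 2 * t ^ (-(1 / 2) : ℝ) + 3 := by
    have h4 := Real.log_le_log ht h1
    have h5 := Real.log_le_self h0.le
    have h6 := abs_le.1 (abs_log_le ht)
    have h7 : 0 < t ^ (-(1 / 2) : ℝ) := by positivity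
    rw [abs_le]
    constructor <;> linarith
  have h4 : |(hlin x t).arg| ≤ 4 := (Complex.abs_arg_le_pi _).trans Real.pi_le_four
  have h5 := Complex.norm_le_abs_re_add_abs_im (Complex.log (hlin x t))
  rw [Complex.log_re, Complex.log_im] at h5
  linarith

lemma integrableOn_log_majorant :
    IntegrableOn (fun t : ℝ => Real.exp (-t) * (3 * t + 2 * t ^ (-(1 / 2) : ℝ) + 7))
      (Set.Ioi 0) := by
  have h : ∀ s : ℝ, -1 < s → IntegrableOn (fun t : ℝ => t ^ s * Real.exp (-t)) (Set.Ioi 0) := by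
    intro s hs
    have := integrableOn_rpow_mul_exp_neg_mul_rpow (p := 1) (s := s) (b := 1) hs one_pos one_pos
    simpa using this
  have h1 := h 1 (by norm_num)
  have h2 := h (-(1 / 2)) (by norm_num)
  simp only [Real.rpow_one] at h1
  have := ((h1.const_mul 3).add (h2.const_mul 2)).add (integrableOn_exp_neg.const_mul 7)
  refine this.congr (Eventually.of_forall fun t => ?_)
  simp only [Pi.add_apply]
  ring

lemma integrableOn_exp_mul_log_hlin {x : ℝ} (hx : 0 < x) (hx1 : x ≤ 1) :
    IntegrableOn (fun t : ℝ => (Real.exp (-t) : ℂ) * Complex.log (hlin x t)) (Set.Ioi 0) := by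
  have hm : Measurable (hlin x) := (continuous_hlin x).measurable
  have : Measurable fun t : ℝ => (Real.exp (-t) : ℂ) * Complex.log (hlin x t) := by fun_prop
  refine integrableOn_log_majorant.mono' this.aestronglyMeasurable
    (ae_restrict_of_forall_mem measurableSet_Ioi fun t ht => ?_)
  rw [norm_mul, Complex.norm_real, Real.norm_of_nonneg (Real.exp_pos _).le]
  exact mul_le_mul_of_nonneg_left (norm_log_hlin_le hx hx1 ht) (Real.exp_pos _).le

lemma hlin_zero (x : ℝ) : hlin x 0 = -(I * x) := by simp [hlin, hroot, hq]

lemma log_hlin_zero {x : ℝ} (hx : 0 < x) :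
    Complex.log (hlin x 0) = Real.log x - Real.pi / 2 * I := by
  rw [hlin_zero, show -(I * (x : ℂ)) = (x : ℂ) * -I by ring, Complex.log_ofReal_mul hx (by simp),
    Complex.log_neg_I]
  ring

/-- Integration by parts in the Laplace integral, which isolates its logarithmic singularity. -/
lemma hmom_zero_eq {x : ℝ} (hx : 0 < x) (hx1 : x ≤ 1) :
    hmom 0 x = -(Real.log x - Real.pi / 2 * I)
      + ∫ t in Set.Ioi (0 : ℝ), (Real.exp (-t) : ℂ) * Complex.log (hlin x t) := by
  have hA := integrableOn_exp_mul_log_hlin hx hx1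
  have hB : IntegrableOn (fun t : ℝ => (Real.exp (-t) : ℂ) / hroot x t) (Set.Ioi 0) := by
    have h1 : Measurable (hroot x) := (continuous_hroot x).measurable
    have : Measurable fun t : ℝ => (Real.exp (-t) : ℂ) / hroot x t := by fun_prop
    have h2 := (integrableOn_Ioi_comp_mul_left_iff
      (fun t : ℝ => (Real.exp (-t) : ℂ) / hroot x t) 0 hx)
    rw [mul_zero] at h2
    rw [← h2]
    have h3 := (integrableOn_hmom 0 hx).const_mul ((x : ℂ)⁻¹)
    refine IntegrableOn.congr_fun h3 (fun s hs => ?_) measurableSet_Ioi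
    have hx0 : (x : ℂ) ≠ 0 := by exact_mod_cast hx.ne'
    have hr := hroot_ne_zero 1 hs
    rw [hroot_scale hx hs]
    push_cast
    field_simp
  have hd : ∀ t ∈ Set.Ioi (0 : ℝ),
      HasDerivAt (fun t : ℝ => (Real.exp (-t) : ℂ) * Complex.log (hlin x t))
        ((Real.exp (-t) : ℂ) / hroot x t - (Real.exp (-t) : ℂ) * Complex.log (hlin x t)) t := by
    intro t ht
    have h1 : HasDerivAt (fun t : ℝ => Real.exp (-t)) (-Real.exp (-t)) t := by
      simpa using (hasDerivAt_id t).neg.exp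
    refine (h1.ofReal_comp.mul (hasDerivAt_log_hlin x ht)).congr_deriv ?_
    push_cast; ring
  have hc : ContinuousWithinAt (fun t : ℝ => (Real.exp (-t) : ℂ) * Complex.log (hlin x t))
      (Set.Ici 0) 0 := by
    have h1 : ContinuousAt (fun t => Complex.log (hlin x t)) 0 := by
      refine (continuous_hlin x).continuousAt.clog ?_
      rw [hlin_zero]
      exact Or.inr (by simp [hx.ne'])
    have h2 : Continuous fun t : ℝ => (Real.exp (-t) : ℂ) := by fun_prop
    exact (h2.continuousAt.mul h1).continuousWithinAt
  have hlim : Tendsto (fun t : ℝ => (Real.exp (-t) : ℂ) * Complex.log (hlin x t)) atTop (𝓝 0) := by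
    have h1 : Tendsto (fun t : ℝ => 12 * (t ^ 1 * Real.exp (-t))) atTop (𝓝 (12 * 0)) :=
      (Real.tendsto_pow_mul_exp_neg_atTop_nhds_zero 1).const_mul 12
    rw [mul_zero] at h1
    refine squeeze_zero_norm' ?_ h1
    filter_upwards [eventually_ge_atTop 1] with t ht
    have ht0 : 0 < t := by linarith
    rw [norm_mul, Complex.norm_real, Real.norm_of_nonneg (Real.exp_pos _).le]
    have h2 := norm_log_hlin_le hx hx1 ht0
    have h3 : t ^ (-(1 / 2) : ℝ) ≤ 1 := Real.rpow_le_one_of_one_le_of_nonpos ht (by norm_num)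
    have h4 : ‖Complex.log (hlin x t)‖ ≤ 12 * t := by linarith
    nlinarith [mul_le_mul_of_nonneg_left h4 (Real.exp_pos (-t)).le]
  have key := integral_Ioi_of_hasDerivAt_of_tendsto hc hd (hB.sub hA) hlim
  rw [integral_sub hB hA, ← hmom_zero_scaled hx, log_hlin_zero hx] at key
  simp only [neg_zero, Real.exp_zero, Complex.ofReal_one, one_mul] at key
  linear_combination key

/-- The logarithmic singularity of the Laplace integral, with its constant term. -/
lemma tendsto_hmom_zero_add_log :
    Tendsto (fun x : ℝ => hmom 0 x + Real.log x) (𝓝[>] 0)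
      (𝓝 (Real.log 2 - Real.eulerMascheroniConstant + Real.pi / 2 * I)) := by
  have h : Tendsto (fun x : ℝ => ∫ t in Set.Ioi (0 : ℝ),
      (Real.exp (-t) : ℂ) * Complex.log (hlin x t)) (𝓝[>] 0)
      (𝓝 (∫ t in Set.Ioi (0 : ℝ), ((Real.exp (-t) * (Real.log 2 + Real.log t) : ℝ) : ℂ))) := by
    have hI : Set.Ioc (0 : ℝ) 1 ∈ 𝓝[>] (0 : ℝ) := Ioc_mem_nhdsGT one_pos
    refine tendsto_integral_filter_of_dominated_convergence
      (fun t : ℝ => Real.exp (-t) * (3 * t + 2 * t ^ (-(1 / 2) : ℝ) + 7))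
      (Eventually.of_forall fun x => ?_) ?_ integrableOn_log_majorant
      (ae_restrict_of_forall_mem measurableSet_Ioi fun t ht => ?_)
    · have hm : Measurable (hlin x) := (continuous_hlin x).measurable
      have : Measurable fun t : ℝ => (Real.exp (-t) : ℂ) * Complex.log (hlin x t) := by fun_prop
      exact this.aestronglyMeasurable
    · filter_upwards [hI] with x hx
      refine ae_restrict_of_forall_mem measurableSet_Ioi fun t ht => ?_
      rw [norm_mul, Complex.norm_real, Real.norm_of_nonneg (Real.exp_pos _).le]
      exact mul_le_mul_of_nonneg_left (norm_log_hlin_le hx.1 hx.2 ht) (Real.exp_pos _).le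
    · have ht : 0 < t := ht
      have h1 : ContinuousAt (fun x => hlin x t) 0 := by
        have h2 : Continuous fun x : ℝ => (t : ℂ) - I * x := by fun_prop
        exact h2.continuousAt.add (continuousAt_hroot_left 0 ht)
      have h2 := (h1.clog (hlin_mem_slitPlane 0 ht)).tendsto.mono_left
        (nhdsWithin_le_nhds (s := Set.Ioi 0))
      have h3 : Complex.log (hlin 0 t) = ((Real.log 2 + Real.log t : ℝ) : ℂ) := by
        rw [hlin, hroot_zero ht, ← Real.log_mul two_ne_zero ht.ne',
          Complex.ofReal_log (by positivity)]
        congr 1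
        push_cast; ring
      rw [h3] at h2
      have h4 := h2.const_mul (Real.exp (-t) : ℂ)
      rwa [← Complex.ofReal_mul] at h4
  have hlogi : IntegrableOn (fun t : ℝ => Real.exp (-t) * Real.log t) (Set.Ioi 0) := by
    have hm : Measurable fun t : ℝ => Real.exp (-t) * Real.log t := by fun_prop
    refine integrableOn_log_majorant.mono' hm.aestronglyMeasurable
      (ae_restrict_of_forall_mem measurableSet_Ioi fun t ht => ?_)
    have ht : 0 < t := ht
    rw [norm_mul, Real.norm_of_nonneg (Real.exp_pos _).le, Real.norm_eq_abs]
    refine mul_le_mul_of_nonneg_left ?_ (Real.exp_pos _).le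
    linarith [abs_log_le ht]
  have hval : ∫ t in Set.Ioi (0 : ℝ), ((Real.exp (-t) * (Real.log 2 + Real.log t) : ℝ) : ℂ)
      = Real.log 2 - Real.eulerMascheroniConstant := by
    rw [integral_complex_ofReal]
    simp only [mul_add]
    rw [integral_add (integrableOn_exp_neg.mul_const _) hlogi, integral_mul_const,
      integral_exp_neg_Ioi_zero, integral_exp_neg_mul_log]
    push_cast; ring
  rw [hval] at h
  refine (h.add_const ((Real.pi : ℂ) / 2 * I)).congr' ?_
  filter_upwards [Ioc_mem_nhdsGT one_pos] with x hx
  rw [hmom_zero_eq hx.1 hx.2]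
  ring

/-! ### The Hankel function as a power series, and its Laplace integral -/

/-- The power series with coefficients `c`. -/
def pseries (c : ℕ → ℝ) (y : ℝ) : ℝ := ∑' j, c j * y ^ j

/-- The coefficients of the derivative. -/
def dcoeff (c : ℕ → ℝ) (j : ℕ) : ℝ := (j + 1) * c (j + 1)

/-- Coefficients dominated by those of the exponential series. -/
def ExpBounded (c : ℕ → ℝ) : Prop := ∀ j, |c j| ≤ 1 / (j.factorial : ℝ)

lemma ExpBounded.dcoeff {c : ℕ → ℝ} (hc : ExpBounded c) : ExpBounded (dcoeff c) := by
  intro j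
  have h := hc (j + 1)
  rw [Nat.factorial_succ] at h
  rw [Helmholtz.dcoeff, abs_mul, abs_of_pos (by positivity)]
  refine (mul_le_mul_of_nonneg_left h (by positivity)).trans (le_of_eq ?_)
  push_cast
  field_simp

lemma ExpBounded.summable {c : ℕ → ℝ} (hc : ExpBounded c) (y : ℝ) :
    Summable fun j => c j * y ^ j := by
  refine Summable.of_norm_bounded (Real.summable_pow_div_factorial |y|) fun j => ?_
  rw [norm_mul, norm_pow, Real.norm_eq_abs, Real.norm_eq_abs]
  refine (mul_le_mul_of_nonneg_right (hc j) (by positivity)).trans (le_of_eq ?_)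
  ring

lemma ExpBounded.hasDerivAt {c : ℕ → ℝ} (hc : ExpBounded c) (y : ℝ) :
    HasDerivAt (pseries c) (pseries (Helmholtz.dcoeff c) y) y := by
  set B := |y| + 1 with hB
  have hB0 : 0 < B := by positivity
  have hu : Summable fun j : ℕ => (j : ℝ) * |c j| * B ^ (j - 1) := by
    rw [← summable_nat_add_iff 1]
    refine Summable.of_nonneg_of_le (fun j => by positivity) (fun j => ?_)
      (Real.summable_pow_div_factorial B)
    have h := hc.dcoeff j
    rw [Helmholtz.dcoeff, abs_mul, abs_of_pos (by positivity)] at h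
    rw [Nat.add_sub_cancel]
    push_cast
    refine (mul_le_mul_of_nonneg_right h (by positivity)).trans (le_of_eq ?_)
    ring
  have h := hasDerivAt_tsum_of_isPreconnected (t := Metric.ball (0 : ℝ) B)
    (g := fun j z => c j * z ^ j) (g' := fun j z => c j * (j * z ^ (j - 1))) (y₀ := 0) (y := y)
    hu Metric.isOpen_ball (convex_ball 0 B).isPreconnected
    (fun j z _ => (hasDerivAt_pow j z).const_mul (c j)) (fun j z hz => ?_)
    (by simpa using hB0) (hc.summable 0) (by simp [hB])
  · refine h.congr_deriv ?_
    rw [pseries, Summable.tsum_eq_zero_add]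
    · simp only [Nat.cast_zero, zero_mul, mul_zero, zero_add, Nat.add_sub_cancel]
      refine tsum_congr fun j => ?_
      simp only [Helmholtz.dcoeff]
      push_cast; ring
    · rw [← summable_nat_add_iff 1]
      refine (hc.dcoeff.summable y).congr fun j => ?_
      simp only [Helmholtz.dcoeff, Nat.add_sub_cancel]
      push_cast; ring
  · simp only [Metric.mem_ball, dist_zero_right, Real.norm_eq_abs] at hz
    rw [norm_mul, norm_mul, norm_pow, Real.norm_eq_abs, Real.norm_eq_abs, Real.norm_eq_abs,
      Nat.abs_cast]
    have := pow_le_pow_left₀ (abs_nonneg z) hz.le (j - 1)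
    calc |c j| * (j * |z| ^ (j - 1)) ≤ |c j| * (j * B ^ (j - 1)) := by gcongr
      _ = _ := by ring

lemma pseries_zero (c : ℕ → ℝ) : pseries c 0 = c 0 := by
  rw [pseries, tsum_eq_single 0 fun j hj => by simp [hj]]
  simp

/-- The Bessel operator in the variable `y = x²/4`, applied to a power series. -/
lemma ExpBounded.bessel_operator {c : ℕ → ℝ} (hc : ExpBounded c) (y : ℝ) :
    y * pseries (Helmholtz.dcoeff (Helmholtz.dcoeff c)) y + pseries (Helmholtz.dcoeff c) y
      + pseries c y = ∑' j : ℕ, (((j : ℝ) + 1) ^ 2 * c (j + 1) + c j) * y ^ j := by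
  have s2 := hc.dcoeff.dcoeff.summable y
  have s1 := hc.dcoeff.summable y
  have s0 := hc.summable y
  have e : y * pseries (Helmholtz.dcoeff (Helmholtz.dcoeff c)) y
      = ∑' j : ℕ, (j : ℝ) * Helmholtz.dcoeff c j * y ^ j := by
    rw [Summable.tsum_eq_zero_add]
    · simp only [Nat.cast_zero, zero_mul, zero_add]
      rw [pseries, ← tsum_mul_left]
      refine tsum_congr fun j => ?_
      simp only [Helmholtz.dcoeff]
      push_cast; ring
    · rw [← summable_nat_add_iff 1]
      refine (s2.mul_left y).congr fun j => ?_
      simp only [Helmholtz.dcoeff]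
      push_cast; ring
  have s3 : Summable fun j : ℕ => (j : ℝ) * Helmholtz.dcoeff c j * y ^ j := by
    rw [← summable_nat_add_iff 1]
    refine (s2.mul_left y).congr fun j => ?_
    simp only [Helmholtz.dcoeff]
    push_cast; ring
  rw [e, pseries, pseries, ← s3.tsum_add s1, ← (s3.add s1).tsum_add s0]
  refine tsum_congr fun j => ?_
  simp only [Helmholtz.dcoeff]
  ring

/-- The coefficients of `J₀` in powers of `x²/4`. -/
def jcoeff (j : ℕ) : ℝ := (-1) ^ j / (j.factorial : ℝ) ^ 2

/-- The coefficients of the regular part of `Y₀`, up to the factor `-2/π`. -/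
def ycoeff (j : ℕ) : ℝ := (-1) ^ j * (harmonic j : ℝ) / (j.factorial : ℝ) ^ 2

lemma harmonic_nonneg' (j : ℕ) : (0 : ℝ) ≤ (harmonic j : ℝ) := by
  rw [harmonic]; push_cast
  exact Finset.sum_nonneg fun i _ => by positivity

lemma harmonic_le_factorial (j : ℕ) : (harmonic j : ℝ) ≤ (j.factorial : ℝ) := by
  have h : (harmonic j : ℝ) ≤ j := by
    rw [harmonic]; push_cast
    refine (Finset.sum_le_card_nsmul _ _ 1 fun i _ => ?_).trans (by simp)
    exact inv_le_one_of_one_le₀ (by linarith [Nat.cast_nonneg (α := ℝ) i])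
  exact h.trans (by exact_mod_cast Nat.self_le_factorial j)

lemma expBounded_jcoeff : ExpBounded jcoeff := by
  intro j
  have h1 : (1 : ℝ) ≤ j.factorial := by exact_mod_cast Nat.one_le_iff_ne_zero.2 j.factorial_ne_zero
  rw [jcoeff, abs_div, abs_pow, abs_neg, abs_one, one_pow, abs_of_pos (by positivity)]
  exact one_div_le_one_div_of_le (by positivity) (by nlinarith)

lemma expBounded_ycoeff : ExpBounded ycoeff := by
  intro j
  have h0 : (0 : ℝ) < j.factorial := by exact_mod_cast j.factorial_pos
  rw [ycoeff, abs_div, abs_mul, abs_pow, abs_neg, abs_one, one_pow, one_mul,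
    abs_of_nonneg (harmonic_nonneg' j), abs_of_pos (by positivity),
    div_le_div_iff₀ (by positivity) h0]
  nlinarith [harmonic_le_factorial j]

lemma pseries_jcoeff_eq (y : ℝ) :
    y * pseries (dcoeff (dcoeff jcoeff)) y + pseries (dcoeff jcoeff) y + pseries jcoeff y = 0 := by
  rw [expBounded_jcoeff.bessel_operator]
  have : ∀ j : ℕ, (((j : ℝ) + 1) ^ 2 * jcoeff (j + 1) + jcoeff j) * y ^ j = 0 := by
    intro j
    have h0 : (j.factorial : ℝ) ≠ 0 := by exact_mod_cast j.factorial_ne_zero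
    simp only [jcoeff, Nat.factorial_succ]
    push_cast
    field_simp
    ring
  simp [this]

lemma pseries_ycoeff_eq (y : ℝ) :
    y * pseries (dcoeff (dcoeff ycoeff)) y + pseries (dcoeff ycoeff) y + pseries ycoeff y
      = pseries (dcoeff jcoeff) y := by
  rw [expBounded_ycoeff.bessel_operator, pseries]
  refine tsum_congr fun j => ?_
  have h0 : (j.factorial : ℝ) ≠ 0 := by exact_mod_cast j.factorial_ne_zero
  simp only [jcoeff, ycoeff, dcoeff, Nat.factorial_succ, harmonic_succ]
  push_cast
  field_simp
  ring

lemma besselJ0_eq (x : ℝ) : besselJ0 x = pseries jcoeff (x ^ 2 / 4) := by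
  rw [besselJ0, pseries]
  refine tsum_congr fun j => ?_
  rw [jcoeff, pow_mul]
  congr 2; ring

/-- The series part of `Y₀`, up to the factor `-2/π`. -/
def besselG (x : ℝ) : ℝ := pseries ycoeff (x ^ 2 / 4)

lemma besselY0_eq (x : ℝ) : besselY0 x
    = 2 / Real.pi * ((Real.log (x / 2) + Real.eulerMascheroniConstant) * besselJ0 x
      - besselG x) := by
  have : ∑' j : ℕ, (-1) ^ j * (harmonic j : ℝ) / (j.factorial : ℝ) ^ 2 * (x / 2) ^ (2 * j)
      = besselG x := by
    rw [besselG, pseries]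
    refine tsum_congr fun j => ?_
    rw [ycoeff, pow_mul]
    congr 2; ring
  rw [besselY0, this]
  ring

lemma hasDerivAt_pseries_sq {c : ℕ → ℝ} (hc : ExpBounded c) (x : ℝ) :
    HasDerivAt (fun x => pseries c (x ^ 2 / 4)) (x / 2 * pseries (dcoeff c) (x ^ 2 / 4)) x := by
  have h1 : HasDerivAt (fun x : ℝ => x ^ 2 / 4) (x / 2) x := by
    refine ((hasDerivAt_pow 2 x).div_const 4).congr_deriv ?_
    simp; ring
  refine ((hc.hasDerivAt (x ^ 2 / 4)).comp x h1).congr_deriv ?_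
  ring

lemma hasDerivAt_besselJ0 (x : ℝ) :
    HasDerivAt besselJ0 (x / 2 * pseries (dcoeff jcoeff) (x ^ 2 / 4)) x := by
  have : besselJ0 = fun x => pseries jcoeff (x ^ 2 / 4) := funext besselJ0_eq
  rw [this]
  exact hasDerivAt_pseries_sq expBounded_jcoeff x

lemma hasDerivAt_besselG (x : ℝ) :
    HasDerivAt besselG (x / 2 * pseries (dcoeff ycoeff) (x ^ 2 / 4)) x :=
  hasDerivAt_pseries_sq expBounded_ycoeff x

lemma hasDerivAt_half_mul_pseries {c : ℕ → ℝ} (hc : ExpBounded c) (x : ℝ) :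
    HasDerivAt (fun x => x / 2 * pseries (dcoeff c) (x ^ 2 / 4))
      (pseries (dcoeff c) (x ^ 2 / 4) / 2
        + x ^ 2 / 4 * pseries (dcoeff (dcoeff c)) (x ^ 2 / 4)) x := by
  refine (((hasDerivAt_id x).div_const 2).mul (hasDerivAt_pseries_sq hc.dcoeff x)).congr_deriv ?_
  simp; ring

/-- The derivative of `J₀`. -/
def besselJ1' (x : ℝ) : ℝ := x / 2 * pseries (dcoeff jcoeff) (x ^ 2 / 4)

/-- The derivative of `besselG`. -/
def besselG1 (x : ℝ) : ℝ := x / 2 * pseries (dcoeff ycoeff) (x ^ 2 / 4)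

/-- The derivative of `Y₀`. -/
def besselY1' (x : ℝ) : ℝ :=
  2 / Real.pi * (besselJ0 x / x
    + (Real.log (x / 2) + Real.eulerMascheroniConstant) * besselJ1' x - besselG1 x)

lemma hasDerivAt_besselJ1' {x : ℝ} (hx : 0 < x) :
    HasDerivAt besselJ1' (-(besselJ1' x) / x - besselJ0 x) x := by
  refine (hasDerivAt_half_mul_pseries expBounded_jcoeff x).congr_deriv ?_
  have h := pseries_jcoeff_eq (x ^ 2 / 4)
  rw [besselJ0_eq, besselJ1']
  field_simp
  linear_combination 8 * h

lemma hasDerivAt_besselG1 {x : ℝ} (hx : 0 < x) :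
    HasDerivAt besselG1 (-(besselG1 x) / x - besselG x + 2 * besselJ1' x / x) x := by
  refine (hasDerivAt_half_mul_pseries expBounded_ycoeff x).congr_deriv ?_
  have h := pseries_ycoeff_eq (x ^ 2 / 4)
  rw [besselG, besselG1, besselJ1']
  field_simp
  linear_combination 8 * h

lemma hasDerivAt_log_half {x : ℝ} (hx : 0 < x) :
    HasDerivAt (fun x => Real.log (x / 2) + Real.eulerMascheroniConstant) (1 / x) x := by
  refine ((((hasDerivAt_id x).div_const 2).log (by simp; exact hx.ne')).add_const _).congr_deriv ?_
  simp; field_simp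

lemma hasDerivAt_besselY0 {x : ℝ} (hx : 0 < x) : HasDerivAt besselY0 (besselY1' x) x := by
  have : besselY0 = fun x => 2 / Real.pi *
      ((Real.log (x / 2) + Real.eulerMascheroniConstant) * besselJ0 x - besselG x) :=
    funext besselY0_eq
  rw [this]
  refine ((((hasDerivAt_log_half hx).mul (hasDerivAt_besselJ0 x)).sub
    (hasDerivAt_besselG x)).const_mul (2 / Real.pi)).congr_deriv ?_
  simp only [besselY1', besselJ1', besselG1]
  ring

lemma hasDerivAt_besselY1' {x : ℝ} (hx : 0 < x) :
    HasDerivAt besselY1' (-(besselY1' x) / x - besselY0 x) x := by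
  have h := (((((hasDerivAt_besselJ0 x).div (hasDerivAt_id x) hx.ne').add
    ((hasDerivAt_log_half hx).mul (hasDerivAt_besselJ1' hx))).sub
    (hasDerivAt_besselG1 hx)).const_mul (2 / Real.pi))
  refine h.congr_deriv ?_
  rw [besselY0_eq, besselY1', ← besselJ1']
  simp only [id]
  field_simp
  ring

/-- A solution of Bessel's equation of order zero which is `o(1)`, with derivative `o(1/x)`, as
`x → 0` vanishes: its derivative is then `o(1)` too, and `|D|² + |D'|²` is nonincreasing. -/
lemma eq_zero_of_bessel {D D₁ : ℝ → ℂ} (hD : ∀ x : ℝ, 0 < x → HasDerivAt D (D₁ x) x)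
    (hD₁ : ∀ x : ℝ, 0 < x → HasDerivAt D₁ (-(D₁ x) / x - D x) x)
    (h0 : Tendsto D (𝓝[>] 0) (𝓝 0)) (h1 : Tendsto (fun x : ℝ => (x : ℂ) * D₁ x) (𝓝[>] 0) (𝓝 0))
    {x : ℝ} (hx : 0 < x) : D x = 0 := by
  have hg : ∀ y : ℝ, 0 < y → HasDerivAt (fun x : ℝ => (x : ℂ) * D₁ x) (-(y * D y)) y := by
    intro y hy
    refine ((Complex.ofRealCLM.hasDerivAt (x := y)).mul (hD₁ y hy)).congr_deriv ?_
    have : (y : ℂ) ≠ 0 := by exact_mod_cast hy.ne'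
    simp only [Complex.ofRealCLM_apply, Complex.ofReal_one]
    field_simp
    ring
  -- `(x D')' = -x D` is `o(x)`, and `x D'` tends to zero, so `x D' = o(x²)`
  have hD₁0 : Tendsto D₁ (𝓝[>] 0) (𝓝 0) := by
    rw [Metric.tendsto_nhds]
    intro ε hε
    have h2 := (Metric.tendsto_nhds.1 h0) (ε / 2) (by positivity)
    obtain ⟨δ, hδ0, hδ⟩ := mem_nhdsGT_iff_exists_Ioo_subset.1 h2
    have hδ0 : 0 < δ := hδ0
    filter_upwards [Ioo_mem_nhdsGT (lt_min hδ0 one_pos)] with y hy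
    have hy0 := hy.1
    have hyδ := hy.2.trans_le (min_le_left _ _)
    have hy1 := hy.2.trans_le (min_le_right _ _)
    have hstep : ∀ s ∈ Set.Ioo 0 y, ‖(y : ℂ) * D₁ y - s * D₁ s‖ ≤ ε / 2 * y * y := by
      intro s hs
      have h3 := (convex_Icc s y).norm_image_sub_le_of_norm_hasDerivWithin_le
        (f := fun x : ℝ => (x : ℂ) * D₁ x) (f' := fun z => -(z * D z)) (C := ε / 2 * y)
        (fun z hz => (hg z (hs.1.trans_le hz.1)).hasDerivWithinAt) (fun z hz => ?_)
        (Set.left_mem_Icc.2 hs.2.le) (Set.right_mem_Icc.2 hs.2.le)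
      · refine h3.trans ?_
        rw [Real.norm_of_nonneg (by linarith [hs.2])]
        exact mul_le_mul_of_nonneg_left (by linarith [hs.1]) (by positivity)
      · have hz0 : 0 < z := hs.1.trans_le hz.1
        have h4 : dist (D z) 0 < ε / 2 := hδ ⟨hz0, hz.2.trans_lt hyδ⟩
        rw [dist_zero_right] at h4
        rw [norm_neg, norm_mul, Complex.norm_real, Real.norm_of_nonneg hz0.le, mul_comm]
        exact mul_le_mul h4.le hz.2 hz0.le (by positivity)
    have hlim : Tendsto (fun s : ℝ => ‖(y : ℂ) * D₁ y - s * D₁ s‖) (𝓝[>] 0)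
        (𝓝 ‖(y : ℂ) * D₁ y - 0‖) := (tendsto_const_nhds.sub h1).norm
    have h5 := le_of_tendsto hlim (by
      filter_upwards [Ioo_mem_nhdsGT hy0] with s hs using hstep s hs)
    rw [sub_zero, norm_mul, Complex.norm_real, Real.norm_of_nonneg hy0.le] at h5
    rw [dist_zero_right]
    have h6 : ‖D₁ y‖ ≤ ε / 2 * y := by
      refine le_of_mul_le_mul_left ?_ hy0
      linarith
    nlinarith
  set N : ℝ → ℝ := fun x => ‖D x‖ ^ 2 + ‖D₁ x‖ ^ 2 with hN
  have hNd : ∀ y : ℝ, 0 < y → HasDerivAt N (-(2 / y * ‖D₁ y‖ ^ 2)) y := by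
    intro y hy
    refine ((hD y hy).norm_sq.add (hD₁ y hy).norm_sq).congr_deriv ?_
    have e : -(D₁ y) / (y : ℂ) = (-y⁻¹ : ℝ) • D₁ y := by
      rw [Complex.real_smul]; push_cast; ring
    rw [e, inner_sub_right, real_inner_smul_right, real_inner_self_eq_norm_sq,
      real_inner_comm (D y) (D₁ y)]
    ring
  have hanti : AntitoneOn N (Set.Ioi 0) := by
    refine antitoneOn_of_deriv_nonpos (convex_Ioi 0)
      (fun y hy => (hNd y hy).continuousAt.continuousWithinAt)
      (fun y hy => ((hNd y (interior_subset hy)).differentiableAt).differentiableWithinAt)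
      fun y hy => ?_
    have hy : 0 < y := interior_subset hy
    rw [(hNd y hy).deriv, neg_nonpos]
    positivity
  have hN0 : Tendsto N (𝓝[>] 0) (𝓝 0) := by
    have := (h0.norm.pow 2).add (hD₁0.norm.pow 2)
    simpa using this
  have hle : N x ≤ 0 := by
    refine ge_of_tendsto hN0 ?_
    filter_upwards [Ioo_mem_nhdsGT hx] with s hs
    exact hanti hs.1 hx hs.2.le
  have : ‖D x‖ ^ 2 ≤ 0 := by
    have := sq_nonneg ‖D₁ x‖
    simp only [hN] at hle
    linarith
  exact norm_eq_zero.1 (pow_eq_zero_iff two_ne_zero |>.1 (le_antisymm this (sq_nonneg _)))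

/-- The outgoing solution of Bessel's equation given by the Laplace integral. -/
def hlap (x : ℝ) : ℂ := Complex.exp (I * x) * hmom 0 x

/-- The derivative of `hlap`. -/
def hlap₁ (x : ℝ) : ℂ := Complex.exp (I * x) * (I * hmom 0 x - hmom 1 x)

lemma hasDerivAt_exp_I (x : ℝ) :
    HasDerivAt (fun x : ℝ => Complex.exp (I * x)) (Complex.exp (I * x) * I) x := by
  have := ((Complex.ofRealCLM.hasDerivAt (x := x)).const_mul I).cexp
  refine this.congr_deriv ?_
  simp

lemma hasDerivAt_hlap {x : ℝ} (hx : 0 < x) : HasDerivAt hlap (hlap₁ x) x := by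
  refine ((hasDerivAt_exp_I x).mul (hasDerivAt_hmom 0 hx)).congr_deriv ?_
  simp only [hlap₁]; ring

lemma hasDerivAt_hlap₁ {x : ℝ} (hx : 0 < x) :
    HasDerivAt hlap₁ (-(hlap₁ x) / x - hlap x) x := by
  refine ((hasDerivAt_exp_I x).mul (((hasDerivAt_hmom 0 hx).const_mul I).sub
    (hasDerivAt_hmom 1 hx))).congr_deriv ?_
  have h := hmom_relation hx
  have hx0 : (x : ℂ) ≠ 0 := by exact_mod_cast hx.ne'
  simp only [hlap, hlap₁, Pi.sub_apply, zero_add, Nat.reduceAdd]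
  field_simp
  linear_combination h + x * hmom 0 x * Complex.I_sq

lemma norm_hmom_zero_le {x : ℝ} (hx : 0 < x) :
    ‖hmom 0 x‖ ≤ Real.Gamma (1 / 2) * x ^ (-(1 / 2) : ℝ) := by
  simpa using norm_hmom_le 0 hx

lemma tendsto_mul_hmom_zero :
    Tendsto (fun x : ℝ => ‖(x : ℂ) * hmom 0 x‖) (𝓝[>] 0) (𝓝 0) := by
  have h1 : Tendsto (fun x : ℝ => Real.Gamma (1 / 2) * x ^ (1 / 2 : ℝ)) (𝓝[>] 0) (𝓝 0) := by
    have : Continuous fun x : ℝ => Real.Gamma (1 / 2) * x ^ (1 / 2 : ℝ) :=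
      continuous_const.mul (Real.continuous_rpow_const (by norm_num))
    have h2 := (this.tendsto 0).mono_left (nhdsWithin_le_nhds (s := Set.Ioi 0))
    simpa using h2
  refine squeeze_zero' (Eventually.of_forall fun x => norm_nonneg _) ?_ h1
  filter_upwards [self_mem_nhdsWithin] with x hx
  have hx : 0 < x := hx
  rw [norm_mul, Complex.norm_real, Real.norm_of_nonneg hx.le]
  refine (mul_le_mul_of_nonneg_left (norm_hmom_zero_le hx) hx.le).trans (le_of_eq ?_)
  have : x ^ (1 / 2 : ℝ) = x * x ^ (-(1 / 2) : ℝ) := by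
    rw [← Real.rpow_one_add' hx.le (by norm_num)]; norm_num
  rw [this]; ring

lemma tendsto_log_mul_self : Tendsto (fun x : ℝ => x * Real.log x) (𝓝[>] 0) (𝓝 0) := by
  have := Real.continuous_mul_log.tendsto 0
  simp only [zero_mul] at this
  exact this.mono_left nhdsWithin_le_nhds

/-- The Hankel function `H₀⁽¹⁾`, defined by its power series, is a multiple of the outgoing Laplace
integral, which exhibits its behaviour at infinity: both sides solve Bessel's equation, and their
logarithmic singularities at `0` agree up to the constant term. -/
theorem hankel0_eq {x : ℝ} (hx : 0 < x) : hankel0 x = -(2 * I / Real.pi) * hlap x := by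
  set γ := Real.eulerMascheroniConstant with hγ
  set D : ℝ → ℂ := fun x => hankel0 x + (2 * I / Real.pi) * hlap x with hD
  set D₁ : ℝ → ℂ := fun x => ((besselJ1' x : ℂ) + I * (besselY1' x : ℂ))
    + (2 * I / Real.pi) * hlap₁ x with hD₁
  have hpi : (Real.pi : ℂ) ≠ 0 := by exact_mod_cast Real.pi_ne_zero
  have cJ : Tendsto besselJ0 (𝓝[>] 0) (𝓝 1) := by
    have h := (hasDerivAt_besselJ0 0).continuousAt.tendsto
    have h0 : besselJ0 0 = 1 := by
      rw [besselJ0_eq]; simp [pseries_zero, jcoeff]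
    rw [h0] at h
    exact h.mono_left nhdsWithin_le_nhds
  have cG : Tendsto besselG (𝓝[>] 0) (𝓝 0) := by
    have h := (hasDerivAt_besselG 0).continuousAt.tendsto
    have h0 : besselG 0 = 0 := by simp [besselG, pseries_zero, ycoeff]
    rw [h0] at h
    exact h.mono_left nhdsWithin_le_nhds
  have cP : ∀ {c : ℕ → ℝ}, ExpBounded c →
      Tendsto (fun x : ℝ => pseries c (x ^ 2 / 4)) (𝓝[>] 0) (𝓝 (c 0)) := by
    intro c hc
    have h := (hasDerivAt_pseries_sq hc 0).continuousAt.tendsto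
    simp only [ne_eq, OfNat.ofNat_ne_zero, not_false_eq_true, zero_pow, zero_div,
      pseries_zero] at h
    exact h.mono_left nhdsWithin_le_nhds
  have cx : Tendsto (fun x : ℝ => x) (𝓝[>] 0) (𝓝 0) := nhdsWithin_le_nhds
  -- `J₀ - 1 = O(x)`, and this beats the logarithm
  have cJlog : Tendsto (fun x : ℝ => Real.log x * (besselJ0 x - 1)) (𝓝[>] 0) (𝓝 0) := by
    have h1 := (hasDerivAt_besselJ0 0).isBigO_sub
    have h0 : besselJ0 0 = 1 := by
      rw [besselJ0_eq]; simp [pseries_zero, jcoeff]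
    simp only [h0, sub_zero] at h1
    have h2 : (fun x : ℝ => Real.log x * (besselJ0 x - 1)) =O[𝓝[>] 0]
        fun x : ℝ => Real.log x * x :=
      (isBigO_refl _ _).mul (h1.mono nhdsWithin_le_nhds)
    refine h2.trans_tendsto ?_
    simpa only [mul_comm] using tendsto_log_mul_self
  have cexp : Tendsto (fun x : ℝ => Complex.exp (I * x)) (𝓝[>] 0) (𝓝 1) := by
    have h : Continuous fun x : ℝ => Complex.exp (I * x) := by fun_prop
    have h2 := (h.tendsto 0).mono_left (nhdsWithin_le_nhds (s := Set.Ioi 0))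
    simpa using h2
  have cxh0 : Tendsto (fun x : ℝ => (x : ℂ) * hmom 0 x) (𝓝[>] 0) (𝓝 0) :=
    tendsto_zero_iff_norm_tendsto_zero.2 tendsto_mul_hmom_zero
  have cexph : Tendsto (fun x : ℝ => (Complex.exp (I * x) - 1) * hmom 0 x) (𝓝[>] 0) (𝓝 0) := by
    have h1 := (hasDerivAt_exp_I 0).isBigO_sub
    simp only [Complex.ofReal_zero, mul_zero, Complex.exp_zero, sub_zero] at h1
    have h2 : (fun x : ℝ => (Complex.exp (I * x) - 1) * hmom 0 x) =O[𝓝[>] 0]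
        fun x : ℝ => (x : ℂ) * hmom 0 x := by
      refine IsBigO.mul ((h1.mono nhdsWithin_le_nhds).trans ?_) (isBigO_refl _ _)
      exact IsBigO.of_bound 1 (Eventually.of_forall fun x => by simp)
    exact h2.trans_tendsto cxh0
  have hoR : ∀ {f : ℝ → ℝ} {l : ℝ}, Tendsto f (𝓝[>] 0) (𝓝 l) →
      Tendsto (fun x => (f x : ℂ)) (𝓝[>] 0) (𝓝 (l : ℂ)) := fun h =>
    (Complex.continuous_ofReal.tendsto _).comp h
  -- the constant terms cancel
  have h0 : Tendsto D (𝓝[>] 0) (𝓝 0) := by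
    have h := (hoR cJ).add ((((((hoR cJ).const_mul ((γ - Real.log 2 : ℝ) : ℂ)).add (hoR cJlog)).sub
      (hoR cG)).add (tendsto_hmom_zero_add_log.add cexph)).const_mul (2 * I / Real.pi))
    have e : (((1 : ℝ) : ℂ) + 2 * I / Real.pi * (((γ - Real.log 2 : ℝ) : ℂ) * ((1 : ℝ) : ℂ)
        + ((0 : ℝ) : ℂ) - ((0 : ℝ) : ℂ)
        + (Real.log 2 - Real.eulerMascheroniConstant + Real.pi / 2 * I + 0))) = 0 := by
      rw [← hγ]
      push_cast
      field_simp
      linear_combination Real.pi * Complex.I_sq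
    rw [e] at h
    refine h.congr' ?_
    filter_upwards [self_mem_nhdsWithin] with y hy
    have hy : 0 < y := hy
    simp only [hD, hankel0, hlap]
    rw [besselY0_eq, Real.log_div hy.ne' two_ne_zero, ← hγ]
    push_cast
    field_simp
    ring
  -- the coefficients of the logarithms cancel
  have h1 : Tendsto (fun x : ℝ => (x : ℂ) * D₁ x) (𝓝[>] 0) (𝓝 0) := by
    have cxJ1 : Tendsto (fun x : ℝ => x * besselJ1' x) (𝓝[>] 0) (𝓝 0) := by
      have := (cx.mul (cx.div_const 2)).mul (cP expBounded_jcoeff.dcoeff)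
      simp only [zero_mul] at this
      refine this.congr fun x => ?_
      simp only [besselJ1']; ring
    have cxG1 : Tendsto (fun x : ℝ => x * besselG1 x) (𝓝[>] 0) (𝓝 0) := by
      have := (cx.mul (cx.div_const 2)).mul (cP expBounded_ycoeff.dcoeff)
      simp only [zero_mul] at this
      refine this.congr fun x => ?_
      simp only [besselG1]; ring
    have cxlog : Tendsto (fun x : ℝ => (x * Real.log x) * besselJ1' x) (𝓝[>] 0) (𝓝 0) := by
      have := tendsto_log_mul_self.mul ((cx.div_const 2).mul (cP expBounded_jcoeff.dcoeff))
      simpa [besselJ1'] using this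
    have h := (hoR cxJ1).add (((((hoR cJ).add (((hoR cxJ1).const_mul ((γ - Real.log 2 : ℝ) : ℂ)).add
      (hoR cxlog))).sub (hoR cxG1)).add
      (cexp.mul ((cxh0.const_mul I).sub tendsto_mul_hmom_one))).const_mul (2 * I / Real.pi))
    have e : (((0 : ℝ) : ℂ) + 2 * I / Real.pi * (((1 : ℝ) : ℂ)
        + (((γ - Real.log 2 : ℝ) : ℂ) * ((0 : ℝ) : ℂ) + ((0 : ℝ) : ℂ)) - ((0 : ℝ) : ℂ)
        + 1 * (I * 0 - 1))) = 0 := by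
      push_cast; ring
    rw [e] at h
    refine h.congr' ?_
    filter_upwards [self_mem_nhdsWithin] with y hy
    have hy : 0 < y := hy
    have hy0 : (y : ℂ) ≠ 0 := by exact_mod_cast hy.ne'
    simp only [hD₁, hlap₁, besselY1']
    rw [Real.log_div hy.ne' two_ne_zero, ← hγ]
    push_cast
    field_simp
    ring
  have hD' : ∀ y : ℝ, 0 < y → HasDerivAt D (D₁ y) y := fun y hy =>
    ((hasDerivAt_besselJ0 y).ofReal_comp.add
      ((hasDerivAt_besselY0 hy).ofReal_comp.const_mul I)).add ((hasDerivAt_hlap hy).const_mul _)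
  have hD₁' : ∀ y : ℝ, 0 < y → HasDerivAt D₁ (-(D₁ y) / y - D y) y := by
    intro y hy
    refine (((hasDerivAt_besselJ1' hy).ofReal_comp.add
      ((hasDerivAt_besselY1' hy).ofReal_comp.const_mul I)).add
      ((hasDerivAt_hlap₁ hy).const_mul _)).congr_deriv ?_
    simp only [hD, hD₁, hankel0]
    push_cast
    ring
  have := eq_zero_of_bessel hD' hD₁' h0 h1 hx
  simp only [hD] at this
  linear_combination this

/-! ### The kernels in two and three dimensions -/

lemma outgoingKernel_two {k : ℝ} (hk : 0 < k) :
    OutgoingKernel 2 k (fun r => I / 4 * hankel0 (k * r))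
      (fun r => k / (2 * Real.pi) * hlap₁ (k * r)) := by
  have hpi : (Real.pi : ℂ) ≠ 0 := by exact_mod_cast Real.pi_ne_zero
  have e : ∀ r : ℝ, 0 < r → I / 4 * hankel0 (k * r) = 1 / (2 * Real.pi) * hlap (k * r) := by
    intro r hr
    rw [hankel0_eq (mul_pos hk hr)]
    field_simp
    linear_combination (-(4 * hlap (k * r))) * Complex.I_sq
  have hn : ∀ x : ℝ, ‖Complex.exp (I * x)‖ = 1 := fun x => by
    rw [mul_comm]; exact Complex.norm_exp_ofReal_mul_I x
  have hc : ∀ r : ℝ, HasDerivAt (fun r : ℝ => k * r) k r := fun r => by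
    simpa using (hasDerivAt_id r).const_mul k
  have hn2 : ‖(k / (2 * Real.pi) : ℂ)‖ = k / (2 * Real.pi) := by
    rw [show (k / (2 * Real.pi) : ℂ) = ((k / (2 * Real.pi) : ℝ) : ℂ) by push_cast; ring,
      Complex.norm_real, Real.norm_of_nonneg (by positivity)]
  have hn1 : ‖(1 / (2 * Real.pi) : ℂ)‖ = 1 / (2 * Real.pi) := by
    rw [show (1 / (2 * Real.pi) : ℂ) = ((1 / (2 * Real.pi) : ℝ) : ℂ) by push_cast; ring,
      Complex.norm_real, Real.norm_of_nonneg (by positivity)]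
  have hk0 : (k : ℂ) ≠ 0 := by exact_mod_cast hk.ne'
  refine ⟨fun r hr => ?_, fun r hr => ?_, ?_, ?_, ?_, ?_⟩
  · have h1 := ((hasDerivAt_hlap (mul_pos hk hr)).scomp r (hc r)).const_mul (1 / (2 * Real.pi : ℂ))
    refine (h1.congr_of_eventuallyEq ?_).congr_deriv ?_
    · filter_upwards [lt_mem_nhds hr] with s hs using e s hs
    · rw [Complex.real_smul]; ring
  · have h1 := ((hasDerivAt_hlap₁ (mul_pos hk hr)).scomp r (hc r)).const_mul
      (k / (2 * Real.pi) : ℂ)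
    refine h1.congr_deriv ?_
    have hr0 : (r : ℂ) ≠ 0 := by exact_mod_cast hr.ne'
    rw [e r hr, Complex.real_smul]
    push_cast
    field_simp
    ring
  · refine ⟨1 / (2 * Real.pi) * (Real.Gamma (1 / 2) * k ^ (-(1 / 2) : ℝ)), fun r hr => ?_⟩
    rw [e r hr, norm_mul, hlap, norm_mul, hn, one_mul, hn1, mul_assoc]
    refine mul_le_mul_of_nonneg_left ((norm_hmom_zero_le (mul_pos hk hr)).trans (le_of_eq ?_))
      (by positivity)
    rw [Real.mul_rpow hk.le hr.le]
    norm_num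
    ring
  · refine ⟨k / (2 * Real.pi) * (Real.Gamma (1 + 1 / 2) * k ^ (-(1 + 1 / 2) : ℝ)), fun r hr => ?_⟩
    have e2 : (k / (2 * Real.pi) * hlap₁ (k * r) - I * k * (I / 4 * hankel0 (k * r)) : ℂ)
        = k / (2 * Real.pi) * (-(Complex.exp (I * (k * r : ℝ)) * hmom 1 (k * r))) := by
      rw [e r hr, hlap₁, hlap]
      ring
    rw [e2, norm_mul, norm_neg, norm_mul, hn, one_mul, hn2, mul_assoc]
    have h := norm_hmom_le 1 (mul_pos hk hr)
    refine mul_le_mul_of_nonneg_left (h.trans (le_of_eq ?_)) (by positivity)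
    rw [Real.mul_rpow hk.le hr.le]
    norm_num
    ring
  · refine ⟨Real.Gamma (1 / 2) * (1 + k) + 1, fun r hr => ?_⟩
    have hkr := mul_pos hk hr
    have e2 : (r : ℂ) ^ (2 - 1) * (k / (2 * Real.pi) * hlap₁ (k * r))
        = 1 / (2 * Real.pi) * (Complex.exp (I * (k * r : ℝ))
          * (I * (((k * r : ℝ) : ℂ) * hmom 0 (k * r)) - ((k * r : ℝ) : ℂ) * hmom 1 (k * r))) := by
      rw [hlap₁]
      push_cast
      ring
    have h1 : ‖((k * r : ℝ) : ℂ) * hmom 0 (k * r)‖ ≤ Real.Gamma (1 / 2) * (1 + k * r) := by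
      rw [norm_mul, Complex.norm_real, Real.norm_of_nonneg hkr.le]
      have h2 := mul_le_mul_of_nonneg_left (norm_hmom_zero_le hkr) hkr.le
      have h3 : (k * r) * (k * r) ^ (-(1 / 2) : ℝ) = (k * r) ^ (1 / 2 : ℝ) := by
        rw [← Real.rpow_one_add' hkr.le (by norm_num)]; norm_num
      have h4 : (k * r) ^ (1 / 2 : ℝ) ≤ 1 + k * r := by
        rw [← Real.sqrt_eq_rpow]
        refine Real.sqrt_le_iff.2 ⟨by positivity, by nlinarith⟩
      calc _ ≤ _ := h2
        _ = Real.Gamma (1 / 2) * (k * r) ^ (1 / 2 : ℝ) := by rw [← h3]; ring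
        _ ≤ _ := mul_le_mul_of_nonneg_left h4 (Real.Gamma_pos_of_pos (by norm_num)).le
    have h2 := norm_mul_hmom_one_le hkr
    rw [e2, norm_mul, norm_mul, hn, one_mul, hn1]
    have h3 := norm_sub_le (I * (((k * r : ℝ) : ℂ) * hmom 0 (k * r)))
      (((k * r : ℝ) : ℂ) * hmom 1 (k * r))
    rw [norm_mul, Complex.norm_I, one_mul] at h3
    have h4 : (1 : ℝ) / (2 * Real.pi) ≤ 1 := by
      rw [div_le_one (by positivity)]
      linarith [Real.pi_gt_three]
    have hG : 0 < Real.Gamma (1 / 2) := Real.Gamma_pos_of_pos (by norm_num)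
    have h5 : Real.Gamma (1 / 2) * (1 + k * r) + 1
        ≤ (Real.Gamma (1 / 2) * (1 + k) + 1) * (1 + r) ^ 2 := by
      have h6 : 1 + k * r ≤ (1 + k) * (1 + r) ^ 2 := by nlinarith [mul_pos hk hr, sq_nonneg r]
      have h7 : (1 : ℝ) ≤ (1 + r) ^ 2 := by nlinarith
      nlinarith [mul_le_mul_of_nonneg_left h6 hG.le]
    calc _ ≤ 1 * (Real.Gamma (1 / 2) * (1 + k * r) + 1) :=
          mul_le_mul h4 (by linarith) (norm_nonneg _) zero_le_one
      _ ≤ _ := by rw [one_mul]; exact h5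
  · have hvol : volume.real (Metric.ball (0 : E 2) 1) = Real.pi := by
      rw [Measure.real, InnerProductSpace.volume_ball_of_dim_even (k := 1) (by simp)]
      simp [Real.pi_pos.le]
    rw [hvol]
    have hkr : Tendsto (fun r : ℝ => k * r) (𝓝[>] 0) (𝓝[>] 0) := by
      refine tendsto_nhdsWithin_iff.2 ⟨?_, ?_⟩
      · have : Continuous fun r : ℝ => k * r := by fun_prop
        have h := (this.tendsto 0).mono_left (nhdsWithin_le_nhds (s := Set.Ioi 0))
        simpa using h
      · filter_upwards [self_mem_nhdsWithin] with r hr using mul_pos hk hr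
    have cexp : Tendsto (fun x : ℝ => Complex.exp (I * x)) (𝓝[>] 0) (𝓝 1) := by
      have h : Continuous fun x : ℝ => Complex.exp (I * x) := by fun_prop
      have h2 := (h.tendsto 0).mono_left (nhdsWithin_le_nhds (s := Set.Ioi 0))
      simpa using h2
    have cxh0 : Tendsto (fun x : ℝ => (x : ℂ) * hmom 0 x) (𝓝[>] 0) (𝓝 0) :=
      tendsto_zero_iff_norm_tendsto_zero.2 tendsto_mul_hmom_zero
    have h := ((cexp.mul ((cxh0.const_mul I).sub tendsto_mul_hmom_one)).const_mul
      (1 / (Real.pi : ℂ))).comp hkr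
    have e3 : 1 / (Real.pi : ℂ) * (1 * (I * 0 - 1)) = -(Real.pi : ℂ)⁻¹ := by ring
    rw [e3] at h
    refine h.congr fun r => ?_
    simp only [Function.comp_apply, hlap₁]
    push_cast
    field_simp

lemma outgoingKernel_three {k : ℝ} (hk : 0 < k) :
    OutgoingKernel 3 k
      (fun r => Complex.exp (I * (k * r : ℝ)) / (4 * Real.pi * r : ℝ))
      (fun r => Complex.exp (I * (k * r : ℝ)) * (I * k / r - 1 / (r : ℂ) ^ 2)
        / (4 * Real.pi)) := by
  have hpi : (Real.pi : ℂ) ≠ 0 := by exact_mod_cast Real.pi_ne_zero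
  have hn : ∀ x : ℝ, ‖Complex.exp (I * x)‖ = 1 := fun x => by
    rw [mul_comm]; exact Complex.norm_exp_ofReal_mul_I x
  have hn4 : ‖(4 * Real.pi : ℂ)‖ = 4 * Real.pi := by simp [Real.pi_pos.le]
  have hexp : ∀ r : ℝ, HasDerivAt (fun r : ℝ => Complex.exp (I * (k * r : ℝ)))
      (Complex.exp (I * (k * r : ℝ)) * (I * k)) r := by
    intro r
    have := ((hasDerivAt_id r).const_mul k).ofReal_comp.const_mul I |>.cexp
    refine this.congr_deriv ?_
    simp
  refine ⟨fun r hr => ?_, fun r hr => ?_, ?_, ?_, ?_, ?_⟩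
  · have hr0 : (r : ℂ) ≠ 0 := by exact_mod_cast hr.ne'
    have h1 : HasDerivAt (fun r : ℝ => ((4 * Real.pi * r : ℝ) : ℂ)) (4 * Real.pi : ℂ) r := by
      refine (((hasDerivAt_id r).const_mul (4 * Real.pi)).ofReal_comp).congr_deriv ?_
      simp
    refine ((hexp r).div h1 (by simp [hr.ne', Real.pi_ne_zero])).congr_deriv ?_
    push_cast
    field_simp
  · have hr0 : (r : ℂ) ≠ 0 := by exact_mod_cast hr.ne'
    have h0 := Complex.ofRealCLM.hasDerivAt (x := r)
    have h1 := (((hasDerivAt_const r (I * k)).div h0 hr0).sub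
      ((hasDerivAt_const r (1 : ℂ)).div (h0.fun_pow 2) (pow_ne_zero 2 hr0)))
    refine (((hexp r).mul h1).div_const (4 * Real.pi : ℂ)).congr_deriv ?_
    simp only [Complex.ofRealCLM_apply, Pi.sub_apply, Pi.div_apply]
    push_cast
    field_simp
    ring_nf
    simp only [Complex.I_sq]
    ring
  · refine ⟨1 / (4 * Real.pi), fun r hr => ?_⟩
    rw [norm_div, hn, Complex.norm_real, Real.norm_of_nonneg (by positivity)]
    norm_num
    rw [Real.rpow_neg hr.le, Real.rpow_one]
    apply le_of_eq
    ring
  · refine ⟨1 / (4 * Real.pi), fun r hr => ?_⟩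
    have hr0 : (r : ℂ) ≠ 0 := by exact_mod_cast hr.ne'
    have e2 : Complex.exp (I * (k * r : ℝ)) * (I * k / r - 1 / (r : ℂ) ^ 2) / (4 * Real.pi)
        - I * k * (Complex.exp (I * (k * r : ℝ)) / (4 * Real.pi * r : ℝ))
        = -(Complex.exp (I * (k * r : ℝ)) / ((4 * Real.pi) * (r : ℂ) ^ 2)) := by
      push_cast
      field_simp
      ring
    rw [e2, norm_neg, norm_div, hn, norm_mul, hn4, norm_pow, Complex.norm_real,
      Real.norm_of_nonneg hr.le]
    norm_num
    apply le_of_eq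
    ring
  · refine ⟨k + 1, fun r hr => ?_⟩
    have hr0 : (r : ℂ) ≠ 0 := by exact_mod_cast hr.ne'
    have e2 : (r : ℂ) ^ (3 - 1) * (Complex.exp (I * (k * r : ℝ)) * (I * k / r - 1 / (r : ℂ) ^ 2)
        / (4 * Real.pi))
        = Complex.exp (I * (k * r : ℝ)) * (I * (k * r : ℝ) - 1) / (4 * Real.pi) := by
      push_cast
      field_simp
    rw [e2, norm_div, norm_mul, hn, one_mul, hn4, div_le_iff₀ (by positivity)]
    have h1 := norm_sub_le (I * ((k * r : ℝ) : ℂ)) 1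
    rw [norm_mul, Complex.norm_I, one_mul, Complex.norm_real,
      Real.norm_of_nonneg (mul_pos hk hr).le, norm_one] at h1
    have h3 : (1 : ℝ) + r ≤ (1 + r) ^ 3 := by nlinarith [sq_nonneg r, pow_pos hr 3]
    have h2 : k * r + 1 ≤ (k + 1) * (1 + r) ^ 3 := by nlinarith
    have h4 : (k + 1) * (1 + r) ^ 3 ≤ (k + 1) * (1 + r) ^ 3 * (4 * Real.pi) :=
      le_mul_of_one_le_right (by positivity) (by linarith [Real.pi_gt_three])
    linarith
  · have hvol : volume.real (Metric.ball (0 : E 3) 1) = 4 / 3 * Real.pi := by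
      rw [Measure.real, InnerProductSpace.volume_ball_of_dim_odd (k := 1) (by simp)]
      norm_num [Nat.doubleFactorial]
      rw [ENNReal.toReal_ofReal (by positivity)]
      ring
    rw [hvol]
    have hc : Continuous fun r : ℝ => (3 : ℂ) * (Complex.exp (I * (k * r : ℝ))
        * (I * (k * r : ℝ) - 1) / (4 * Real.pi)) := by fun_prop
    have h := (hc.tendsto 0).mono_left (nhdsWithin_le_nhds (s := Set.Ioi 0))
    have e3 : (3 : ℂ) * (Complex.exp (I * (k * 0 : ℝ)) * (I * (k * 0 : ℝ) - 1) / (4 * Real.pi))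
        = -((4 / 3 * Real.pi : ℝ) : ℂ)⁻¹ := by
      push_cast
      simp
      field_simp
    rw [e3] at h
    refine h.congr' ?_
    filter_upwards [self_mem_nhdsWithin] with r hr
    have hr0 : (r : ℂ) ≠ 0 := by exact_mod_cast (ne_of_gt hr)
    push_cast
    field_simp

/-! ### The equivalence -/

lemma MemLpComp.add_const_mul {n : ℕ} {f g : E n → ℂ} (hf : MemLpComp 2 f) (hg : MemLpComp 2 g)
    (c : ℂ) : MemLpComp 2 fun x => f x + c * g x := by
  obtain ⟨K, hK, hKf⟩ := hf.2
  obtain ⟨L, hL, hLg⟩ := hg.2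
  refine ⟨hf.1.add (hg.1.const_mul c), K ∪ L, hK.union hL, ?_⟩
  filter_upwards [hKf, hLg] with x h1 h2 hx
  rw [Set.mem_union, not_or] at hx
  rw [h1 hx.1, h2 hx.2, mul_zero, add_zero]

lemma MemL2Loc.integrable_mul_testFunction {n : ℕ} {u φ : E n → ℂ} (hu : MemL2Loc u)
    (hφ : IsTestFunction φ) : Integrable fun x => u x * φ x := by
  simpa only [mul_comm] using hu.integrable_mul hφ.1.continuous hφ.2

/-- A twice differentiable function solving the homogeneous Helmholtz equation in the sense of
distributions solves it pointwise. -/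
lemma helmholtz_of_distribution {n : ℕ} {k : ℝ} {s : E n → ℂ} (hs : ContDiff ℝ 2 s)
    (h : ∀ φ : E n → ℂ, IsTestFunction φ → ∫ x, s x * ((Δ φ) x + k ^ 2 * φ x) = 0) (x : E n) :
    (Δ s) x + (k : ℂ) ^ 2 * s x = 0 := by
  have hc : Continuous fun x => (Δ s) x + (k : ℂ) ^ 2 * s x :=
    (continuous_laplacian hs).add (continuous_const.mul hs.continuous)
  have hs2 : MemL2Loc s := hs.continuous.memL2Loc
  have hz : (fun x => (Δ s) x + (k : ℂ) ^ 2 * s x) =ᵐ[volume] fun _ => 0 := by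
    refine ae_eq_of_forall_testFunction hc.locallyIntegrable
      (continuous_const (y := (0 : ℂ))).locallyIntegrable fun φ hφ => ?_
    have i1 : Integrable fun x => s x * (Δ φ) x := hs2.integrable_mul_testFunction hφ.laplacian
    have i2 : Integrable fun x => s x * φ x := hs2.integrable_mul_testFunction hφ
    have i3 : ∀ L : E n → ℂ, Continuous L → Integrable fun x => L x * φ x := fun L hL =>
      hL.memL2Loc.integrable_mul_testFunction hφ
    have h1 := h φ hφ
    have e1 : ∀ x, s x * ((Δ φ) x + (k : ℂ) ^ 2 * φ x)
        = s x * (Δ φ) x + (k : ℂ) ^ 2 * (s x * φ x) := fun x => by ring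
    have e2 : ∀ x, φ x * ((Δ s) x + (k : ℂ) ^ 2 * s x)
        = (Δ s) x * φ x + (k : ℂ) ^ 2 * (s x * φ x) := fun x => by ring
    simp only [e1] at h1
    simp only [e2, mul_zero, integral_zero]
    rw [integral_add i1 (i2.const_mul _), integral_mul_laplacian_comm hs hφ.contDiff_two hφ.2] at h1
    rw [integral_add (i3 _ (continuous_laplacian hs)) (i2.const_mul _)]
    exact h1
  exact congrFun ((Continuous.ae_eq_iff_eq volume hc continuous_const).1 hz) x

namespace OutgoingKernel

variable {n : ℕ} {k : ℝ} {h h₁ : ℝ → ℂ} {f m u : E n → ℂ}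

/-- The right-hand side of the Lippmann–Schwinger equation is a single potential. -/
lemma newton_add_eq_potential (H : OutgoingKernel n k h h₁) (hn : 2 ≤ n)
    (hΦ : ∀ x y : E n, Phi k x y = h ‖x - y‖) (hf : MemLpComp 2 f) (hg : MemLpComp 2 u) (x : E n) :
    newton k f x + (k : ℂ) ^ 2 * newton k u x
      = potential h (fun y => f y + (k : ℂ) ^ 2 * u y) x := by
  simp only [newton, potential, hΦ]
  rw [← integral_const_mul, ← integral_add (H.integrable_potential_integrand hn hf x)
    ((H.integrable_potential_integrand hn hg x).const_mul _)]
  refine integral_congr_ae (Eventually.of_forall fun y => ?_)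
  simp only; ring

/-- Solutions of the Lippmann–Schwinger equation solve the full-space problem. -/
theorem isFSPSolution_of_lse (H : OutgoingKernel n k h h₁) (hn : 2 ≤ n)
    (hf : MemLpComp 2 f) (hm : MemLpComp ⊤ m) (hu : MemL2Loc u)
    (hLSE : u =ᵐ[volume] potential h fun y => f y + (k : ℂ) ^ 2 * (m y * u y)) :
    MemHLoc 2 u ∧ MemC0 u ∧ IsFSPSolution k m f u := by
  have hmu := hm.mul_memL2Loc hu
  set F : E n → ℂ := fun y => f y + (k : ℂ) ^ 2 * (m y * u y) with hF
  have hFc : MemLpComp 2 F := hf.add_const_mul hmu _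
  have hdist : ∀ φ : E n → ℂ, IsTestFunction φ →
      ∫ x, u x * ((Δ φ) x + k ^ 2 * φ x) = -∫ y, F y * φ y := by
    intro φ hφ
    rw [← H.integral_potential_mul_helmholtz hn hFc hφ]
    refine integral_congr_ae ?_
    filter_upwards [hLSE] with x hx
    rw [hx]
  have hsplit : ∀ φ : E n → ℂ, IsTestFunction φ →
      ∫ x, u x * ((Δ φ) x + k ^ 2 * φ x)
        = (∫ x, u x * (Δ φ) x) + (k : ℂ) ^ 2 * ∫ x, u x * φ x := by
    intro φ hφ
    rw [← integral_const_mul, ← integral_add (hu.integrable_mul_testFunction hφ.laplacian)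
      ((hu.integrable_mul_testFunction hφ).const_mul _)]
    refine integral_congr_ae (Eventually.of_forall fun y => ?_)
    simp only; ring
  have hFsplit : ∀ φ : E n → ℂ, IsTestFunction φ → ∫ y, F y * φ y
      = (∫ y, f y * φ y) + (k : ℂ) ^ 2 * ∫ y, (m y * u y) * φ y := by
    intro φ hφ
    rw [← integral_const_mul, ← integral_add (hf.memL2Loc.integrable_mul_testFunction hφ)
      ((hmu.memL2Loc.integrable_mul_testFunction hφ).const_mul _)]
    refine integral_congr_ae (Eventually.of_forall fun y => ?_)
    simp only [hF]; ring
  have h2 : MemHLoc 2 u := by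
    refine memHLoc_two (F := fun x => (-1) * F x + (-(k : ℂ) ^ 2) * u x) hu
      ((hFc.memL2Loc.const_mul _).add (hu.const_mul _)) fun φ hφ => ?_
    have e : ∀ x, ((-1) * F x + (-(k : ℂ) ^ 2) * u x) * φ x
        = (-1) * (F x * φ x) + (-(k : ℂ) ^ 2) * (u x * φ x) := fun x => by ring
    simp only [e]
    rw [integral_add ((hFc.memL2Loc.integrable_mul_testFunction hφ).const_mul _)
      ((hu.integrable_mul_testFunction hφ).const_mul _), integral_const_mul, integral_const_mul]
    linear_combination hdist φ hφ - hsplit φ hφ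
  refine ⟨h2, ⟨_, H.continuous_potential hn hFc, hLSE.symm⟩, h2.mono (by norm_num), fun φ hφ => ?_,
    _, hLSE.symm, H.radiation_potential hn hFc⟩
  have e : ∀ x, u x * (Δ φ) x + (k : ℂ) ^ 2 * (1 + m x) * u x * φ x
      = u x * (Δ φ) x + ((k : ℂ) ^ 2 * (u x * φ x) + (k : ℂ) ^ 2 * ((m x * u x) * φ x)) :=
    fun x => by ring
  have i1 := (hu.integrable_mul_testFunction hφ).const_mul ((k : ℂ) ^ 2)
  have i2 := (hmu.memL2Loc.integrable_mul_testFunction hφ).const_mul ((k : ℂ) ^ 2)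
  simp only [e]
  rw [integral_add (hu.integrable_mul_testFunction hφ.laplacian) (by exact i1.add i2),
    integral_add i1 i2, integral_const_mul, integral_const_mul]
  linear_combination hdist φ hφ - hsplit φ hφ - hFsplit φ hφ

/-- Solutions of the full-space problem solve the Lippmann–Schwinger equation: the difference of
the two sides is a radiating entire solution of the Helmholtz equation. -/
theorem lse_of_isFSPSolution (H : OutgoingKernel n k h h₁) (hn : 2 ≤ n) (hk : 0 < k)
    (hf : MemLpComp 2 f) (hm : MemLpComp ⊤ m) (hu : IsFSPSolution k m f u) :
    u =ᵐ[volume] potential h fun y => f y + (k : ℂ) ^ 2 * (m y * u y) := by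
  have hu2 : MemL2Loc u := hu.memHLoc.memL2Loc
  have hmu := hm.mul_memL2Loc hu2
  set F : E n → ℂ := fun y => f y + (k : ℂ) ^ 2 * (m y * u y) with hF
  have hFc : MemLpComp 2 F := hf.add_const_mul hmu _
  set v : E n → ℂ := potential h F with hv
  have hvc : Continuous v := H.continuous_potential hn hFc
  have hw : MemL2Loc fun x => u x - v x := hu2.sub hvc.memL2Loc
  have hθ : ∀ {φ : E n → ℂ}, IsTestFunction φ →
      IsTestFunction fun x => (Δ φ) x + (k : ℂ) ^ 2 * φ x := fun hφ =>
    ⟨hφ.laplacian.1.add (contDiff_const.mul hφ.1), hφ.laplacian.2.add hφ.2.mul_left⟩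
  have hwk : ∀ φ : E n → ℂ, IsTestFunction φ →
      ∫ x, (u x - v x) * ((Δ φ) x + k ^ 2 * φ x) = 0 := by
    intro φ hφ
    have iu := hu2.integrable_mul_testFunction (hθ hφ)
    have iv := hvc.memL2Loc.integrable_mul_testFunction (hθ hφ)
    have i1 := (hmu.memL2Loc.integrable_mul_testFunction hφ).const_mul ((k : ℂ) ^ 2)
    have h1 := hu.helmholtz φ hφ
    have e1 : ∀ x, u x * (Δ φ) x + (k : ℂ) ^ 2 * (1 + m x) * u x * φ x
        = u x * ((Δ φ) x + (k : ℂ) ^ 2 * φ x) + (k : ℂ) ^ 2 * ((m x * u x) * φ x) :=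
      fun x => by ring
    simp only [e1] at h1
    rw [integral_add iu i1] at h1
    have h2 := H.integral_potential_mul_helmholtz hn hFc hφ
    have h3 : ∫ y, F y * φ y = (∫ y, f y * φ y) + ∫ y, (k : ℂ) ^ 2 * ((m y * u y) * φ y) := by
      rw [← integral_add (hf.memL2Loc.integrable_mul_testFunction hφ) i1]
      refine integral_congr_ae (Eventually.of_forall fun y => ?_)
      simp only [hF]; ring
    simp only [sub_mul]
    rw [integral_sub iu iv, h2, h3]
    linear_combination h1
  obtain ⟨s, hs, hsw⟩ := exists_contDiff_of_helmholtz hw hwk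
  have hs2 : ContDiff ℝ 2 s := hs.of_le (WithTop.coe_le_coe.2 le_top)
  have hsΔ := helmholtz_of_distribution (k := k) hs2 fun φ hφ => by
    rw [← hwk φ hφ]
    refine integral_congr_ae ?_
    filter_upwards [hsw] with x hx
    rw [hx]
  -- the given representative of `u` agrees with `s + v` far out
  obtain ⟨v₀, hv₀, hv₀d, hv₀r⟩ := hu.radiation
  obtain ⟨hvd, hvr⟩ := H.radiation_potential hn hFc
  have hfar : ∀ᶠ x in Bornology.cobounded (E n), v₀ =ᶠ[𝓝 x] fun y => s y + v y := by
    rw [← comap_norm_atTop, eventually_comap] at hv₀d ⊢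
    obtain ⟨R, hR⟩ := eventually_atTop.1 hv₀d
    have hopen : IsOpen {x : E n | R < ‖x‖} := isOpen_lt continuous_const continuous_norm
    have heq : Set.EqOn v₀ (fun y => s y + v y) {x : E n | R < ‖x‖} := by
      refine Measure.eqOn_open_of_ae_eq (μ := volume) (ae_restrict_of_ae ?_) hopen
        (fun x hx => ((hR ‖x‖ (le_of_lt hx)) x rfl).continuousAt.continuousWithinAt)
        (hs.continuous.add hvc).continuousOn
      filter_upwards [hv₀, hsw] with x h1 h2
      rw [h1, h2]; ring
    filter_upwards [eventually_gt_atTop R] with r hr x hx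
    refine heq.eventuallyEq_of_mem (hopen.mem_nhds ?_)
    simpa [hx] using hr
  have hrad : (fun x => fderiv ℝ s x (‖x‖⁻¹ • x) - Complex.I * k * s x)
      =o[Bornology.cobounded (E n)] fun x => ‖x‖ ^ (-(((n : ℝ) - 1) / 2)) := by
    refine (hv₀r.sub hvr).congr' ?_ EventuallyEq.rfl
    filter_upwards [hfar, hvd] with x hx hxv
    have hsd : DifferentiableAt ℝ s x := hs2.differentiable (by norm_num) x
    rw [hx.fderiv_eq, hx.eq_of_nhds, fderiv_fun_add hsd hxv, add_apply]
    ring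
  have hs0 := eq_zero_of_radiating hn hk hs2 hsΔ hrad
  filter_upwards [hsw] with x hx
  rw [hs0 x] at hx
  linear_combination -hx

/-- The equivalence, for an arbitrary outgoing kernel. -/
theorem fsp_lse_equivalence (H : OutgoingKernel n k h h₁) (hn : 2 ≤ n) (hk : 0 < k)
    (hΦ : ∀ x y : E n, Phi k x y = h ‖x - y‖) (hf : MemLpComp 2 f) (hm : MemLpComp ⊤ m) :
    (∀ u : E n → ℂ, IsFSPSolution k m f u →
      MemHLoc 2 u ∧ MemC0 u ∧ SolvesLSE k m f u ∧
      ∀ v : E n → ℂ, Continuous v → v =ᵐ[volume] u →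
        ∀ x, Integrable (fun y => (f y + (k : ℂ) ^ 2 * m y * v y) * Phi k x y) ∧
          v x = ∫ y, (f y + (k : ℂ) ^ 2 * m y * v y) * Phi k x y) ∧
    (∀ u : E n → ℂ, MemL2Loc u → SolvesLSE k m f u →
      MemHLoc 2 u ∧ MemC0 u ∧ IsFSPSolution k m f u) := by
  refine ⟨fun u hu => ?_, fun u hu hLSE => ?_⟩
  · have hu2 : MemL2Loc u := hu.memHLoc.memL2Loc
    have hLSE := H.lse_of_isFSPSolution hn hk hf hm hu
    obtain ⟨h1, h2, -⟩ := H.isFSPSolution_of_lse hn hf hm hu2 hLSE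
    refine ⟨h1, h2, ?_, fun v hv hvu x => ?_⟩
    · refine hLSE.trans (Eventually.of_forall fun x => ?_)
      exact (H.newton_add_eq_potential hn hΦ hf (hm.mul_memL2Loc hu2) x).symm
    · have hv2 : MemL2Loc v := hu2.congr hvu.symm
      have hFc := hf.add_const_mul (hm.mul_memL2Loc hv2) ((k : ℂ) ^ 2)
      have e : ∀ y, h ‖x - y‖ * (f y + (k : ℂ) ^ 2 * (m y * v y))
          = (f y + (k : ℂ) ^ 2 * m y * v y) * Phi k x y := fun y => by
        rw [hΦ]; ring
      have hvpot : v =ᵐ[volume] potential h fun y => f y + (k : ℂ) ^ 2 * (m y * v y) := by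
        refine (hvu.trans hLSE).trans (Eventually.of_forall fun x => ?_)
        refine integral_congr_ae ?_
        filter_upwards [hvu] with y hy
        rw [hy]
      have hveq := (Continuous.ae_eq_iff_eq volume hv (H.continuous_potential hn hFc)).1 hvpot
      have hint := H.integrable_potential_integrand hn hFc x
      simp only [e] at hint
      refine ⟨hint, (congrFun hveq x).trans ?_⟩
      simp only [potential, e]
  · refine H.isFSPSolution_of_lse hn hf hm hu (hLSE.trans (Eventually.of_forall fun x => ?_))
    exact H.newton_add_eq_potential hn hΦ hf (hm.mul_memL2Loc hu) x

end OutgoingKernel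

end Helmholtz

end

theorem theorem2p5 (n : ℕ) (hn : n = 2 ∨ n = 3) (k : ℝ) (hk : 0 < k)
    (f : Helmholtz.E n → ℂ) (hf : Helmholtz.MemLpComp 2 f)
    (m : Helmholtz.E n → ℂ) (hm : Helmholtz.MemLpComp ⊤ m) :
    (∀ u : Helmholtz.E n → ℂ, Helmholtz.IsFSPSolution k m f u →
      Helmholtz.MemHLoc 2 u ∧ Helmholtz.MemC0 u ∧ Helmholtz.SolvesLSE k m f u ∧
      ∀ v : Helmholtz.E n → ℂ, Continuous v → v =ᵐ[volume] u →
        ∀ x, Integrable (fun y => (f y + (k : ℂ) ^ 2 * m y * v y) * Helmholtz.Phi k x y) ∧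
          v x = ∫ y, (f y + (k : ℂ) ^ 2 * m y * v y) * Helmholtz.Phi k x y) ∧
    (∀ u : Helmholtz.E n → ℂ, Helmholtz.MemL2Loc u → Helmholtz.SolvesLSE k m f u →
      Helmholtz.MemHLoc 2 u ∧ Helmholtz.MemC0 u ∧ Helmholtz.IsFSPSolution k m f u) := by
  rcases hn with rfl | rfl
  · exact (Helmholtz.outgoingKernel_two hk).fsp_lse_equivalence le_rfl hk
      (fun x y => by simp [Helmholtz.Phi]) hf hm
  · exact (Helmholtz.outgoingKernel_three hk).fsp_lse_equivalence (by norm_num) hk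
      (fun x y => by simp [Helmholtz.Phi]) hf hm
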